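/- Let $(\Omega,\mathcal F,\mathbb P)$ be a probability space, $\mathbb T:\Omega\to\Omega$ a bijective bimeasurable transformation preserving $\mathbb P$, $\mathcal F_0\subseteq\mathcal F$ a $\sigma$-algebra with $\mathcal F_0\subseteq\mathbb T^{-1}(\mathcal F_0)$, and $\mathcal F_i=\mathbb T^{-i}(\mathcal F_0)$ for $i\in\mathbb Z$. Let $\epsilon_0\in\mathbb L^2$ with $\mathbb E(\epsilon_0)=0$ and $\epsilon_i=\epsilon_0\circ\mathbb T^i$. Assume that $\mathcal F_{-\infty}=\bigcap_i\mathcal F_i$ is trivial, that $\epsilon_0$ is measurable with respect to $\mathcal F_\infty=\bigvee_i\mathcal F_i$, and, with $P_0(Z)=\mathbb E(Z|\mathcal F_0)-\mathbb E(Z|\mathcal F_{-1})$, that $$\text{(C1)}\qquad \sum_{i\in\mathbb Z}\|P_0(\epsilon_i)\|_{\mathbb L^2}<\infty .$$ Let $X=(x_{i,j})_{i\ge1,\,1\le j\le p}$ be a random array of reals, independent of $(\epsilon_i)_{i\in\mathbb Z}$; for each $n$ the design matrix, also denoted by $X$, consists of the first $n$ rows. Let $d_j(n)=(\sum_{i=1}^n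 x_{i,j}^2)^{1/2}$ and $D(n)=\mathrm{diag}(d_1(n),\dots,d_p(n))$. Assume that almost surely, for all $j,l\in\{1,\dots,p\}$ and all integers $k\ge0$, $$\text{(C2)}\ \ d_j(n)\to\infty,\qquad \text{(C3)}\ \ \frac{\sup_{1\le i\le n}|x_{i,j}|}{d_j(n)}\to0,\qquad \text{(C4)}\ \ \rho_{j,l}(k)=\lim_{n\to\infty}\sum_{m=1}^{n-k}\frac{x_{m,j}x_{m+k,l}}{d_j(n)d_l(n)}\ \text{exists},$$ and (C5) the matrix $R(0)$ is positive definite, where $R(k)=[\rho_{j,l}(k)]_{j,l}$. Let $\beta\in\mathbb R^p$ and $Y=X\beta+\epsilon$, that is, $Y_i=\sum_{j}x_{i,j}\beta_j+\epsilon_i$ for $1\le i\le n$. Let $K:\mathbb R\to\mathbb R$ be a continuous, nonnegative, even function with compact support, $K(0)=1$ and integrable Fourier transform. Let $(h_n)$ be positive reals with $h_n\to\infty$ and $$h_n\,\mathbb E\Big(|\epsilon_0|^2\big(1\wedge\tfrac{h_n}{n}|\epsilon_0|^2\big)\Big)\to0 .$$ Let $\hat\beta=(X^tX)^{-1}X^tY$,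 $\hat\epsilon_i=Y_i-\sum_jx_{i,j}\hat\beta_j$ for $1\le i\le n$, $\hat\gamma^*_k=\frac1n\sum_{i=1}^{n-|k|}\hat\epsilon_i\hat\epsilon_{i+|k|}$, $\widehat\Gamma^*_{n,h_n}=\big[K\big(\tfrac{j-l}{h_n}\big)\hat\gamma^*_{j-l}\big]_{1\le j,l\le n}$ and $$C_n=D(n)(X^tX)^{-1}X^t\,\widehat\Gamma^*_{n,h_n}\,X(X^tX)^{-1}D(n).$$ Then the autocovariances $\gamma(k)=\mathbb E(\epsilon_0\epsilon_k)$ satisfy $\sum_{k\in\mathbb Z}|\gamma(k)|<\infty$, and $f(\lambda)=\frac1{2\pi}\sum_{k\in\mathbb Z}\gamma(k)e^{ik\lambda}$ is the spectral density of the errors: $\gamma(k)=\int_{-\pi}^{\pi}e^{ik\lambda}f(\lambda)\,d\lambda$ for all $k\in\mathbb Z$. Almost surely there is a measure $F_X$ on $[-\pi,\pi]$ whose values are Hermitian positive semidefinite $p\times p$ matrices, with $R(k)=\int_{-\pi}^{\pi}e^{ik\lambda}F_X(d\lambda)$ for all $k\ge0$. With $$F=\frac1{2\pi}\int_{-\pi}^{\pi}F_X(d\lambda),\qquad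 G=\frac1{2\pi}\int_{-\pi}^{\pi}f(\lambda)F_X(d\lambda),\qquad C=F^{-1}GF^{-1},$$ the estimator $C_n$ is consistent: for all $j,l\in\{1,\dots,p\}$, $$\mathbb E\big(|(C_n)_{j,l}-C_{j,l}|\ \big|\ X\big)\xrightarrow[n\to\infty]{}0\quad\text{almost surely},$$ where the conditional expectation is given the whole array $X$, in the sense of nonnegative random variables (with values in $[0,\infty]$). -/

import Mathlib

open MeasureTheory ProbabilityTheory Filter Topology Matrix
open scoped ENNReal ComplexOrder FourierTransform

noncomputable section

namespace HannanRegression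

/-! ### The error process -/

section Errors

variable {Ω : Type*}

/-- The iterate `T^i`, `i ∈ ℤ`, of a bijective bimeasurable transformation. -/
def iter {mΩ : MeasurableSpace Ω} (T : Ω ≃ᵐ Ω) (i : ℤ) : Ω → Ω :=
  ⇑((T.toEquiv : Equiv.Perm Ω) ^ i)

/-- The process `ε_i = ε_0 ∘ T^i`. -/
def process {mΩ : MeasurableSpace Ω} (T : Ω ≃ᵐ Ω) (ε₀ : Ω → ℝ) (i : ℤ) : Ω → ℝ :=
  fun ω => ε₀ (iter T i ω)

/-- The σ-algebra `F_i = T^{-i}(F_0)`. -/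
abbrev shiftAlgebra {mΩ : MeasurableSpace Ω} (T : Ω ≃ᵐ Ω) (F₀ : MeasurableSpace Ω) (i : ℤ) :
    MeasurableSpace Ω :=
  F₀.comap (iter T i)

/-- The operator `P_j(Z) = E(Z | F_j) - E(Z | F_{j-1})`. -/
def proj {mΩ : MeasurableSpace Ω} (μ : Measure Ω) (T : Ω ≃ᵐ Ω) (F₀ : MeasurableSpace Ω) (j : ℤ)
    (Z : Ω → ℝ) : Ω → ℝ :=
  μ[Z|shiftAlgebra T F₀ j] - μ[Z|shiftAlgebra T F₀ (j - 1)]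

/-- A square integrable, centered, stationary error process `ε_i = ε_0 ∘ T^i`, regular with respect
to the filtration `F_i = T^{-i}(F_0)`, which satisfies Hannan's condition. -/
structure IsHannanProcess (F₀ : MeasurableSpace Ω) {mΩ : MeasurableSpace Ω} (μ : Measure Ω)
    (T : Ω ≃ᵐ Ω) (ε₀ : Ω → ℝ) : Prop where
  measurePreserving : MeasurePreserving T μ μ
  memLp : MemLp ε₀ 2 μ
  mean_zero : ∫ ω, ε₀ ω ∂μ = 0
  sub_algebra : F₀ ≤ mΩ
  mono : F₀ ≤ shiftAlgebra T F₀ 1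
  tail_trivial : ∀ A : Set Ω, MeasurableSet[⨅ i : ℤ, shiftAlgebra T F₀ i] A → μ A = 0 ∨ μ A = 1
  measurable_top : Measurable[⨆ i : ℤ, shiftAlgebra T F₀ i] ε₀
  hannan : ∑' i : ℤ, eLpNorm (proj μ T F₀ 0 (process T ε₀ i)) 2 μ < ∞

/-- The autocovariance `γ(k) = E(ε_0 ε_k)` of a centered stationary process. -/
def autocov {mΩ : MeasurableSpace Ω} (μ : Measure Ω) (T : Ω ≃ᵐ Ω) (ε₀ : Ω → ℝ) (k : ℤ) : ℝ :=
  ∫ ω, process T ε₀ 0 ω * process T ε₀ k ω ∂μ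

/-- The (continuous version of the) spectral density `f(t) = (2π)⁻¹ ∑_k γ(k) e^{ikt}`. -/
def spectralDensity (γ : ℤ → ℝ) (t : ℝ) : ℂ :=
  (2 * (Real.pi : ℂ))⁻¹ * ∑' k : ℤ, (γ k : ℂ) * Complex.exp (Complex.I * k * t)

end Errors

/-! ### The design

A realization of the design is an array `x : ℕ → Fin p → ℝ`, where `x i` is the row number `i + 1`.
The `n × p` design matrix consists of the first `n` rows. -/

section Design

variable {p : ℕ}

/-- The `n × p` design matrix. -/
def designMatrix (x : ℕ → Fin p → ℝ) (n : ℕ) : Matrix (Fin n) (Fin p) ℝ :=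
  Matrix.of fun i j => x i j

/-- `d_j(n)`, the Euclidean norm of the `j`-th column of the `n × p` design matrix. -/
def colNorm (x : ℕ → Fin p → ℝ) (n : ℕ) (j : Fin p) : ℝ :=
  √(∑ i ∈ Finset.range n, x i j ^ 2)

/-- The diagonal matrix `D(n)` of the column norms. -/
def colNormMatrix (x : ℕ → Fin p → ℝ) (n : ℕ) : Matrix (Fin p) (Fin p) ℝ :=
  Matrix.diagonal (colNorm x n)

/-- `∑_{m=1}^{n-k} x_{m,j} x_{m+k,l} / (d_j(n) d_l(n))`. -/
def lagCorr (x : ℕ → Fin p → ℝ) (n k : ℕ) (j l : Fin p) : ℝ :=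
  ∑ m ∈ Finset.range (n - k), x m j * x (m + k) l / (colNorm x n j * colNorm x n l)

/-- The matrix `R(k) = [ρ_{j,l}(k)]` of the limits of `lagCorr x n k j l` as `n → ∞`. -/
def lagLimit (x : ℕ → Fin p → ℝ) (k : ℕ) : Matrix (Fin p) (Fin p) ℝ :=
  Matrix.of fun j l => limUnder atTop fun n => lagCorr x n k j l

/-- Hannan's conditions on (a realization of) the design. -/
structure IsHannanDesign (x : ℕ → Fin p → ℝ) : Prop where
  colNorm_tendsto : ∀ j, Tendsto (fun n => colNorm x n j) atTop atTop
  sup_div_tendsto : ∀ j, Tendsto (fun n => (⨆ i : Fin n, |x i j|) / colNorm x n j) atTop (𝓝 0)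
  lag_limit_exists : ∀ (k : ℕ) (j l : Fin p),
    ∃ r : ℝ, Tendsto (fun n => lagCorr x n k j l) atTop (𝓝 r)
  posDef : (lagLimit x 0).PosDef

/-- A `p × p` matrix of complex measures on `[-π, π]`. -/
abbrev MatrixMeasure (p : ℕ) : Type :=
  Matrix (Fin p) (Fin p) (ComplexMeasure (Set.Icc (-Real.pi) Real.pi))

/-- The entrywise integral `∫_{-π}^{π} g(t) M(dt)`. -/
def MatrixMeasure.integral (M : MatrixMeasure p) (g : ℝ → ℂ) : Matrix (Fin p) (Fin p) ℂ :=
  Matrix.of fun j l => VectorMeasure.integral (M j l)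
    (fun t : Set.Icc (-Real.pi) Real.pi => g t) (ContinuousLinearMap.mul ℝ ℂ)

/-- `M` is a spectral measure of `(R(k))_{k ≥ 0}`: it takes Hermitian positive semidefinite values
and `R(k) = ∫_{-π}^{π} e^{ikt} M(dt)` for all `k ≥ 0`. -/
structure IsSpectralMeasure (R : ℕ → Matrix (Fin p) (Fin p) ℝ) (M : MatrixMeasure p) : Prop where
  posSemidef : ∀ A : Set (Set.Icc (-Real.pi) Real.pi), MeasurableSet A →
    (Matrix.of fun j l => M j l A).PosSemidef
  fourier : ∀ k : ℕ,
    (R k).map (fun r : ℝ => (r : ℂ)) = M.integral fun t => Complex.exp (Complex.I * k * t)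

open scoped Classical in
/-- The spectral measure `F_X` of the limits `R(k)` of the design (`0` if there is none). -/
def spectralMeasure (x : ℕ → Fin p → ℝ) : MatrixMeasure p :=
  if h : ∃ M, IsSpectralMeasure (lagLimit x) M then h.choose else 0

/-- `F = (2π)⁻¹ ∫_{-π}^{π} F_X(dt)`. -/
def matF (x : ℕ → Fin p → ℝ) : Matrix (Fin p) (Fin p) ℂ :=
  (2 * (Real.pi : ℂ))⁻¹ • (spectralMeasure x).integral fun _ => 1

/-- `G = (2π)⁻¹ ∫_{-π}^{π} f(t) F_X(dt)`. -/
def matG (f : ℝ → ℂ) (x : ℕ → Fin p → ℝ) : Matrix (Fin p) (Fin p) ℂ :=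
  (2 * (Real.pi : ℂ))⁻¹ • (spectralMeasure x).integral f

/-- The limiting covariance matrix `C = F⁻¹ G F⁻¹`. -/
def limitCov (f : ℝ → ℂ) (x : ℕ → Fin p → ℝ) : Matrix (Fin p) (Fin p) ℂ :=
  (matF x)⁻¹ * matG f x * (matF x)⁻¹

end Design

/-! ### The estimator -/

section Estimator

variable {p : ℕ}

/-- The least square estimator `(XᵗX)⁻¹ Xᵗ Y` from the first `n` observations. -/
def leastSquares (x : ℕ → Fin p → ℝ) (y : ℕ → ℝ) (n : ℕ) : Fin p → ℝ :=
  ((designMatrix x n)ᵀ * designMatrix x n)⁻¹ *ᵥ ((designMatrix x n)ᵀ *ᵥ fun i : Fin n => y i)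

/-- The residuals of the least square fit to the first `n` observations; only the indices `i < n`
are used. -/
def residual (x : ℕ → Fin p → ℝ) (y : ℕ → ℝ) (n : ℕ) (i : ℕ) : ℝ :=
  y i - ∑ j, x i j * leastSquares x y n j

/-- `n⁻¹ ∑_{j=1}^{n-|k|} e_j e_{j+|k|}`. -/
def empAutocov (e : ℕ → ℝ) (n : ℕ) (k : ℤ) : ℝ :=
  (n : ℝ)⁻¹ * ∑ i ∈ Finset.range (n - k.natAbs), e i * e (i + k.natAbs)

/-- The tapered empirical covariance matrix `[K((j-l)/h) γ̂_{j-l}]`. -/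
def taperedCov (K : ℝ → ℝ) (h : ℝ) (e : ℕ → ℝ) (n : ℕ) : Matrix (Fin n) (Fin n) ℝ :=
  Matrix.of fun j l => K (((j : ℝ) - (l : ℝ)) / h) * empAutocov e n ((j : ℤ) - (l : ℤ))

/-- The estimator `C_n = D(n) (XᵗX)⁻¹ Xᵗ Γ̂* X (XᵗX)⁻¹ D(n)`, with `Γ̂*` the tapered covariance matrix
of the residuals. -/
def covEstimator (K : ℝ → ℝ) (h : ℝ) (x : ℕ → Fin p → ℝ) (y : ℕ → ℝ) (n : ℕ) :
    Matrix (Fin p) (Fin p) ℝ :=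
  colNormMatrix x n * ((designMatrix x n)ᵀ * designMatrix x n)⁻¹ * (designMatrix x n)ᵀ *
    taperedCov K h (residual x y n) n *
    designMatrix x n * ((designMatrix x n)ᵀ * designMatrix x n)⁻¹ * colNormMatrix x n

/-- The conditions on the kernel. -/
structure IsTaperKernel (K : ℝ → ℝ) : Prop where
  nonneg : ∀ t, 0 ≤ K t
  symm : ∀ t, K (-t) = K t
  zero : K 0 = 1
  continuous : Continuous K
  compactSupport : HasCompactSupport K
  integrable_fourier : Integrable (𝓕 fun t => (K t : ℂ))

end Estimator

/-- The observations `Y = Xβ + ε`; index `i` is the observation number `i + 1`. -/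
def response {Ω : Type*} {mΩ : MeasurableSpace Ω} {p : ℕ} (T : Ω ≃ᵐ Ω) (ε₀ : Ω → ℝ)
    (X : Ω → ℕ → Fin p → ℝ) (β : Fin p → ℝ) (ω : Ω) (i : ℕ) : ℝ :=
  ∑ j, X ω i j * β j + process T ε₀ (i + 1) ω

end HannanRegression

end

/-! The design is independent of the errors, so conditioning on `X` amounts to freezing the design
and integrating over the errors (`condLExp_comap_of_indepFun`). It therefore suffices to prove
convergence in L¹ for each fixed array `x` satisfying Hannan's conditions.

Let z_j be the j-th column divided by d_j(n), and R_n the Gram matrix of these columns. Summing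
along diagonals in the other order gives C_n = R_n⁻¹ A_n R_n⁻¹, where the entry (j, l) of A_n is n⁻¹
∑_{a,b} w_n(b - a) ε̂_a ε̂_b with w_n(k) = K(k/h_n) ∑_m z_{m,j} z_{m+k,l} (`covEstimator_eq`). Since
R_n → R(0) and w_n(k) → ρ_{j,l}(k), the point is that such a quadratic form converges in L¹ to ∑_k
γ(k) ρ_{j,l}(k).

Three facts carry this. First, Hannan's condition gives the Bessel inequality ‖∑ c_a ε_a‖ ≤ H |c|
with H = ∑_j ‖P_0(ε_j)‖, because ε is a sum over j of orthogonal sequences of norms ‖P_0(ε_j)‖; the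
same bound for remainders makes ε close, in the Bessel sense, to a finite moving sum of bounded
martingale differences (`exists_approx`). Second, the form with weights w_n is bounded in L¹ by C n
H_u H_v on Bessel sequences, uniformly in h_n: without the taper it is a sum of products of shifted
linear forms, and the taper is an average of modulations because its Fourier transform is integrable
(`integral_abs_lagForm_taper_le`). Third, ∑_k w_n(k)² = O(h_n) = o(n), since the taper has compact
support and |∑_m z_{m,j} z_{m+k,l}| ≤ 1; the bandwidth condition gives h_n/n → 0 unless the errors
vanish.

By the second fact the error process may be replaced by the moving sum. For the latter, finitely
many lags are handled by the mean ergodic theorem, and the products over the remaining lags form a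
martingale difference array, so that their sum has norm O(√(n ∑_k w_n(k)²)) = o(n)
(`tendsto_lagForm_movingSum`). The residuals differ from the errors by a combination of the p
normalized columns with coefficients bounded in L²; by the third fact such a perturbation is
negligible (`integral_abs_lagForm_sub_le`).

On the spectral side, F_X is a weak limit of the matrix measures with densities ζ̄_j ζ_l, where ζ_j
is the trigonometric polynomial with coefficients z_j (`exists_matrix_limit`). Integrating the
Fourier series of f term by term gives G = (2π)⁻² ∑_k γ(k) R(k), while F = (2π)⁻¹ R(0), hence C =
R(0)⁻¹ (∑_k γ(k) R(k)) R(0)⁻¹ (`limitCov_eq`). -/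

noncomputable section

namespace HannanRegression

/-! ### Bessel sequences in `L²` -/

section Bessel

variable {Ω : Type*} {mΩ : MeasurableSpace Ω} {μ : Measure Ω} {f g : Ω → ℝ}

/-- The `L²` norm of a function, as a real number. -/
def l2norm (μ : Measure Ω) (f : Ω → ℝ) : ℝ := (eLpNorm f 2 μ).toReal

lemma l2norm_nonneg : 0 ≤ l2norm μ f := ENNReal.toReal_nonneg

lemma l2norm_congr (h : f =ᵐ[μ] g) : l2norm μ f = l2norm μ g := by
  rw [l2norm, l2norm, eLpNorm_congr_ae h]

lemma l2norm_add_le (hf : MemLp f 2 μ) (hg : MemLp g 2 μ) :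
    l2norm μ (fun ω => f ω + g ω) ≤ l2norm μ f + l2norm μ g := by
  rw [l2norm, l2norm, l2norm, ← ENNReal.toReal_add hf.2.ne hg.2.ne]
  exact ENNReal.toReal_mono (by finiteness [hf.2.ne, hg.2.ne])
    (eLpNorm_add_le hf.1 hg.1 (by norm_num))

lemma l2norm_const_mul (c : ℝ) : l2norm μ (fun ω => c * f ω) = |c| * l2norm μ f := by
  have := eLpNorm_const_smul c f 2 μ
  rw [l2norm, l2norm]
  change (eLpNorm (c • f) 2 μ).toReal = _
  rw [this]
  simp

lemma l2norm_neg : l2norm μ (fun ω => - f ω) = l2norm μ f := by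
  simpa using l2norm_const_mul (μ := μ) (f := f) (-1)

lemma l2norm_sum_le {ι : Type*} (s : Finset ι) {f : ι → Ω → ℝ} (hf : ∀ i ∈ s, MemLp (f i) 2 μ) :
    l2norm μ (fun ω => ∑ i ∈ s, f i ω) ≤ ∑ i ∈ s, l2norm μ (f i) := by
  classical
  induction s using Finset.induction_on with
  | empty => simp [l2norm]
  | insert i s his ih =>
    simp only [Finset.sum_insert his]
    have h1 : ∀ j ∈ s, MemLp (f j) 2 μ := fun j hj => hf j (Finset.mem_insert_of_mem hj)
    exact (l2norm_add_le (hf i (Finset.mem_insert_self _ _)) (memLp_finsetSum s h1)).trans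
      (by gcongr; exact ih h1)

lemma l2norm_sq (hf : MemLp f 2 μ) : l2norm μ f ^ 2 = ∫ ω, f ω ^ 2 ∂μ := by
  rw [l2norm, hf.eLpNorm_eq_integral_rpow_norm (by norm_num) (by norm_num)]
  have h0 : 0 ≤ ∫ a, ‖f a‖ ^ (2 : ℝ≥0∞).toReal ∂μ := by positivity
  rw [ENNReal.toReal_ofReal (by positivity)]
  simp only [ENNReal.toReal_ofNat] at *
  rw [← Real.rpow_natCast, ← Real.rpow_mul h0]
  simp

lemma l2norm_le_of_sq_le {C : ℝ} (hf : MemLp f 2 μ) (hC : 0 ≤ C)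
    (h : ∫ ω, f ω ^ 2 ∂μ ≤ C ^ 2) : l2norm μ f ≤ C := by
  rw [← l2norm_sq hf] at h
  exact le_of_sq_le_sq h hC

lemma integral_abs_mul_le (hf : MemLp f 2 μ) (hg : MemLp g 2 μ) :
    ∫ ω, |f ω * g ω| ∂μ ≤ l2norm μ f * l2norm μ g := by
  have h := integral_mul_norm_le_Lp_mul_Lq (μ := μ) (f := f) (g := g) (p := 2) (q := 2)
    (by constructor <;> norm_num) (by simpa using hf) (by simpa using hg)
  simp only [abs_mul]
  refine h.trans_eq ?_
  have key : ∀ {f : Ω → ℝ}, MemLp f 2 μ → (∫ a, ‖f a‖ ^ (2 : ℝ) ∂μ) ^ (1 / (2 : ℝ)) = l2norm μ f := by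
    intro f hf
    have : ∫ a, ‖f a‖ ^ (2 : ℝ) ∂μ = l2norm μ f ^ 2 := by
      rw [l2norm_sq hf]
      simp
    rw [this, ← Real.sqrt_eq_rpow, Real.sqrt_sq l2norm_nonneg]
  rw [key hf, key hg]

lemma integral_abs_le_l2norm [IsProbabilityMeasure μ] (hf : MemLp f 2 μ) :
    ∫ ω, |f ω| ∂μ ≤ l2norm μ f := by
  have h := integral_abs_mul_le hf (memLp_const (1 : ℝ) (μ := μ))
  have h1 : l2norm μ (fun _ : Ω => (1 : ℝ)) = 1 := by
    rw [l2norm, eLpNorm_const _ (by norm_num) (IsProbabilityMeasure.ne_zero μ)]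
    simp
  simpa [h1] using h

lemma memLp_linear_combination {ι : Type*} (s : Finset ι) (c : ι → ℝ) {f : ι → Ω → ℝ}
    (hf : ∀ i, MemLp (f i) 2 μ) : MemLp (fun ω => ∑ i ∈ s, c i * f i ω) 2 μ :=
  memLp_finsetSum s fun i _ => (hf i).const_mul _

/-- The `L²` norm of a sum of pairwise orthogonal functions. -/
lemma integral_sum_sq_of_orthogonal {ι : Type*} (s : Finset ι) {f : ι → Ω → ℝ}
    (hf : ∀ i ∈ s, MemLp (f i) 2 μ)
    (h : ∀ i ∈ s, ∀ j ∈ s, i ≠ j → ∫ ω, f i ω * f j ω ∂μ = 0) :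
    ∫ ω, (∑ i ∈ s, f i ω) ^ 2 ∂μ = ∑ i ∈ s, ∫ ω, f i ω ^ 2 ∂μ := by
  have hint : ∀ i ∈ s, ∀ j ∈ s, Integrable (fun ω => f i ω * f j ω) μ :=
    fun i hi j hj => (hf i hi).integrable_mul (hf j hj)
  simp only [sq, Finset.sum_mul_sum]
  rw [integral_finsetSum _ fun i hi => integrable_finsetSum _ fun j hj => hint i hi j hj]
  refine Finset.sum_congr rfl fun i hi => ?_
  rw [integral_finsetSum _ fun j hj => hint i hi j hj,
    Finset.sum_eq_single_of_mem i hi fun j hj hji => h i hi j hj hji.symm]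

/-- The sequence `u` of square integrable functions has the Bessel bound `H`: the linear
combination with coefficients `c` has norm at most `H` times the Euclidean norm of `c`. -/
structure IsBessel (μ : Measure Ω) (u : ℕ → Ω → ℝ) (H : ℝ) : Prop where
  memLp : ∀ a, MemLp (u a) 2 μ
  nonneg : 0 ≤ H
  bound : ∀ (n : ℕ) (c : ℕ → ℝ), l2norm μ (fun ω => ∑ a ∈ Finset.range n, c a * u a ω) ≤
    H * √(∑ a ∈ Finset.range n, c a ^ 2)

namespace IsBessel

variable {u v : ℕ → Ω → ℝ} {H H' : ℝ}

lemma mono (hu : IsBessel μ u H) (h : H ≤ H') : IsBessel μ u H' where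
  memLp := hu.memLp
  nonneg := hu.nonneg.trans h
  bound n c := (hu.bound n c).trans (by gcongr)

lemma congr_ae (hu : IsBessel μ u H) (h : ∀ a, u a =ᵐ[μ] v a) : IsBessel μ v H where
  memLp a := (memLp_congr_ae (h a)).1 (hu.memLp a)
  nonneg := hu.nonneg
  bound n c := by
    rw [l2norm_congr (g := fun ω => ∑ a ∈ Finset.range n, c a * u a ω)]
    · exact hu.bound n c
    · filter_upwards [ae_all_iff.2 h] with ω hω
      simp [hω]

lemma add (hu : IsBessel μ u H) (hv : IsBessel μ v H') :
    IsBessel μ (fun a ω => u a ω + v a ω) (H + H') where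
  memLp a := (hu.memLp a).add (hv.memLp a)
  nonneg := add_nonneg hu.nonneg hv.nonneg
  bound n c := by
    simp only [mul_add, Finset.sum_add_distrib]
    refine (l2norm_add_le (memLp_linear_combination _ _ hu.memLp)
      (memLp_linear_combination _ _ hv.memLp)).trans ?_
    rw [add_mul]
    exact add_le_add (hu.bound n c) (hv.bound n c)

lemma neg (hu : IsBessel μ u H) : IsBessel μ (fun a ω => - u a ω) H where
  memLp a := (hu.memLp a).neg
  nonneg := hu.nonneg
  bound n c := by
    simp only [mul_neg, Finset.sum_neg_distrib, l2norm_neg]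
    exact hu.bound n c

lemma sub (hu : IsBessel μ u H) (hv : IsBessel μ v H') :
    IsBessel μ (fun a ω => u a ω - v a ω) (H + H') := by
  simpa only [sub_eq_add_neg] using hu.add hv.neg

lemma sum {ι : Type*} (s : Finset ι) {u : ι → ℕ → Ω → ℝ} {H : ι → ℝ}
    (h : ∀ i ∈ s, IsBessel μ (u i) (H i)) :
    IsBessel μ (fun a ω => ∑ i ∈ s, u i a ω) (∑ i ∈ s, H i) := by
  classical
  induction s using Finset.induction_on with
  | empty =>
    exact ⟨fun a => by simp, by simp, fun n c => by simp [l2norm]⟩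
  | insert i s his ih =>
    simp only [Finset.sum_insert his]
    exact (h i (Finset.mem_insert_self _ _)).add
      (ih fun j hj => h j (Finset.mem_insert_of_mem hj))

/-- The factors are absorbed into the coefficients, whose Euclidean norm does not increase. This
carries the cosines and sines of the Fourier representation of the taper. -/
lemma modulate (hu : IsBessel μ u H) (m : ℕ → ℝ) (hm : ∀ a, |m a| ≤ 1) :
    IsBessel μ (fun a ω => m a * u a ω) H where
  memLp a := (hu.memLp a).const_mul _
  nonneg := hu.nonneg
  bound n c := by
    have h := hu.bound n (fun a => c a * m a)
    simp only [mul_assoc] at h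
    refine h.trans (mul_le_mul_of_nonneg_left (Real.sqrt_le_sqrt ?_) hu.nonneg)
    refine Finset.sum_le_sum fun a _ => ?_
    rw [mul_pow]
    exact mul_le_of_le_one_right (sq_nonneg _) ((sq_le_one_iff_abs_le_one _).2 (hm a))

end IsBessel

/-- A sequence of pairwise orthogonal functions of norm at most `H` has the Bessel bound `H`. -/
lemma isBessel_of_orthogonal {u : ℕ → Ω → ℝ} {H : ℝ} (hu : ∀ a, MemLp (u a) 2 μ) (hH : 0 ≤ H)
    (hn : ∀ a, l2norm μ (u a) ≤ H) (ho : ∀ a b, a ≠ b → ∫ ω, u a ω * u b ω ∂μ = 0) :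
    IsBessel μ u H where
  memLp := hu
  nonneg := hH
  bound n c := by
    refine l2norm_le_of_sq_le (memLp_linear_combination _ _ hu) (by positivity) ?_
    rw [integral_sum_sq_of_orthogonal _ fun a _ => (hu a).const_mul _]
    · rw [mul_pow, Real.sq_sqrt (by positivity), Finset.mul_sum]
      refine Finset.sum_le_sum fun a _ => ?_
      simp only [mul_pow, integral_const_mul]
      rw [← l2norm_sq (hu a), mul_comm]
      gcongr
      · exact l2norm_nonneg
      · exact hn a
    · intro a _ b _ hab
      have : ∀ ω, c a * u a ω * (c b * u b ω) = c a * c b * (u a ω * u b ω) := fun ω => by ring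
      simp only [this, integral_const_mul, ho a b hab, mul_zero]

end Bessel

/-! ### The filtration of the shift -/

section Shift

variable {Ω : Type*} {F₀ mΩ : MeasurableSpace Ω} {T : Ω ≃ᵐ Ω}

lemma iter_zero : iter T 0 = id := by
  ext ω
  simp [iter]

lemma iter_one : iter T 1 = T := by
  ext ω
  simp [iter]

lemma iter_add (i j : ℤ) : iter T (i + j) = iter T i ∘ iter T j := by
  ext ω
  simp [iter, _root_.zpow_add, Equiv.Perm.mul_apply]

lemma iter_neg_one : iter T (-1) = T.symm := by
  ext ω
  rw [iter, _root_.zpow_neg_one]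
  rfl

lemma iter_comp_apply (i j : ℤ) (ω : Ω) : iter T i (iter T j ω) = iter T (i + j) ω := by
  rw [iter_add]
  rfl

lemma measurable_iter (i : ℤ) : Measurable (iter T i) := by
  induction i using Int.induction_on with
  | zero => rw [iter_zero]; exact measurable_id
  | succ k ih => rw [iter_add, iter_one]; exact ih.comp T.measurable
  | pred k ih => rw [sub_eq_add_neg, iter_add, iter_neg_one]; exact ih.comp T.symm.measurable

/-- The iterate `T^i` as a measurable equivalence. -/
def iterEquiv (T : Ω ≃ᵐ Ω) (i : ℤ) : Ω ≃ᵐ Ω where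
  toFun := iter T i
  invFun := iter T (-i)
  left_inv ω := by rw [iter_comp_apply, neg_add_cancel, iter_zero, id]
  right_inv ω := by rw [iter_comp_apply, add_neg_cancel, iter_zero, id]
  measurable_toFun := measurable_iter i
  measurable_invFun := measurable_iter (-i)

lemma process_process (f : Ω → ℝ) (i j : ℤ) :
    process T (process T f i) j = process T f (i + j) := by
  ext ω
  simp [process, iter_comp_apply]

lemma process_zero (f : Ω → ℝ) : process T f 0 = f := by
  ext ω
  simp [process, iter_zero]

variable {μ : Measure Ω}

lemma measurePreserving_iter (hT : MeasurePreserving T μ μ) (i : ℤ) :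
    MeasurePreserving (iter T i) μ μ := by
  induction i using Int.induction_on with
  | zero => rw [iter_zero]; exact MeasurePreserving.id μ
  | succ k ih => rw [iter_add, iter_one]; exact ih.comp hT
  | pred k ih =>
    rw [sub_eq_add_neg, iter_add, iter_neg_one]
    exact ih.comp (MeasurePreserving.symm T hT)

lemma integral_comp_iter (hT : MeasurePreserving T μ μ) (i : ℤ) (f : Ω → ℝ) :
    ∫ ω, f (iter T i ω) ∂μ = ∫ ω, f ω ∂μ :=
  (measurePreserving_iter hT i).integral_comp (iterEquiv T i).measurableEmbedding f

lemma memLp_process (hT : MeasurePreserving T μ μ) {f : Ω → ℝ} {q : ℝ≥0∞} (hf : MemLp f q μ)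
    (i : ℤ) : MemLp (process T f i) q μ :=
  hf.comp_measurePreserving (measurePreserving_iter hT i)

lemma l2norm_process (hT : MeasurePreserving T μ μ) {f : Ω → ℝ} (hf : AEStronglyMeasurable f μ)
    (i : ℤ) : l2norm μ (process T f i) = l2norm μ f := by
  rw [l2norm, l2norm, ← eLpNorm_comp_measurePreserving hf (measurePreserving_iter hT i)]
  rfl

lemma process_congr_ae (hT : MeasurePreserving T μ μ) {f g : Ω → ℝ} (h : f =ᵐ[μ] g) (i : ℤ) :
    process T f i =ᵐ[μ] process T g i :=
  (measurePreserving_iter hT i).quasiMeasurePreserving.ae_eq_comp h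

lemma comap_shiftAlgebra (i j : ℤ) :
    (shiftAlgebra T F₀ j).comap (iter T i) = shiftAlgebra T F₀ (j + i) := by
  rw [shiftAlgebra, MeasurableSpace.comap_comp, ← iter_add]

lemma shiftAlgebra_le (h : F₀ ≤ mΩ) (i : ℤ) : shiftAlgebra T F₀ i ≤ mΩ :=
  (MeasurableSpace.comap_mono h).trans (measurable_iter i).comap_le

lemma shiftAlgebra_mono (h : F₀ ≤ shiftAlgebra T F₀ 1) : Monotone (shiftAlgebra T F₀) := by
  refine monotone_int_of_le_succ fun i => ?_
  rw [add_comm, ← comap_shiftAlgebra]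
  exact MeasurableSpace.comap_mono h

lemma aestronglyMeasurable_process (hT : MeasurePreserving T μ μ) {f : Ω → ℝ} {j : ℤ}
    (hf : AEStronglyMeasurable[shiftAlgebra T F₀ j] f μ) (i : ℤ) :
    AEStronglyMeasurable[shiftAlgebra T F₀ (j + i)] (process T f i) μ := by
  obtain ⟨g, hg, hfg⟩ := hf
  refine ⟨process T g i, ?_, process_congr_ae hT hfg i⟩
  rw [← comap_shiftAlgebra]
  exact hg.comp_measurable (Measurable.of_comap_le le_rfl)

lemma aestronglyMeasurable_of_le {m m' : MeasurableSpace Ω} (h : m ≤ m') {f : Ω → ℝ}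
    (hf : AEStronglyMeasurable[m] f μ) : AEStronglyMeasurable[m'] f μ :=
  ⟨hf.mk f, hf.stronglyMeasurable_mk.mono h, hf.ae_eq_mk⟩

lemma integrable_mul_of_memLp {f g : Ω → ℝ} (hf : MemLp f 2 μ) (hg : MemLp g 2 μ) :
    Integrable (fun ω => f ω * g ω) μ :=
  hf.integrable_mul hg

lemma integral_condExp_mul [IsFiniteMeasure μ] {m : MeasurableSpace Ω} (hm : m ≤ mΩ)
    {f g : Ω → ℝ} (hf : MemLp f 2 μ) (hg : MemLp g 2 μ) (hgm : AEStronglyMeasurable[m] g μ) :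
    ∫ ω, μ[f|m] ω * g ω ∂μ = ∫ ω, f ω * g ω ∂μ := by
  have h := condExp_mul_of_aestronglyMeasurable_right hgm (hf.integrable_mul hg)
    (hf.integrable (by norm_num))
  rw [← integral_condExp hm (f := fun ω => f ω * g ω)]
  exact (integral_congr_ae h).symm

/-- The shift preserves the measure and pulls `F_j` back to `F_{j+i}`, so the defining set integrals
correspond under a change of variables. -/
lemma condExp_process [IsFiniteMeasure μ] (hT : MeasurePreserving T μ μ) (hF : F₀ ≤ mΩ)
    {f : Ω → ℝ} (hf : Integrable f μ) (i j : ℤ) :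
    μ[process T f i|shiftAlgebra T F₀ (j + i)] =ᵐ[μ]
      process T (μ[f|shiftAlgebra T F₀ j]) i := by
  have hi := measurePreserving_iter hT i
  have hint : Integrable (process T (μ[f|shiftAlgebra T F₀ j]) i) μ :=
    (hi.integrable_comp_emb (iterEquiv T i).measurableEmbedding).2 integrable_condExp
  refine (ae_eq_condExp_of_forall_setIntegral_eq (shiftAlgebra_le hF _)
    ((hi.integrable_comp_emb (iterEquiv T i).measurableEmbedding).2 hf)
    (fun s _ _ => hint.integrableOn) ?_ ?_).symm
  · intro s hs _
    rw [← comap_shiftAlgebra] at hs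
    obtain ⟨t, ht, rfl⟩ := hs
    have e : ∀ g : Ω → ℝ, ∫ ω in iter T i ⁻¹' t, process T g i ω ∂μ = ∫ ω in t, g ω ∂μ :=
      fun g => hi.setIntegral_preimage_emb (iterEquiv T i).measurableEmbedding g t
    rw [e, setIntegral_condExp (shiftAlgebra_le hF _) hf ht]
    exact (e f).symm
  · exact aestronglyMeasurable_process hT stronglyMeasurable_condExp.aestronglyMeasurable i

lemma proj_process [IsFiniteMeasure μ] (hT : MeasurePreserving T μ μ) (hF : F₀ ≤ mΩ)
    {f : Ω → ℝ} (hf : Integrable f μ) (i j : ℤ) :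
    proj μ T F₀ (j + i) (process T f i) =ᵐ[μ] process T (proj μ T F₀ j f) i := by
  have h1 := condExp_process hT hF hf i j
  have h2 := condExp_process hT hF hf i (j - 1)
  rw [show j - 1 + i = j + i - 1 by ring] at h2
  filter_upwards [h1, h2] with ω e1 e2
  simp only [proj, Pi.sub_apply, e1, e2]
  rfl

/-- A square integrable martingale difference: an `F_0`-measurable function orthogonal to the
`F_{-1}`-measurable functions. -/
structure IsMartingaleDiff (F₀ : MeasurableSpace Ω) {mΩ : MeasurableSpace Ω} (μ : Measure Ω)
    (T : Ω ≃ᵐ Ω) (D : Ω → ℝ) : Prop where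
  memLp : MemLp D 2 μ
  meas : AEStronglyMeasurable[shiftAlgebra T F₀ 0] D μ
  orth : ∀ g : Ω → ℝ, AEStronglyMeasurable[shiftAlgebra T F₀ (-1)] g μ → MemLp g 2 μ →
    ∫ ω, D ω * g ω ∂μ = 0

namespace IsMartingaleDiff

variable {D D' : Ω → ℝ}

lemma sub (hD : IsMartingaleDiff F₀ μ T D) (hD' : IsMartingaleDiff F₀ μ T D') :
    IsMartingaleDiff F₀ μ T (fun ω => D ω - D' ω) where
  memLp := hD.memLp.sub hD'.memLp
  meas := hD.meas.sub hD'.meas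
  orth g hg hg2 := by
    simp only [sub_mul]
    rw [integral_sub (integrable_mul_of_memLp hD.memLp hg2) (integrable_mul_of_memLp hD'.memLp hg2),
      hD.orth g hg hg2, hD'.orth g hg hg2, sub_zero]

/-- Composition with `T^{-i}` moves the statement to time `0`, where it is the definition. -/
lemma integral_process_mul (hT : MeasurePreserving T μ μ) (hD : IsMartingaleDiff F₀ μ T D)
    {i : ℤ} {g : Ω → ℝ} (hg : AEStronglyMeasurable[shiftAlgebra T F₀ (i - 1)] g μ)
    (hg2 : MemLp g 2 μ) : ∫ ω, process T D i ω * g ω ∂μ = 0 := by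
  have h := hD.orth (process T g (-i)) (by
    have := aestronglyMeasurable_process hT hg (-i)
    rwa [show i - 1 + -i = -1 by ring] at this) (memLp_process hT hg2 _)
  rw [← integral_comp_iter hT i] at h
  simpa [process, iter_comp_apply, iter_zero] using h

lemma meas_process (hT : MeasurePreserving T μ μ) (hD : IsMartingaleDiff F₀ μ T D) (i : ℤ) :
    AEStronglyMeasurable[shiftAlgebra T F₀ i] (process T D i) μ := by
  have := aestronglyMeasurable_process hT hD.meas i
  rwa [zero_add] at this

/-- The later factor is orthogonal to everything measurable strictly before it. The two differences
may be distinct: the cross terms of moving sums need this. -/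
lemma integral_process_mul_process (hT : MeasurePreserving T μ μ)
    (hmono : F₀ ≤ shiftAlgebra T F₀ 1) (hD : IsMartingaleDiff F₀ μ T D)
    (hD' : IsMartingaleDiff F₀ μ T D') {i j : ℤ} (hij : i ≠ j) :
    ∫ ω, process T D i ω * process T D' j ω ∂μ = 0 := by
  rcases lt_or_gt_of_ne hij with h | h
  · simp only [mul_comm (process T D i _)]
    exact hD'.integral_process_mul hT
      (aestronglyMeasurable_of_le (shiftAlgebra_mono hmono (by omega)) (hD.meas_process hT i))
      (memLp_process hT hD.memLp i)
  · exact hD.integral_process_mul hT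
      (aestronglyMeasurable_of_le (shiftAlgebra_mono hmono (by omega)) (hD'.meas_process hT j))
      (memLp_process hT hD'.memLp j)

lemma isBessel (hT : MeasurePreserving T μ μ) (hmono : F₀ ≤ shiftAlgebra T F₀ 1)
    (hD : IsMartingaleDiff F₀ μ T D) (c : ℤ) :
    IsBessel μ (fun a => process T D (a + c)) (l2norm μ D) :=
  isBessel_of_orthogonal (fun a => memLp_process hT hD.memLp _) l2norm_nonneg
    (fun a => (l2norm_process hT hD.memLp.1 _).le)
    (fun a b hab => hD.integral_process_mul_process hT hmono hD (by omega))

end IsMartingaleDiff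

lemma isMartingaleDiff_sub_condExp [IsFiniteMeasure μ] (hF : F₀ ≤ mΩ)
    (hmono : F₀ ≤ shiftAlgebra T F₀ 1) {f : Ω → ℝ} (hf : MemLp f 2 μ)
    (hfm : AEStronglyMeasurable[shiftAlgebra T F₀ 0] f μ) :
    IsMartingaleDiff F₀ μ T (fun ω => f ω - μ[f|shiftAlgebra T F₀ (-1)] ω) where
  memLp := hf.sub (hf.condExp one_le_two)
  meas := hfm.sub (aestronglyMeasurable_of_le (shiftAlgebra_mono hmono (by norm_num))
    stronglyMeasurable_condExp.aestronglyMeasurable)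
  orth g hg hg2 := by
    simp only [sub_mul]
    rw [integral_sub (integrable_mul_of_memLp hf hg2) (integrable_mul_of_memLp (hf.condExp one_le_two) hg2),
      integral_condExp_mul (shiftAlgebra_le hF _) hf hg2 hg, sub_self]

lemma isMartingaleDiff_proj [IsFiniteMeasure μ] (hF : F₀ ≤ mΩ)
    (hmono : F₀ ≤ shiftAlgebra T F₀ 1) {f : Ω → ℝ} (hf : MemLp f 2 μ) :
    IsMartingaleDiff F₀ μ T (proj μ T F₀ 0 f) where
  memLp := (hf.condExp one_le_two).sub (hf.condExp one_le_two)
  meas := by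
    refine AEStronglyMeasurable.sub stronglyMeasurable_condExp.aestronglyMeasurable ?_
    exact aestronglyMeasurable_of_le (shiftAlgebra_mono hmono (by norm_num))
      stronglyMeasurable_condExp.aestronglyMeasurable
  orth g hg hg2 := by
    simp only [proj, Pi.sub_apply, sub_mul, zero_sub]
    rw [integral_sub (integrable_mul_of_memLp (hf.condExp one_le_two) hg2)
      (integrable_mul_of_memLp (hf.condExp one_le_two) hg2),
      integral_condExp_mul (shiftAlgebra_le hF _) hf hg2 hg,
      integral_condExp_mul (shiftAlgebra_le hF _) hf hg2
        (aestronglyMeasurable_of_le (shiftAlgebra_mono hmono (by norm_num)) hg), sub_self]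

end Shift

/-! ### Convergence of conditional expectations in `L²` -/

section Convergence

variable {Ω : Type*} {F₀ mΩ : MeasurableSpace Ω} {T : Ω ≃ᵐ Ω} {μ : Measure Ω}

lemma tendsto_l2norm_sub_of_tendsto_Lp {F : ℕ → Lp ℝ 2 μ} {y : Lp ℝ 2 μ} {f : ℕ → Ω → ℝ}
    (h : Tendsto F atTop (𝓝 y)) (hf : ∀ n, F n =ᵐ[μ] f n) :
    Tendsto (fun n => l2norm μ (fun ω => f n ω - y ω)) atTop (𝓝 0) := by
  refine (tendsto_iff_norm_sub_tendsto_zero.1 h).congr fun n => ?_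
  rw [Lp.norm_def]
  refine l2norm_congr ?_
  filter_upwards [Lp.coeFn_sub (F n) y, hf n] with ω h1 h2
  rw [h1, Pi.sub_apply, h2]

/-- In L² the conditional expectations are orthogonal projections on an increasing sequence of
subspaces, which converge strongly. The limit is identified later. -/
lemma exists_tendsto_condExp_of_monotone [IsFiniteMeasure μ] {m : ℕ → MeasurableSpace Ω}
    (hm : ∀ n, m n ≤ mΩ) (hmono : Monotone m) {f : Ω → ℝ} (hf : MemLp f 2 μ) :
    ∃ y : Lp ℝ 2 μ, Tendsto (fun n => l2norm μ (fun ω => μ[f|m n] ω - y ω)) atTop (𝓝 0) := by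
  have hfact : ∀ n, Fact (m n ≤ mΩ) := fun n => ⟨hm n⟩
  let U : ℕ → Submodule ℝ (Lp ℝ 2 μ) := fun n => lpMeas ℝ ℝ (m n) 2 μ
  have hU : Monotone U := fun a b hab g hg => by
    rw [mem_lpMeas_iff_aestronglyMeasurable] at *
    exact aestronglyMeasurable_of_le (hmono hab) hg
  have h := Submodule.starProjection_tendsto_closure_iSup U hU (hf.toLp f)
  exact ⟨_, tendsto_l2norm_sub_of_tendsto_Lp h fun n =>
    hf.condExpL2_ae_eq_condExp (𝕜 := ℝ) (hm n)⟩

/-- The orthogonal complements increase, so the complementary projections converge. Each subspace is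
closed and contains all later projections, hence the limit. -/
lemma exists_tendsto_condExp_of_antitone [IsFiniteMeasure μ] {m : ℕ → MeasurableSpace Ω}
    (hm : ∀ n, m n ≤ mΩ) (hanti : Antitone m) {f : Ω → ℝ} (hf : MemLp f 2 μ) :
    ∃ y : Lp ℝ 2 μ, (∀ n, AEStronglyMeasurable[m n] y μ) ∧
      Tendsto (fun n => l2norm μ (fun ω => μ[f|m n] ω - y ω)) atTop (𝓝 0) := by
  have hfact : ∀ n, Fact (m n ≤ mΩ) := fun n => ⟨hm n⟩
  let U : ℕ → Submodule ℝ (Lp ℝ 2 μ) := fun n => lpMeas ℝ ℝ (m n) 2 μ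
  have hU : Antitone U := fun a b hab g hg => by
    rw [mem_lpMeas_iff_aestronglyMeasurable] at *
    exact aestronglyMeasurable_of_le (hanti hab) hg
  have hV : Monotone fun n => (U n)ᗮ := fun a b hab => Submodule.orthogonal_le (hU hab)
  have h := (Submodule.starProjection_tendsto_closure_iSup (fun n => (U n)ᗮ) hV
    (hf.toLp f)).const_sub (hf.toLp f)
  simp only [Submodule.starProjection_orthogonal_val, sub_sub_cancel] at h
  refine ⟨_, fun n => ?_, tendsto_l2norm_sub_of_tendsto_Lp h fun n =>
    hf.condExpL2_ae_eq_condExp (𝕜 := ℝ) (hm n)⟩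
  have hcl : IsClosed (U n : Set (Lp ℝ 2 μ)) := by
    rw [← Submodule.orthogonal_orthogonal (U n)]
    exact Submodule.isClosed_orthogonal _
  have := hcl.mem_of_tendsto h (eventually_atTop.2 ⟨n, fun k hk =>
    hU hk (Submodule.starProjection_apply_mem _ _)⟩)
  exact mem_lpMeas_iff_aestronglyMeasurable.1 this

/-- Measurability of `y` holds only up to null sets, with a different representative `g n` for each
`σ`-algebra. The limsup of the events `{g n > 0}` is a genuine tail event which agrees a.e. with `{y
> 0}`; it has probability 0 or 1, and in the second case the vanishing mean forces `y = 0`. -/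
lemma ae_nonpos_of_tail_trivial [IsProbabilityMeasure μ] {m : ℤ → MeasurableSpace Ω}
    (hmono : Monotone m) (hle : ∀ i, m i ≤ mΩ)
    (htail : ∀ A : Set Ω, MeasurableSet[⨅ i, m i] A → μ A = 0 ∨ μ A = 1)
    {y : Ω → ℝ} (hyint : Integrable y μ) (hy0 : ∫ ω, y ω ∂μ = 0)
    (hy : ∀ n : ℕ, AEStronglyMeasurable[m (-n)] y μ) : ∀ᵐ ω ∂μ, y ω ≤ 0 := by
  choose g hg hyg using hy
  let A : ℕ → Set Ω := fun n => {ω | 0 < g n ω}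
  have hA : ∀ n : ℕ, MeasurableSet[m (-n)] (A n) := fun n =>
    (hg n).measurable measurableSet_Ioi
  let B : Set Ω := ⋂ N : ℕ, ⋃ n : ℕ, A (n + N)
  have hB : MeasurableSet[⨅ i, m i] B := by
    rw [MeasurableSpace.measurableSet_iInf]
    intro i
    -- A limsup does not depend on its first terms; discarding `i.natAbs` of them leaves events that
    -- all lie in `m i`.
    have e : B = ⋂ N : ℕ, ⋃ n : ℕ, A (n + (N + i.natAbs)) := by
      ext ω
      simp only [B, Set.mem_iInter, Set.mem_iUnion]
      constructor
      · intro h N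
        exact h _
      · intro h N
        obtain ⟨n, hn⟩ := h N
        exact ⟨n + i.natAbs, by rwa [add_assoc, add_comm i.natAbs N]⟩
    rw [e]
    refine MeasurableSet.iInter fun N => MeasurableSet.iUnion fun n => ?_
    exact hmono (by omega) _ (hA _)
  have hBy : ∀ᵐ ω ∂μ, ω ∈ B ↔ 0 < y ω := by
    filter_upwards [ae_all_iff.2 hyg] with ω hω
    simp [B, A, ← hω]
  rcases htail B hB with h0 | h1
  · have : ∀ᵐ ω ∂μ, ω ∉ B := measure_eq_zero_iff_ae_notMem.1 h0
    filter_upwards [this, hBy] with ω h2 h3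
    exact not_lt.1 fun h => h2 (h3.2 h)
  · have hBm : MeasurableSet B := (iInf_le m 0).trans (hle 0) _ hB
    have h2 : ∀ᵐ ω ∂μ, ω ∈ B := (mem_ae_iff_prob_eq_one hBm).2 h1
    have hpos : ∀ᵐ ω ∂μ, 0 < y ω := by
      filter_upwards [h2, hBy] with ω h3 h4 using h4.1 h3
    have h3 := (integral_eq_zero_iff_of_nonneg_ae
      (by filter_upwards [hpos] with ω h using h.le) hyint).1 hy0
    filter_upwards [h3] with ω h4 using h4.le

/-- The limit `y` of the projections is centered and measurable with respect to every `m (-n)`, so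
triviality of the tail, applied to `y` and to `-y`, gives `y = 0`. -/
lemma tendsto_condExp_atBot [IsProbabilityMeasure μ] {m : ℤ → MeasurableSpace Ω}
    (hmono : Monotone m) (hle : ∀ i, m i ≤ mΩ)
    (htail : ∀ A : Set Ω, MeasurableSet[⨅ i, m i] A → μ A = 0 ∨ μ A = 1)
    {f : Ω → ℝ} (hf : MemLp f 2 μ) (hf0 : ∫ ω, f ω ∂μ = 0) :
    Tendsto (fun n : ℕ => l2norm μ (μ[f|m (-n)])) atTop (𝓝 0) := by
  obtain ⟨y, hym, hlim⟩ := exists_tendsto_condExp_of_antitone (m := fun n : ℕ => m (-n))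
    (fun n => hle _) (fun a b hab => hmono (by omega)) hf
  have hyL : MemLp y 2 μ := Lp.memLp y
  have hyint : Integrable y μ := hyL.integrable one_le_two
  have hy0 : ∫ ω, y ω ∂μ = 0 := by
    have h : ∀ n : ℕ, |∫ ω, y ω ∂μ| ≤ l2norm μ (fun ω => μ[f|m (-n)] ω - y ω) := by
      intro n
      have h1 : ∫ ω, (μ[f|m (-n)] ω - y ω) ∂μ = - ∫ ω, y ω ∂μ := by
        rw [integral_sub integrable_condExp hyint, integral_condExp (hle _), hf0, zero_sub]
      rw [← abs_neg, ← h1]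
      exact (abs_integral_le_integral_abs).trans
        (integral_abs_le_l2norm ((hf.condExp one_le_two).sub hyL))
    have := ge_of_tendsto' hlim h
    exact abs_eq_zero.1 (le_antisymm this (abs_nonneg _))
  have h1 := ae_nonpos_of_tail_trivial hmono hle htail hyint hy0 hym
  have h2 := ae_nonpos_of_tail_trivial hmono hle htail hyint.neg
    (by simp [integral_neg, hy0]) fun n => (hym n).neg
  refine hlim.congr fun n => l2norm_congr ?_
  filter_upwards [h1, h2] with ω h3 h4
  rw [le_antisymm h3 (by simpa using h4), sub_zero]

/-- The L² limit exists by projection; Lévy's upward theorem gives the L¹ limit. Both imply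
convergence in measure, whose limit is a.e. unique. -/
lemma tendsto_condExp_atTop [IsProbabilityMeasure μ] {m : ℤ → MeasurableSpace Ω}
    (hmono : Monotone m) (hle : ∀ i, m i ≤ mΩ) {f : Ω → ℝ} (hf : MemLp f 2 μ)
    (hfm : AEStronglyMeasurable[⨆ i, m i] f μ) :
    Tendsto (fun n : ℕ => l2norm μ (fun ω => μ[f|m n] ω - f ω)) atTop (𝓝 0) := by
  obtain ⟨y, hlim⟩ := exists_tendsto_condExp_of_monotone (m := fun n : ℕ => m n)
    (fun n => hle _) (fun a b hab => hmono (by omega)) hf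
  let ℱ : Filtration ℕ mΩ := ⟨fun n => m n, fun a b hab => hmono (by omega), fun n => hle _⟩
  have hsup : ⨆ n, ℱ n = ⨆ i, m i := by
    refine le_antisymm (iSup_le fun n => le_iSup m n) (iSup_le fun i => ?_)
    exact (hmono (show i ≤ (i.natAbs : ℤ) by omega)).trans (le_iSup (fun n => ℱ n) i.natAbs)
  have hyL : MemLp y 2 μ := Lp.memLp y
  have hlev := tendsto_eLpNorm_condExp (μ := μ) (ℱ := ℱ) f
  have h1 := tendstoInMeasure_of_tendsto_eLpNorm one_ne_zero
    (fun n : ℕ => (integrable_condExp (f := f) (μ := μ) (m := m n)).1) integrable_condExp.1 hlev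
  have hlim2 : Tendsto (fun n : ℕ => eLpNorm (μ[f|m n] - (y : Ω → ℝ)) 2 μ) atTop (𝓝 0) := by
    refine (ENNReal.tendsto_toReal_iff (fun n => ?_) (by simp)).1 (by rw [ENNReal.toReal_zero]; exact hlim)
    exact ((hf.condExp one_le_two).sub hyL).2.ne
  have h2 := tendstoInMeasure_of_tendsto_eLpNorm (by norm_num)
    (fun n : ℕ => (integrable_condExp (f := f) (μ := μ) (m := m n)).1) hyL.1 hlim2
  have h3 : y =ᵐ[μ] f := by
    refine (tendstoInMeasure_ae_unique h2 h1).trans ?_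
    rw [hsup]
    exact condExp_of_aestronglyMeasurable' (iSup_le hle) hfm (hf.integrable one_le_two)
  refine hlim.congr fun n => l2norm_congr ?_
  filter_upwards [h3] with ω h4
  rw [h4]

lemma sum_Icc_sub_telescope (φ : ℤ → ℝ) (R : ℕ) :
    ∑ j ∈ Finset.Icc (-R : ℤ) R, (φ (-j) - φ (-j - 1)) = φ R - φ (-(R + 1 : ℕ)) := by
  induction R with
  | zero => simp
  | succ R ih =>
    have e : Finset.Icc (-(R + 1 : ℕ) : ℤ) (R + 1 : ℕ) =
        insert (-(R + 1 : ℕ) : ℤ) (insert ((R + 1 : ℕ) : ℤ) (Finset.Icc (-R : ℤ) R)) := by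
      ext j
      simp only [Finset.mem_Icc, Finset.mem_insert]
      omega
    rw [e, Finset.sum_insert, Finset.sum_insert, ih]
    · have h1 : (-(-((R + 1 : ℕ) : ℤ)) - 1) = (R : ℤ) := by push_cast; ring
      have h2 : (-((R + 1 : ℕ) : ℤ) - 1) = -((R + 1 + 1 : ℕ) : ℤ) := by push_cast; ring
      rw [h1, h2, neg_neg]
      ring
    · simp only [Finset.mem_Icc]
      omega
    · simp only [Finset.mem_Icc, Finset.mem_insert]
      omega

/-- A regular filtration of a measure preserving transformation. -/
structure IsRegularShift (F₀ : MeasurableSpace Ω) {mΩ : MeasurableSpace Ω} (μ : Measure Ω)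
    (T : Ω ≃ᵐ Ω) : Prop where
  measurePreserving : MeasurePreserving T μ μ
  sub_algebra : F₀ ≤ mΩ
  mono : F₀ ≤ shiftAlgebra T F₀ 1
  tail_trivial : ∀ A : Set Ω, MeasurableSet[⨅ i : ℤ, shiftAlgebra T F₀ i] A → μ A = 0 ∨ μ A = 1

lemma IsHannanProcess.isRegularShift {ε₀ : Ω → ℝ} (h : IsHannanProcess F₀ μ T ε₀) :
    IsRegularShift F₀ μ T :=
  ⟨h.measurePreserving, h.sub_algebra, h.mono, h.tail_trivial⟩

namespace IsRegularShift

/-- A centered square integrable function is the sum of its martingale differences. -/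
lemma tendsto_sum_proj [IsProbabilityMeasure μ] (hS : IsRegularShift F₀ μ T) {g : Ω → ℝ}
    (hg : MemLp g 2 μ) (hg0 : ∫ ω, g ω ∂μ = 0)
    (hgm : AEStronglyMeasurable[⨆ i : ℤ, shiftAlgebra T F₀ i] g μ) :
    Tendsto (fun R : ℕ => l2norm μ (fun ω => g ω - ∑ j ∈ Finset.Icc (-R : ℤ) R,
      process T (proj μ T F₀ 0 (process T g j)) (-j) ω)) atTop (𝓝 0) := by
  have hmono := shiftAlgebra_mono hS.mono
  have hle := shiftAlgebra_le (T := T) hS.sub_algebra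
  have h1 := tendsto_condExp_atTop hmono hle hg hgm
  have h2 := (tendsto_condExp_atBot hmono hle hS.tail_trivial hg hg0).comp (tendsto_add_atTop_nat 1)
  have h3 := h1.add h2
  rw [add_zero] at h3
  refine squeeze_zero (fun _ => l2norm_nonneg) (fun R => ?_) h3
  have key : (fun ω => g ω - ∑ j ∈ Finset.Icc (-R : ℤ) R,
      process T (proj μ T F₀ 0 (process T g j)) (-j) ω) =ᵐ[μ]
      fun ω => - (μ[g|shiftAlgebra T F₀ R] ω - g ω) +
        μ[g|shiftAlgebra T F₀ (-(R + 1 : ℕ))] ω := by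
    -- By equivariance `P_0(g ∘ T^j) ∘ T^{-j} = P_{-j}(g)`, and these differences telescope over
    -- `j`.
    have h : ∀ᵐ ω ∂μ, ∀ j : ℤ, process T (proj μ T F₀ 0 (process T g j)) (-j) ω =
        μ[g|shiftAlgebra T F₀ (-j)] ω - μ[g|shiftAlgebra T F₀ (-j - 1)] ω := by
      refine ae_all_iff.2 fun j => ?_
      have := proj_process hS.measurePreserving hS.sub_algebra
        ((memLp_process hS.measurePreserving hg j).integrable one_le_two) (-j) 0
      rw [process_process, add_neg_cancel, process_zero, zero_add] at this
      filter_upwards [this] with ω hω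
      rw [← hω]
      rfl
    filter_upwards [h] with ω hω
    simp only [hω]
    rw [sum_Icc_sub_telescope (fun i => μ[g|shiftAlgebra T F₀ i] ω)]
    ring
  rw [l2norm_congr key]
  refine (l2norm_add_le (((hg.condExp one_le_two).sub hg).neg)
    (hg.condExp one_le_two)).trans ?_
  refine add_le_add (le_of_eq ?_) le_rfl
  exact l2norm_neg

/-- For each `j` the shifts of `D j` are orthogonal with the common norm `‖D j‖`; Bessel bounds add
up over `j`. -/
lemma isBessel_sum_proj [IsProbabilityMeasure μ] (hS : IsRegularShift F₀ μ T)
    {D : ℤ → Ω → ℝ} (hD : ∀ j, IsMartingaleDiff F₀ μ T (D j)) (s : Finset ℤ) (c : ℤ) :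
    IsBessel μ (fun a ω => ∑ j ∈ s, process T (D j) (a + c - j) ω) (∑ j ∈ s, l2norm μ (D j)) := by
  refine IsBessel.sum s fun j _ => ?_
  simpa only [add_sub_assoc] using (hD j).isBessel hS.measurePreserving hS.mono (c - j)

/-- The mean ergodic theorem. -/
lemma tendsto_birkhoff [IsProbabilityMeasure μ] (hS : IsRegularShift F₀ μ T) {g : Ω → ℝ}
    (hg : MemLp g 2 μ) (hg0 : ∫ ω, g ω ∂μ = 0)
    (hgm : AEStronglyMeasurable[⨆ i : ℤ, shiftAlgebra T F₀ i] g μ) (c : ℤ) :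
    Tendsto (fun n : ℕ => l2norm μ (fun ω => (n : ℝ)⁻¹ *
      ∑ a ∈ Finset.range n, process T g (a + c) ω)) atTop (𝓝 0) := by
  rw [Metric.tendsto_atTop]
  intro δ hδ
  have hT := hS.measurePreserving
  -- `g` is a finite sum of shifted martingale differences plus a remainder of norm below `δ / 2`.
  -- The averages of the remainder stay below `δ / 2`, while the Bessel bound with all coefficients
  -- equal to `1` makes those of the finite sum of order `n^{-1/2}`.
  obtain ⟨R, hR⟩ := ((hS.tendsto_sum_proj hg hg0 hgm).eventually
    (gt_mem_nhds (half_pos hδ))).exists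
  set D : ℤ → Ω → ℝ := fun j => proj μ T F₀ 0 (process T g j) with hDdef
  have hD : ∀ j, IsMartingaleDiff F₀ μ T (D j) := fun j =>
    isMartingaleDiff_proj hS.sub_algebra hS.mono (memLp_process hT hg j)
  set s := Finset.Icc (-R : ℤ) R
  set H := ∑ j ∈ s, l2norm μ (D j)
  have hb := hS.isBessel_sum_proj hD s c
  set r : Ω → ℝ := fun ω => g ω - ∑ j ∈ s, process T (D j) (-j) ω with hr
  have hrL : MemLp r 2 μ := hg.sub (memLp_finsetSum s fun j _ => memLp_process hT (hD j).memLp _)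
  have hlim : Tendsto (fun n : ℕ => H * (√(n : ℝ))⁻¹) atTop (𝓝 0) := by
    have := (tendsto_inv_atTop_zero.comp
      (Real.tendsto_sqrt_atTop.comp tendsto_natCast_atTop_atTop)).const_mul H
    simpa using this
  obtain ⟨N, hN⟩ := eventually_atTop.1 (hlim.eventually (gt_mem_nhds (half_pos hδ)))
  refine ⟨max N 1, fun n hn => ?_⟩
  have hn1 : 0 < n := by omega
  have hn0 : (0 : ℝ) < n := by exact_mod_cast hn1
  rw [Real.dist_0_eq_abs, abs_of_nonneg l2norm_nonneg]
  have e : ∀ ω, (n : ℝ)⁻¹ * ∑ a ∈ Finset.range n, process T g (a + c) ω =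
      (n : ℝ)⁻¹ * (∑ a ∈ Finset.range n, process T r (a + c) ω) +
      (n : ℝ)⁻¹ * ∑ a ∈ Finset.range n, 1 * ∑ j ∈ s, process T (D j) (a + c - j) ω := by
    intro ω
    rw [← mul_add, ← Finset.sum_add_distrib]
    congr 1
    refine Finset.sum_congr rfl fun a _ => ?_
    simp [hr, process, iter_comp_apply, neg_add_eq_sub]
  simp only [e]
  have hmr : ∀ a : ℕ, MemLp (process T r (a + c)) 2 μ := fun a => memLp_process hT hrL _
  have i1 : l2norm μ (fun ω => (n : ℝ)⁻¹ * ∑ a ∈ Finset.range n, process T r (a + c) ω) ≤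
      l2norm μ r := by
    rw [l2norm_const_mul, abs_of_pos (inv_pos.2 hn0), inv_mul_le_iff₀ hn0]
    refine (l2norm_sum_le _ fun a _ => hmr a).trans ?_
    simp [l2norm_process hT hrL.1]
  have i2 : l2norm μ (fun ω => (n : ℝ)⁻¹ * ∑ a ∈ Finset.range n,
      1 * ∑ j ∈ s, process T (D j) (a + c - j) ω) ≤ H * (√(n : ℝ))⁻¹ := by
    rw [l2norm_const_mul, abs_of_pos (inv_pos.2 hn0), inv_mul_le_iff₀ hn0]
    refine (hb.bound n fun _ => 1).trans (le_of_eq ?_)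
    simp only [one_pow, Finset.sum_const, Finset.card_range, nsmul_eq_mul, mul_one]
    have : √(n : ℝ) = n * (√(n : ℝ))⁻¹ := by
      rw [← div_eq_mul_inv, Real.div_sqrt]
    rw [mul_left_comm, ← this]
  refine (l2norm_add_le ((memLp_finsetSum _ fun a _ => hmr a).const_mul _)
    ((memLp_linear_combination _ (fun _ => 1) hb.memLp).const_mul _)).trans_lt ?_
  have := hN n (by omega)
  have i3 : l2norm μ r < δ / 2 := hR
  linarith

end IsRegularShift

end Convergence

/-! ### Approximation of the error process by bounded martingale differences -/

section Approximation

variable {Ω : Type*} {F₀ mΩ : MeasurableSpace Ω} {T : Ω ≃ᵐ Ω} {μ : Measure Ω}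

lemma abs_integral_mul_le {f g : Ω → ℝ} (hf : MemLp f 2 μ) (hg : MemLp g 2 μ) :
    |∫ ω, f ω * g ω ∂μ| ≤ l2norm μ f * l2norm μ g :=
  abs_integral_le_integral_abs.trans (integral_abs_mul_le hf hg)

lemma tendsto_integral_mul {u v : ℕ → Ω → ℝ} {f g : Ω → ℝ} (hu : ∀ n, MemLp (u n) 2 μ)
    (hv : ∀ n, MemLp (v n) 2 μ) (hf : MemLp f 2 μ) (hg : MemLp g 2 μ)
    (huf : Tendsto (fun n => l2norm μ (fun ω => f ω - u n ω)) atTop (𝓝 0))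
    (hvg : Tendsto (fun n => l2norm μ (fun ω => g ω - v n ω)) atTop (𝓝 0)) :
    Tendsto (fun n => ∫ ω, u n ω * v n ω ∂μ) atTop (𝓝 (∫ ω, f ω * g ω ∂μ)) := by
  rw [tendsto_iff_norm_sub_tendsto_zero]
  have hlim : Tendsto (fun n => l2norm μ (fun ω => f ω - u n ω) * l2norm μ (fun ω => g ω - v n ω) +
      l2norm μ (fun ω => f ω - u n ω) * l2norm μ g +
      l2norm μ f * l2norm μ (fun ω => g ω - v n ω)) atTop (𝓝 0) := by
    simpa using ((huf.mul hvg).add (huf.mul_const _)).add (hvg.const_mul (l2norm μ f))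
  refine squeeze_zero (fun _ => norm_nonneg _) (fun n => ?_) hlim
  have h1 := hf.sub (hu n)
  have h2 := hg.sub (hv n)
  have e : ∫ ω, u n ω * v n ω ∂μ - ∫ ω, f ω * g ω ∂μ =
      ∫ ω, (f ω - u n ω) * (g ω - v n ω) ∂μ - ∫ ω, (f ω - u n ω) * g ω ∂μ -
        ∫ ω, f ω * (g ω - v n ω) ∂μ := by
    have i1 : Integrable (fun ω => (f ω - u n ω) * (g ω - v n ω)) μ := integrable_mul_of_memLp h1 h2
    have i2 : Integrable (fun ω => (f ω - u n ω) * g ω) μ := integrable_mul_of_memLp h1 hg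
    have i3 : Integrable (fun ω => f ω * (g ω - v n ω)) μ := integrable_mul_of_memLp hf h2
    rw [← integral_sub (integrable_mul_of_memLp (hu n) (hv n)) (integrable_mul_of_memLp hf hg),
      ← integral_sub i1 i2, ← integral_sub (by exact i1.sub i2) i3]
    refine integral_congr_ae (Eventually.of_forall fun ω => ?_)
    ring
  rw [e, Real.norm_eq_abs]
  refine (abs_sub _ _).trans (add_le_add ((abs_sub _ _).trans (add_le_add ?_ ?_)) ?_)
  · exact abs_integral_mul_le h1 h2
  · exact abs_integral_mul_le h1 hg
  · exact abs_integral_mul_le hf h2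

lemma tendsto_l2norm_sub_truncation {f : Ω → ℝ} (hf : MemLp f 2 μ) :
    Tendsto (fun M : ℕ => l2norm μ (fun ω => f ω - max (-M : ℝ) (min (f ω) M))) atTop (𝓝 0) := by
  have hm : ∀ M : ℕ, AEStronglyMeasurable (fun ω => f ω - max (-M : ℝ) (min (f ω) M)) μ := by
    intro M
    have : Continuous fun x : ℝ => x - max (-M : ℝ) (min x M) := by fun_prop
    exact this.comp_aestronglyMeasurable hf.1
  have hb : ∀ (M : ℕ) (x : ℝ), |x - max (-M : ℝ) (min x M)| ≤ |x| := by
    intro M x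
    have hM : (0 : ℝ) ≤ M := Nat.cast_nonneg M
    rcases le_total x M with h1 | h1
    · rw [min_eq_left h1]
      rcases le_total (-M : ℝ) x with h2 | h2
      · rw [max_eq_right h2]; simp
      · rw [max_eq_left h2, abs_of_nonpos (by linarith), abs_of_nonpos (by linarith)]; linarith
    · rw [min_eq_right h1, max_eq_right (by linarith), abs_of_nonneg (by linarith),
        abs_of_nonneg (by linarith)]
      linarith
  have hL : ∀ M : ℕ, MemLp (fun ω => f ω - max (-M : ℝ) (min (f ω) M)) 2 μ := fun M =>
    hf.mono (hm M) (Eventually.of_forall fun ω => hb M (f ω))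
  have hlim : Tendsto (fun M : ℕ => ∫ ω, (f ω - max (-M : ℝ) (min (f ω) M)) ^ 2 ∂μ) atTop
      (𝓝 (∫ _, (0 : ℝ) ∂μ)) := by
    refine tendsto_integral_of_dominated_convergence (fun ω => f ω ^ 2) (fun M => (hm M).pow 2)
      hf.integrable_sq (fun M => Eventually.of_forall fun ω => ?_)
      (Eventually.of_forall fun ω => ?_)
    · rw [Real.norm_eq_abs, abs_pow, ← sq_abs (f ω)]
      exact pow_le_pow_left₀ (abs_nonneg _) (hb M (f ω)) 2
    · obtain ⟨N, hN⟩ := exists_nat_ge |f ω|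
      refine tendsto_const_nhds.congr' (eventually_atTop.2 ⟨N, fun M hM => ?_⟩)
      have h1 : |f ω| ≤ M := hN.trans (by exact_mod_cast hM)
      rw [abs_le] at h1
      simp [min_eq_left h1.2, max_eq_right h1.1]
  have := hlim.sqrt
  simp only [integral_zero, Real.sqrt_zero] at this
  refine this.congr fun M => ?_
  rw [← l2norm_sq (hL M), Real.sqrt_sq l2norm_nonneg]

/-- Truncation destroys orthogonality to the past, so the truncated function `f` is recentered by `y
= E(f | F_{-1})`. Recentering keeps it bounded, and since `D` is orthogonal to the past, `y` is
minus the projection of `D - f`, hence `‖y‖ ≤ ‖D - f‖`. -/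
lemma IsMartingaleDiff.exists_bounded_approx [IsProbabilityMeasure μ] (hF : F₀ ≤ mΩ)
    (hmono : F₀ ≤ shiftAlgebra T F₀ 1) {D : Ω → ℝ} (hD : IsMartingaleDiff F₀ μ T D) {δ : ℝ}
    (hδ : 0 < δ) : ∃ D' : Ω → ℝ, IsMartingaleDiff F₀ μ T D' ∧ (∃ M : ℝ, ∀ᵐ ω ∂μ, |D' ω| ≤ M) ∧
      l2norm μ (fun ω => D ω - D' ω) ≤ δ := by
  obtain ⟨M, hM⟩ := ((tendsto_l2norm_sub_truncation hD.memLp).eventually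
    (gt_mem_nhds (half_pos hδ))).exists
  set f : Ω → ℝ := fun ω => max (-M : ℝ) (min (D ω) M) with hfdef
  have hM0 : (0 : ℝ) ≤ M := Nat.cast_nonneg M
  have hbd : ∀ ω, |f ω| ≤ M := fun ω =>
    abs_le.2 ⟨le_max_left _ _, max_le (by linarith) (min_le_right _ _)⟩
  have hc : Continuous fun x : ℝ => max (-M : ℝ) (min x M) := by fun_prop
  have hfm : AEStronglyMeasurable[shiftAlgebra T F₀ 0] f μ := hc.comp_aestronglyMeasurable hD.meas
  have hfL : MemLp f 2 μ := MemLp.of_bound (hc.comp_aestronglyMeasurable hD.memLp.1) M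
    (Eventually.of_forall hbd)
  set y := μ[f|shiftAlgebra T F₀ (-1)] with hy
  have hyL : MemLp y 2 μ := hfL.condExp one_le_two
  refine ⟨fun ω => f ω - y ω, isMartingaleDiff_sub_condExp hF hmono hfL hfm, ⟨M + M, ?_⟩, ?_⟩
  · have h1 : ∀ᵐ ω ∂μ, |y ω| ≤ M :=
      ae_bdd_abs_condExp_of_ae_bdd_abs (Eventually.of_forall hbd)
    filter_upwards [h1] with ω h2
    exact (abs_sub _ _).trans (add_le_add (hbd ω) h2)
  · have hDf : MemLp (fun ω => D ω - f ω) 2 μ := hD.memLp.sub hfL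
    have hyn : l2norm μ y ≤ l2norm μ (fun ω => D ω - f ω) := by
      have hym : AEStronglyMeasurable[shiftAlgebra T F₀ (-1)] y μ :=
        stronglyMeasurable_condExp.aestronglyMeasurable
      -- `∫ y² = ∫ f y` because `y` is the projection of `f`, and `∫ D y = 0`.
      have e : l2norm μ y ^ 2 = - ∫ ω, (D ω - f ω) * y ω ∂μ := by
        rw [l2norm_sq hyL]
        simp only [sq, sub_mul]
        rw [integral_condExp_mul (shiftAlgebra_le hF _) hfL hyL hym,
          integral_sub (integrable_mul_of_memLp hD.memLp hyL) (integrable_mul_of_memLp hfL hyL),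
          hD.orth y hym hyL]
        ring
      have h1 : l2norm μ y ^ 2 ≤ l2norm μ (fun ω => D ω - f ω) * l2norm μ y := by
        rw [e]
        exact (neg_le_abs _).trans (abs_integral_mul_le hDf hyL)
      rcases eq_or_lt_of_le (l2norm_nonneg (μ := μ) (f := y)) with h0 | h0
      · rw [← h0]; exact l2norm_nonneg
      · rw [sq] at h1
        exact le_of_mul_le_mul_right h1 h0
    have e : ∀ ω, D ω - (f ω - y ω) = (D ω - f ω) + y ω := fun ω => by ring
    simp only [e]
    refine (l2norm_add_le hDf hyL).trans ?_
    have h3 : l2norm μ (fun ω => D ω - f ω) < δ / 2 := hM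
    linarith

namespace IsHannanProcess

variable {ε₀ : Ω → ℝ}

lemma measurable (hε : IsHannanProcess F₀ μ T ε₀) : Measurable ε₀ :=
  hε.measurable_top.mono (iSup_le fun i => shiftAlgebra_le hε.sub_algebra i) le_rfl

lemma isMartingaleDiff [IsProbabilityMeasure μ] (hε : IsHannanProcess F₀ μ T ε₀) (j : ℤ) :
    IsMartingaleDiff F₀ μ T (proj μ T F₀ 0 (process T ε₀ j)) :=
  isMartingaleDiff_proj hε.sub_algebra hε.mono (memLp_process hε.measurePreserving hε.memLp j)

lemma summable_l2norm_proj (hε : IsHannanProcess F₀ μ T ε₀) :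
    Summable fun j : ℤ => l2norm μ (proj μ T F₀ 0 (process T ε₀ j)) :=
  ENNReal.summable_toReal hε.hannan.ne

lemma tendsto_sum_proj [IsProbabilityMeasure μ] (hε : IsHannanProcess F₀ μ T ε₀) :
    Tendsto (fun R : ℕ => l2norm μ (fun ω => ε₀ ω - ∑ j ∈ Finset.Icc (-R : ℤ) R,
      process T (proj μ T F₀ 0 (process T ε₀ j)) (-j) ω)) atTop (𝓝 0) :=
  hε.isRegularShift.tendsto_sum_proj hε.memLp hε.mean_zero
    hε.measurable_top.stronglyMeasurable.aestronglyMeasurable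

/-- The bound is the tail of Hannan's series. With `n` and `c` fixed, the martingale expansion is
cut at `|j| ≤ R`: the indices outside `s` contribute at most the tail by `isBessel_sum_proj`, and
the error `r R` enters only through `∑ |c a|` times its norm, which disappears as `R → ∞`. -/
lemma isBessel_sub_sum [IsProbabilityMeasure μ] (hε : IsHannanProcess F₀ μ T ε₀) (s : Finset ℤ) :
    IsBessel μ (fun a ω => process T ε₀ (a + 1) ω -
        ∑ j ∈ s, process T (proj μ T F₀ 0 (process T ε₀ j)) (a + 1 - j) ω)
      (∑' j : ℤ, l2norm μ (proj μ T F₀ 0 (process T ε₀ j)) -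
        ∑ j ∈ s, l2norm μ (proj μ T F₀ 0 (process T ε₀ j))) := by
  classical
  have hT := hε.measurePreserving
  have hS := hε.isRegularShift
  have hsum := hε.summable_l2norm_proj
  have hlim := hε.tendsto_sum_proj
  have hD := hε.isMartingaleDiff
  set d : ℤ → Ω → ℝ := fun j => proj μ T F₀ 0 (process T ε₀ j)
  have hmem : ∀ a : ℕ, MemLp (fun ω => process T ε₀ (a + 1) ω -
      ∑ j ∈ s, process T (d j) (a + 1 - j) ω) 2 μ := fun a =>
    (memLp_process hT hε.memLp _).sub
      (memLp_finsetSum s fun j _ => memLp_process hT (hD j).memLp _)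
  refine ⟨hmem, sub_nonneg.2 (hsum.sum_le_tsum s fun _ _ => l2norm_nonneg), fun n c => ?_⟩
  set H := ∑' j : ℤ, l2norm μ (d j) - ∑ j ∈ s, l2norm μ (d j)
  set r : ℕ → Ω → ℝ := fun R ω => ε₀ ω - ∑ j ∈ Finset.Icc (-R : ℤ) R, process T (d j) (-j) ω with hr
  have hrL : ∀ R, MemLp (r R) 2 μ := fun R =>
    hε.memLp.sub (memLp_finsetSum _ fun j _ => memLp_process hT (hD j).memLp _)
  have hlim2 : Tendsto (fun R => (∑ a ∈ Finset.range n, |c a|) * l2norm μ (r R) +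
      H * √(∑ a ∈ Finset.range n, c a ^ 2)) atTop (𝓝 (H * √(∑ a ∈ Finset.range n, c a ^ 2))) := by
    simpa using (hlim.const_mul (∑ a ∈ Finset.range n, |c a|)).add_const
      (H * √(∑ a ∈ Finset.range n, c a ^ 2))
  obtain ⟨N, hN⟩ : ∃ N : ℕ, ∀ R ≥ N, s ⊆ Finset.Icc (-R : ℤ) R := by
    refine ⟨∑ j ∈ s, j.natAbs, fun R hR j hj => ?_⟩
    have := Finset.single_le_sum (f := Int.natAbs) (fun _ _ => Nat.zero_le _) hj
    rw [Finset.mem_Icc]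
    omega
  refine ge_of_tendsto hlim2 (eventually_atTop.2 ⟨N, fun R hR => ?_⟩)
  have hsub := hN R hR
  set t := Finset.Icc (-R : ℤ) R \ s
  have e : ∀ ω, ∑ a ∈ Finset.range n, c a * (process T ε₀ (a + 1) ω -
      ∑ j ∈ s, process T (d j) (a + 1 - j) ω) =
      ∑ a ∈ Finset.range n, c a * process T (r R) (a + 1) ω +
      ∑ a ∈ Finset.range n, c a * ∑ j ∈ t, process T (d j) (a + 1 - j) ω := by
    intro ω
    rw [← Finset.sum_add_distrib]
    refine Finset.sum_congr rfl fun a _ => ?_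
    rw [← mul_add]
    congr 1
    have h1 : process T (r R) (a + 1) ω = process T ε₀ (a + 1) ω -
        ∑ j ∈ Finset.Icc (-R : ℤ) R, process T (d j) (a + 1 - j) ω := by
      simp [hr, process, iter_comp_apply, neg_add_eq_sub]
    rw [h1, ← Finset.sum_sdiff hsub]
    ring
  refine (congrArg (l2norm μ) (funext e)).trans_le ?_
  have hb := hS.isBessel_sum_proj hD t 1
  have hm1 : ∀ a : ℕ, MemLp (process T (r R) (a + 1)) 2 μ := fun a => memLp_process hT (hrL R) _
  refine (l2norm_add_le (memLp_linear_combination _ c hm1)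
    (memLp_linear_combination _ c hb.memLp)).trans (add_le_add ?_ ?_)
  · refine (l2norm_sum_le _ fun a _ => (hm1 a).const_mul _).trans ?_
    rw [Finset.sum_mul]
    refine Finset.sum_le_sum fun a _ => ?_
    rw [l2norm_const_mul, l2norm_process hT (hrL R).1]
  · refine (hb.bound n c).trans (mul_le_mul_of_nonneg_right ?_ (Real.sqrt_nonneg _))
    rw [le_sub_iff_add_le, Finset.sum_sdiff hsub]
    exact hsum.sum_le_tsum _ fun _ _ => l2norm_nonneg

/-- The case `s = ∅`: the constant is the full sum of Hannan's series. -/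
lemma exists_isBessel [IsProbabilityMeasure μ] (hε : IsHannanProcess F₀ μ T ε₀) :
    ∃ H, IsBessel μ (fun a => process T ε₀ (a + 1)) H :=
  ⟨_, by simpa using hε.isBessel_sub_sum ∅⟩

/-- The error process is approximated by a finite sum of bounded martingale differences. -/
lemma exists_approx [IsProbabilityMeasure μ] (hε : IsHannanProcess F₀ μ T ε₀) {δ : ℝ}
    (hδ : 0 < δ) : ∃ (s : Finset ℤ) (D : ℤ → Ω → ℝ), (∀ j, IsMartingaleDiff F₀ μ T (D j)) ∧
      (∀ j, ∃ M : ℝ, ∀ᵐ ω ∂μ, |D j ω| ≤ M) ∧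
      IsBessel μ (fun a ω => process T ε₀ (a + 1) ω -
        ∑ j ∈ s, process T (D j) (a + 1 - j) ω) δ := by
  have hsum := hε.summable_l2norm_proj
  have hD := hε.isMartingaleDiff
  set d : ℤ → Ω → ℝ := fun j => proj μ T F₀ 0 (process T ε₀ j)
  obtain ⟨s, hs⟩ := (hsum.hasSum.eventually (lt_mem_nhds
    (sub_lt_self (∑' j, l2norm μ (d j)) (half_pos hδ)))).exists
  -- Half of `δ` pays for the tail of the series, the other half for the truncations. The `+ 1`
  -- covers an empty `s`.
  have hδ' : 0 < δ / 2 / (s.card + 1) := by positivity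
  choose D hD1 hD2 hD3 using fun j => (hD j).exists_bounded_approx hε.sub_algebra hε.mono hδ'
  refine ⟨s, D, hD1, hD2, ?_⟩
  have h1 := hε.isBessel_sub_sum s
  have h2 := hε.isRegularShift.isBessel_sum_proj (fun j => (hD j).sub (hD1 j)) s 1
  refine ((h1.add h2).mono ?_).congr_ae fun a => Eventually.of_forall fun ω => ?_
  · have h3 : ∑ j ∈ s, l2norm μ (fun ω => d j ω - D j ω) ≤ δ / 2 := by
      refine (Finset.sum_le_sum fun j _ => hD3 j).trans ?_
      rw [Finset.sum_const, nsmul_eq_mul, mul_div_assoc', div_le_iff₀ (by positivity)]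
      nlinarith
    linarith
  · have h4 : ∀ j, process T (fun ω => proj μ T F₀ 0 (process T ε₀ j) ω - D j ω) (a + 1 - j) ω =
        process T (proj μ T F₀ 0 (process T ε₀ j)) (a + 1 - j) ω -
          process T (D j) (a + 1 - j) ω := fun j => rfl
    simp only [h4, Finset.sum_sub_distrib]
    ring

/-- By orthogonality only pairs `j = i + k` contribute to `γ(k)`, so `|γ(k)| ≤ ∑_i ‖d i‖ ‖d (i +
k)‖`, and summing over `k` gives at most `A²`. The argument is run on the truncated expansions `u
R`, with a bound independent of `R`. -/
lemma summable_autocov [IsProbabilityMeasure μ] (hε : IsHannanProcess F₀ μ T ε₀) :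
    Summable fun k : ℤ => |autocov μ T ε₀ k| := by
  classical
  have hT := hε.measurePreserving
  have hsum := hε.summable_l2norm_proj
  have hlim := hε.tendsto_sum_proj
  have hD := hε.isMartingaleDiff
  set d : ℤ → Ω → ℝ := fun j => proj μ T F₀ 0 (process T ε₀ j)
  set A := ∑' j : ℤ, l2norm μ (d j)
  set u : ℕ → Ω → ℝ := fun R ω => ∑ j ∈ Finset.Icc (-R : ℤ) R, process T (d j) (-j) ω
  have huL : ∀ R, MemLp (u R) 2 μ := fun R =>
    memLp_finsetSum _ fun j _ => memLp_process hT (hD j).memLp _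
  have hcov : ∀ k : ℤ, Tendsto (fun R => ∫ ω, u R ω * process T (u R) k ω ∂μ) atTop
      (𝓝 (autocov μ T ε₀ k)) := by
    intro k
    rw [autocov, process_zero]
    refine tendsto_integral_mul huL (fun R => memLp_process hT (huL R) k) hε.memLp
      (memLp_process hT hε.memLp k) hlim ?_
    refine hlim.congr fun R => ?_
    exact (l2norm_process hT (hε.memLp.sub (huL R)).1 k).symm
  have hterm : ∀ R k, |∫ ω, u R ω * process T (u R) k ω ∂μ| ≤
      ∑ i ∈ Finset.Icc (-R : ℤ) R, ∑ j ∈ Finset.Icc (-R : ℤ) R,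
        if j = i + k then l2norm μ (d i) * l2norm μ (d j) else 0 := by
    intro R k
    have e : ∀ ω, u R ω * process T (u R) k ω = ∑ i ∈ Finset.Icc (-R : ℤ) R,
        ∑ j ∈ Finset.Icc (-R : ℤ) R, process T (d i) (-i) ω * process T (d j) (-j + k) ω := by
      intro ω
      simp only [u, process, Finset.sum_mul_sum, iter_comp_apply]
    have hi : ∀ i j, Integrable
        (fun ω => process T (d i) (-i) ω * process T (d j) (-j + k) ω) μ := fun i j =>
      integrable_mul_of_memLp (memLp_process hT (hD i).memLp _) (memLp_process hT (hD j).memLp _)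
    simp only [e]
    rw [integral_finsetSum _ fun i _ => integrable_finsetSum _ fun j _ => hi i j]
    refine (Finset.abs_sum_le_sum_abs _ _).trans (Finset.sum_le_sum fun i _ => ?_)
    rw [integral_finsetSum _ fun j _ => hi i j]
    refine (Finset.abs_sum_le_sum_abs _ _).trans (Finset.sum_le_sum fun j _ => ?_)
    split_ifs with h
    · refine (abs_integral_mul_le (memLp_process hT (hD i).memLp _)
        (memLp_process hT (hD j).memLp _)).trans ?_
      rw [l2norm_process hT (hD i).memLp.1, l2norm_process hT (hD j).memLp.1]
    · rw [(hD i).integral_process_mul_process hT hε.mono (hD j) (by omega), abs_zero]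
  refine summable_of_sum_le (c := A * A) (fun _ => abs_nonneg _) fun t => ?_
  refine le_of_tendsto (tendsto_finsetSum t fun k _ => (hcov k).abs)
    (Eventually.of_forall fun R => ?_)
  have hA : ∑ i ∈ Finset.Icc (-R : ℤ) R, l2norm μ (d i) ≤ A :=
    hsum.sum_le_tsum _ fun _ _ => l2norm_nonneg
  have h0 : 0 ≤ ∑ i ∈ Finset.Icc (-R : ℤ) R, l2norm μ (d i) :=
    Finset.sum_nonneg fun _ _ => l2norm_nonneg
  calc ∑ k ∈ t, |∫ ω, u R ω * process T (u R) k ω ∂μ|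
      ≤ ∑ k ∈ t, ∑ i ∈ Finset.Icc (-R : ℤ) R, ∑ j ∈ Finset.Icc (-R : ℤ) R,
        (if j = i + k then l2norm μ (d i) * l2norm μ (d j) else 0) :=
      Finset.sum_le_sum fun k _ => hterm R k
    _ = ∑ i ∈ Finset.Icc (-R : ℤ) R, ∑ j ∈ Finset.Icc (-R : ℤ) R, ∑ k ∈ t,
        (if j = i + k then l2norm μ (d i) * l2norm μ (d j) else 0) := by
      rw [Finset.sum_comm]
      exact Finset.sum_congr rfl fun i _ => Finset.sum_comm
    _ ≤ ∑ i ∈ Finset.Icc (-R : ℤ) R, ∑ j ∈ Finset.Icc (-R : ℤ) R,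
        l2norm μ (d i) * l2norm μ (d j) := by
      refine Finset.sum_le_sum fun i _ => Finset.sum_le_sum fun j _ => ?_
      have : ∀ k, (j = i + k) ↔ (k = j - i) := fun k => by omega
      simp only [this, Finset.sum_ite_eq']
      split_ifs
      · exact le_rfl
      · exact mul_nonneg l2norm_nonneg l2norm_nonneg
    _ = (∑ i ∈ Finset.Icc (-R : ℤ) R, l2norm μ (d i)) *
        ∑ j ∈ Finset.Icc (-R : ℤ) R, l2norm μ (d j) := by rw [Finset.sum_mul_sum]
    _ ≤ A * A := mul_le_mul hA hA h0 (h0.trans hA)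

end IsHannanProcess

end Approximation

/-! ### Quadratic forms with weights depending on the lag -/

section LagForm

/-- The bilinear form `∑_{a, b < n} w(b - a) u_a v_b`. -/
def lagForm (w : ℤ → ℝ) (n : ℕ) (u v : ℕ → ℝ) : ℝ :=
  ∑ a ∈ Finset.range n, ∑ b ∈ Finset.range n, w ((b : ℤ) - a) * (u a * v b)

lemma lagForm_add_left (w : ℤ → ℝ) (n : ℕ) (u u' v : ℕ → ℝ) :
    lagForm w n (fun a => u a + u' a) v = lagForm w n u v + lagForm w n u' v := by
  simp only [lagForm, ← Finset.sum_add_distrib]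
  refine Finset.sum_congr rfl fun a _ => Finset.sum_congr rfl fun b _ => ?_
  ring

lemma lagForm_add_right (w : ℤ → ℝ) (n : ℕ) (u v v' : ℕ → ℝ) :
    lagForm w n u (fun a => v a + v' a) = lagForm w n u v + lagForm w n u v' := by
  simp only [lagForm, ← Finset.sum_add_distrib]
  refine Finset.sum_congr rfl fun a _ => Finset.sum_congr rfl fun b _ => ?_
  ring

lemma sum_lag_eq_natCast (n k : ℕ) (φ : ℕ → ℕ → ℝ) :
    ∑ a ∈ Finset.range n, ∑ b ∈ Finset.range n, (if (b : ℤ) - a = k then φ a b else 0) =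
      ∑ i ∈ Finset.range (n - k), φ i (i + k) := by
  have h : ∀ a ∈ Finset.range n, ∑ b ∈ Finset.range n, (if (b : ℤ) - a = k then φ a b else 0) =
      if a ∈ Finset.range (n - k) then φ a (a + k) else 0 := by
    intro a ha
    have : ∀ b : ℕ, ((b : ℤ) - a = k) ↔ (b = a + k) := fun b => by omega
    simp only [this, Finset.sum_ite_eq', Finset.mem_range]
    rw [Finset.mem_range] at ha
    refine if_congr (by omega) rfl rfl
  rw [Finset.sum_congr rfl h, ← Finset.sum_filter]
  refine Finset.sum_congr ?_ fun _ _ => rfl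
  ext a
  simp only [Finset.mem_filter, Finset.mem_range]
  omega

lemma sum_lag_eq_neg_natCast (n k : ℕ) (φ : ℕ → ℕ → ℝ) :
    ∑ a ∈ Finset.range n, ∑ b ∈ Finset.range n, (if (b : ℤ) - a = -(k : ℤ) then φ a b else 0) =
      ∑ i ∈ Finset.range (n - k), φ (i + k) i := by
  rw [Finset.sum_comm, ← sum_lag_eq_natCast n k fun a b => φ b a]
  refine Finset.sum_congr rfl fun b _ => Finset.sum_congr rfl fun a _ => ?_
  refine if_congr (by omega) rfl rfl

lemma sum_lag_one (n : ℕ) (k : ℤ) :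
    ∑ a ∈ Finset.range n, ∑ b ∈ Finset.range n, (if (b : ℤ) - a = k then (1 : ℝ) else 0) =
      ((n - k.natAbs : ℕ) : ℝ) := by
  rcases Int.natAbs_eq k with h | h
  · have := sum_lag_eq_natCast n k.natAbs fun _ _ => 1
    rw [← h] at this
    simpa using this
  · have := sum_lag_eq_neg_natCast n k.natAbs fun _ _ => 1
    rw [← h] at this
    simpa using this

lemma sum_eq_sum_lag (n : ℕ) (φ : ℕ → ℕ → ℝ) :
    ∑ a ∈ Finset.range n, ∑ b ∈ Finset.range n, φ a b =
      ∑ k ∈ Finset.Ioo (-n : ℤ) n, ∑ a ∈ Finset.range n, ∑ b ∈ Finset.range n,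
        (if (b : ℤ) - a = k then φ a b else 0) := by
  rw [Finset.sum_comm' (t' := Finset.range n) (s' := fun _ => Finset.Ioo (-n : ℤ) n) (by simp)]
  refine Finset.sum_congr rfl fun a ha => ?_
  rw [Finset.sum_comm]
  refine Finset.sum_congr rfl fun b hb => ?_
  rw [Finset.mem_range] at ha hb
  rw [Finset.sum_ite_eq, if_pos]
  rw [Finset.mem_Ioo]
  omega

lemma sum_sub_natCast_le (n : ℕ) {b : ℕ} (hb : b < n) (g : ℤ → ℝ) (hg : ∀ k, 0 ≤ g k) :
    ∑ a ∈ Finset.range n, g ((b : ℤ) - a) ≤ ∑ k ∈ Finset.Ioo (-n : ℤ) n, g k := by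
  rw [← Finset.sum_image (s := Finset.range n) (g := fun a : ℕ => (b : ℤ) - a) (f := g)]
  · refine Finset.sum_le_sum_of_subset_of_nonneg (fun k hk => ?_) fun k _ _ => hg k
    obtain ⟨a, ha, rfl⟩ := Finset.mem_image.1 hk
    rw [Finset.mem_range] at ha
    rw [Finset.mem_Ioo]
    omega
  · intro a _ a' _ h
    simpa using h

lemma sum_natCast_sub_le (n : ℕ) {b : ℕ} (hb : b < n) (g : ℤ → ℝ) (hg : ∀ k, 0 ≤ g k) :
    ∑ a ∈ Finset.range n, g ((a : ℤ) - b) ≤ ∑ k ∈ Finset.Ioo (-n : ℤ) n, g k := by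
  rw [← Finset.sum_image (s := Finset.range n) (g := fun a : ℕ => (a : ℤ) - b) (f := g)]
  · refine Finset.sum_le_sum_of_subset_of_nonneg (fun k hk => ?_) fun k _ _ => hg k
    obtain ⟨a, ha, rfl⟩ := Finset.mem_image.1 hk
    rw [Finset.mem_range] at ha
    rw [Finset.mem_Ioo]
    omega
  · intro a _ a' _ h
    simpa using h

lemma tendsto_natCast_sub_div (m : ℕ) :
    Tendsto (fun n : ℕ => (n : ℝ)⁻¹ * ((n - m : ℕ) : ℝ)) atTop (𝓝 1) := by
  have h : Tendsto (fun n : ℕ => 1 - (m : ℝ) * (n : ℝ)⁻¹) atTop (𝓝 1) := by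
    simpa using (tendsto_inv_atTop_nhds_zero_nat (𝕜 := ℝ)).const_mul (m : ℝ) |>.const_sub 1
  refine h.congr' (eventually_atTop.2 ⟨m + 1, fun n hn => ?_⟩)
  have h0 : (n : ℝ) ≠ 0 := by
    have : 0 < n := by omega
    positivity
  simp only
  rw [Nat.cast_sub (by omega)]
  field_simp

variable {Ω : Type*} {F₀ mΩ : MeasurableSpace Ω} {T : Ω ≃ᵐ Ω} {μ : Measure Ω}

lemma aestronglyMeasurable_sum {m : MeasurableSpace Ω} {ι : Type*} (s : Finset ι)
    {f : ι → Ω → ℝ} (hf : ∀ i ∈ s, AEStronglyMeasurable[m] (f i) μ) :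
    AEStronglyMeasurable[m] (fun ω => ∑ i ∈ s, f i ω) μ := by
  classical
  induction s using Finset.induction_on with
  | empty => simpa using aestronglyMeasurable_const
  | insert i s his ih =>
    simp only [Finset.sum_insert his]
    exact (hf i (Finset.mem_insert_self _ _)).add
      (ih fun j hj => hf j (Finset.mem_insert_of_mem hj))

lemma integrable_lagForm {u v : ℕ → Ω → ℝ} (hu : ∀ a, MemLp (u a) 2 μ)
    (hv : ∀ a, MemLp (v a) 2 μ) (w : ℤ → ℝ) (n : ℕ) :
    Integrable (fun ω => lagForm w n (fun a => u a ω) (fun a => v a ω)) μ :=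
  integrable_finsetSum _ fun a _ => integrable_finsetSum _ fun b _ =>
    (integrable_mul_of_memLp (hu a) (hv b)).const_mul _

/-- A sequence of lag weights for which the quadratic forms in a Bessel sequence are controlled. -/
structure IsLagWeight (μ : Measure Ω) (w : ℕ → ℤ → ℝ) (ρ : ℤ → ℝ) : Prop where
  multiplier : ∃ C : ℝ, 0 ≤ C ∧ ∀ (n : ℕ) (u v : ℕ → Ω → ℝ) (Hu Hv : ℝ), IsBessel μ u Hu →
    IsBessel μ v Hv →
    ∫ ω, |lagForm (w n) n (fun a => u a ω) (fun a => v a ω)| ∂μ ≤ C * n * Hu * Hv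
  bounded : ∃ C : ℝ, ∀ n k, |w n k| ≤ C
  small : Tendsto (fun n : ℕ => (n : ℝ)⁻¹ * ∑ k ∈ Finset.Ioo (-n : ℤ) n, w n k ^ 2) atTop (𝓝 0)
  tendsto : ∀ k, Tendsto (fun n => w n k) atTop (𝓝 (ρ k))

lemma integral_process_mul_process_eq_autocov (hT : MeasurePreserving T μ μ) (f : Ω → ℝ)
    (i j : ℤ) : ∫ ω, process T f i ω * process T f j ω ∂μ = autocov μ T f (j - i) := by
  rw [autocov, ← integral_comp_iter hT i fun ω => process T f 0 ω * process T f (j - i) ω]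
  simp [process, iter_comp_apply]

lemma autocov_neg (hT : MeasurePreserving T μ μ) (f : Ω → ℝ) (k : ℤ) :
    autocov μ T f (-k) = autocov μ T f k := by
  rw [← zero_sub, ← integral_process_mul_process_eq_autocov hT, autocov]
  simp only [mul_comm]

lemma integral_lagForm_process (hT : MeasurePreserving T μ μ) {f : Ω → ℝ} (hf : MemLp f 2 μ)
    (w : ℤ → ℝ) (n : ℕ) :
    ∫ ω, lagForm w n (fun a => process T f (a + 1) ω) (fun a => process T f (a + 1) ω) ∂μ =
      ∑ a ∈ Finset.range n, ∑ b ∈ Finset.range n,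
        w ((b : ℤ) - a) * autocov μ T f ((b : ℤ) - a) := by
  have hi : ∀ a b : ℕ, Integrable (fun ω => w ((b : ℤ) - a) *
      (process T f (a + 1) ω * process T f (b + 1) ω)) μ := fun a b =>
    (integrable_mul_of_memLp (memLp_process hT hf _) (memLp_process hT hf _)).const_mul _
  simp only [lagForm]
  rw [integral_finsetSum _ fun a _ => integrable_finsetSum _ fun b _ => hi a b]
  refine Finset.sum_congr rfl fun a _ => ?_
  rw [integral_finsetSum _ fun b _ => hi a b]
  refine Finset.sum_congr rfl fun b _ => ?_
  rw [integral_const_mul, integral_process_mul_process_eq_autocov hT]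
  congr 2
  ring

/-- Convergence of the expectation of the weighted quadratic form. -/
lemma IsLagWeight.tendsto_integral {w : ℕ → ℤ → ℝ} {ρ : ℤ → ℝ} (hw : IsLagWeight μ w ρ)
    (hT : MeasurePreserving T μ μ) {f : Ω → ℝ} (hf : MemLp f 2 μ)
    (hsum : Summable fun k : ℤ => |autocov μ T f k|) :
    Tendsto (fun n : ℕ => (n : ℝ)⁻¹ * ∫ ω, lagForm (w n) n (fun a => process T f (a + 1) ω)
      (fun a => process T f (a + 1) ω) ∂μ) atTop (𝓝 (∑' k : ℤ, autocov μ T f k * ρ k)) := by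
  obtain ⟨C, hC⟩ := hw.bounded
  -- There are `n - |k|` pairs at lag `k`; truncated subtraction makes this zero for `|k| ≥ n`, so
  -- the sum over all of `ℤ` is the finite one and dominated convergence applies.
  have h : Tendsto (fun n : ℕ => ∑' k : ℤ, autocov μ T f k * w n k *
      ((n : ℝ)⁻¹ * ((n - k.natAbs : ℕ) : ℝ))) atTop (𝓝 (∑' k : ℤ, autocov μ T f k * ρ k)) := by
    refine tendsto_tsum_of_dominated_convergence (bound := fun k => |autocov μ T f k| * C)
      (hsum.mul_right C) (fun k => ?_) (Eventually.of_forall fun n k => ?_)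
    · simpa using ((hw.tendsto k).const_mul (autocov μ T f k)).mul
        (tendsto_natCast_sub_div k.natAbs)
    · have h1 : |(n : ℝ)⁻¹ * ((n - k.natAbs : ℕ) : ℝ)| ≤ 1 := by
        rw [abs_of_nonneg (by positivity)]
        rcases Nat.eq_zero_or_pos n with rfl | hn
        · simp
        · rw [inv_mul_le_iff₀ (by positivity), mul_one]
          exact_mod_cast Nat.sub_le _ _
      have hC0 : 0 ≤ C := (abs_nonneg _).trans (hC n k)
      rw [Real.norm_eq_abs, abs_mul, abs_mul]
      calc _ ≤ |autocov μ T f k| * C * 1 := by gcongr; exact hC n k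
        _ = _ := mul_one _
  refine h.congr fun n => ?_
  rw [integral_lagForm_process hT hf, sum_eq_sum_lag, Finset.mul_sum,
    tsum_eq_sum (s := Finset.Ioo (-n : ℤ) n)]
  · refine Finset.sum_congr rfl fun k _ => ?_
    have e : ∀ a b : ℕ, (if (b : ℤ) - a = k then w n ((b : ℤ) - a) *
        autocov μ T f ((b : ℤ) - a) else 0) =
        w n k * autocov μ T f k * if (b : ℤ) - a = k then 1 else 0 := by
      intro a b
      split_ifs with h
      · rw [h, mul_one]
      · rw [mul_zero]
    simp only [e, ← Finset.mul_sum, sum_lag_one]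
    ring
  · intro k hk
    rw [Finset.mem_Ioo] at hk
    rw [show n - k.natAbs = 0 by omega]
    simp

lemma memLp_mul_of_bounded {f g : Ω → ℝ} {M : ℝ} (hf : AEStronglyMeasurable f μ)
    (hM : ∀ᵐ ω ∂μ, |f ω| ≤ M) (hg : MemLp g 2 μ) : MemLp (fun ω => f ω * g ω) 2 μ := by
  refine (hg.const_mul M).mono (hf.mul hg.1) ?_
  filter_upwards [hM] with ω h
  rw [norm_mul, norm_mul]
  exact mul_le_mul_of_nonneg_right (h.trans (le_abs_self M)) (norm_nonneg _)

lemma process_bounded (hT : MeasurePreserving T μ μ) {f : Ω → ℝ} {M : ℝ}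
    (hM : ∀ᵐ ω ∂μ, |f ω| ≤ M) (i : ℤ) : ∀ᵐ ω ∂μ, |process T f i ω| ≤ M :=
  (measurePreserving_iter hT i).quasiMeasurePreserving.ae hM

/-- The `L²` bound of a weighted sum of products of bounded martingale differences over large
lags. -/
lemma l2norm_far_lags_le [IsProbabilityMeasure μ] (hS : IsRegularShift F₀ μ T) {D D' : Ω → ℝ}
    (hD : IsMartingaleDiff F₀ μ T D) (hD' : IsMartingaleDiff F₀ μ T D') {M M' : ℝ}
    (hM : ∀ᵐ ω ∂μ, |D ω| ≤ M) (hM' : ∀ᵐ ω ∂μ, |D' ω| ≤ M') {N : ℕ} {j j' : ℤ}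
    (hjj : j' - j ≤ N) (v : ℤ → ℝ) (n : ℕ) (S : ℝ)
    (hv : ∀ b < n, ∑ a ∈ Finset.range n, v ((b : ℤ) - a) ^ 2 ≤ S) :
    l2norm μ (fun ω => ∑ b ∈ Finset.range n, ∑ a ∈ Finset.range n,
      if (N : ℤ) < (b : ℤ) - a then v ((b : ℤ) - a) *
        (process T D (a + 1 - j) ω * process T D' (b + 1 - j') ω) else 0) ≤
      |M'| * l2norm μ D * √(n * S) := by
  classical
  have hT := hS.measurePreserving
  set c : ℕ → ℕ → ℝ := fun b a => if (N : ℤ) < (b : ℤ) - a then v ((b : ℤ) - a) else 0 with hc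
  set A : ℕ → Ω → ℝ := fun b ω => ∑ a ∈ Finset.range n, c b a * process T D (a + 1 - j) ω with hA
  have hDp : ∀ a : ℕ, MemLp (process T D (a + 1 - j)) 2 μ := fun a => memLp_process hT hD.memLp _
  have hAL : ∀ b, MemLp (A b) 2 μ := fun b => memLp_linear_combination _ _ hDp
  -- A lag larger than `N ≥ j' - j` puts `a + 1 - j` strictly before `b + 1 - j'`: `A b` is
  -- measurable with respect to the past of the factor `D'` it multiplies, so the `Z b` are
  -- martingale differences.
  have hAm : ∀ b : ℕ, AEStronglyMeasurable[shiftAlgebra T F₀ (b + 1 - j' - 1)] (A b) μ := by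
    intro b
    refine aestronglyMeasurable_sum _ fun a _ => ?_
    by_cases h : (N : ℤ) < (b : ℤ) - a
    · refine AEStronglyMeasurable.const_mul ?_ _
      exact aestronglyMeasurable_of_le (shiftAlgebra_mono hS.mono (by omega))
        (hD.meas_process hT (a + 1 - j))
    · simp only [hc, if_neg h, zero_mul]
      exact aestronglyMeasurable_const
  have hAb : ∀ b, ∃ K : ℝ, ∀ᵐ ω ∂μ, |A b ω| ≤ K := by
    intro b
    refine ⟨∑ a ∈ Finset.range n, |c b a| * M, ?_⟩
    filter_upwards [ae_all_iff.2 fun a : ℕ => process_bounded hT hM (a + 1 - j)] with ω h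
    refine (Finset.abs_sum_le_sum_abs _ _).trans (Finset.sum_le_sum fun a _ => ?_)
    rw [abs_mul]
    exact mul_le_mul_of_nonneg_left (h a) (abs_nonneg _)
  set Z : ℕ → Ω → ℝ := fun b ω => process T D' (b + 1 - j') ω * A b ω with hZ
  have hD'p : ∀ b : ℕ, MemLp (process T D' (b + 1 - j')) 2 μ := fun b =>
    memLp_process hT hD'.memLp _
  have hZL : ∀ b, MemLp (Z b) 2 μ := fun b =>
    memLp_mul_of_bounded (hD'p b).1 (process_bounded hT hM' _) (hAL b)
  -- The factor of `Z b'` at time `b' + 1 - j'` is orthogonal to the past-measurable product `A b' *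
  -- Z b`, which is in L² because `A b'` is bounded.
  have horth : ∀ b b', b < b' → ∫ ω, Z b ω * Z b' ω ∂μ = 0 := by
    intro b b' hbb
    obtain ⟨K, hK⟩ := hAb b'
    have hg : MemLp (fun ω => A b' ω * Z b ω) 2 μ := memLp_mul_of_bounded (hAL b').1 hK (hZL b)
    have hZm : AEStronglyMeasurable[shiftAlgebra T F₀ (b' + 1 - j' - 1)] (Z b) μ := by
      refine AEStronglyMeasurable.mul ?_ ?_
      · exact aestronglyMeasurable_of_le (shiftAlgebra_mono hS.mono (by omega))
          (hD'.meas_process hT (b + 1 - j'))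
      · exact aestronglyMeasurable_of_le (shiftAlgebra_mono hS.mono (by omega)) (hAm b)
    have := hD'.integral_process_mul hT (i := b' + 1 - j') ((hAm b').mul hZm) hg
    rw [← this]
    refine integral_congr_ae (Eventually.of_forall fun ω => ?_)
    simp only [hZ, Pi.mul_apply]
    ring
  have e : ∀ ω, ∑ b ∈ Finset.range n, ∑ a ∈ Finset.range n,
      (if (N : ℤ) < (b : ℤ) - a then v ((b : ℤ) - a) *
        (process T D (a + 1 - j) ω * process T D' (b + 1 - j') ω) else 0) =
      ∑ b ∈ Finset.range n, Z b ω := by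
    intro ω
    refine Finset.sum_congr rfl fun b _ => ?_
    simp only [hZ, hA, Finset.mul_sum]
    refine Finset.sum_congr rfl fun a _ => ?_
    simp only [hc]
    split_ifs
    · ring
    · ring
  simp only [e]
  have hbess := hD.isBessel hT hS.mono (1 - j)
  refine l2norm_le_of_sq_le (memLp_finsetSum _ fun b _ => hZL b)
    (mul_nonneg (mul_nonneg (abs_nonneg _) l2norm_nonneg) (Real.sqrt_nonneg _)) ?_
  rw [integral_sum_sq_of_orthogonal _ (fun b _ => hZL b)]
  · have hZb : ∀ b ∈ Finset.range n, ∫ ω, Z b ω ^ 2 ∂μ ≤ (|M'| * l2norm μ D) ^ 2 * S := by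
      intro b hb
      rw [Finset.mem_range] at hb
      have h1 : l2norm μ (A b) ≤ l2norm μ D * √S := by
        have h2 := hbess.bound n (c b)
        simp only [← add_sub_assoc] at h2
        refine h2.trans (mul_le_mul_of_nonneg_left (Real.sqrt_le_sqrt ?_) l2norm_nonneg)
        refine le_trans (Finset.sum_le_sum fun a _ => ?_) (hv b hb)
        simp only [hc]
        split_ifs
        · exact le_rfl
        · simp [sq_nonneg]
      have hS0 : 0 ≤ S := (Finset.sum_nonneg fun a _ => sq_nonneg _).trans (hv b hb)
      calc ∫ ω, Z b ω ^ 2 ∂μ ≤ ∫ ω, |M'| ^ 2 * A b ω ^ 2 ∂μ := by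
            refine integral_mono_ae (hZL b).integrable_sq ((hAL b).integrable_sq.const_mul _) ?_
            filter_upwards [process_bounded hT hM' (b + 1 - j')] with ω h
            simp only [hZ, mul_pow]
            refine mul_le_mul_of_nonneg_right ?_ (sq_nonneg _)
            rw [← sq_abs (process T D' _ ω)]
            exact pow_le_pow_left₀ (abs_nonneg _) (h.trans (le_abs_self _)) 2
        _ = |M'| ^ 2 * l2norm μ (A b) ^ 2 := by rw [integral_const_mul, l2norm_sq (hAL b)]
        _ ≤ |M'| ^ 2 * (l2norm μ D * √S) ^ 2 := by
            gcongr
            exact l2norm_nonneg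
        _ = (|M'| * l2norm μ D) ^ 2 * S := by
            rw [mul_pow, mul_pow, Real.sq_sqrt hS0]
            ring
    refine (Finset.sum_le_sum hZb).trans ?_
    rw [Finset.sum_const, Finset.card_range, nsmul_eq_mul]
    rcases Nat.eq_zero_or_pos n with rfl | hn
    · simp
    · have hS0 : 0 ≤ S := (Finset.sum_nonneg fun a _ => sq_nonneg _).trans (hv 0 hn)
      rw [mul_pow _ (√_), Real.sq_sqrt (by positivity)]
      exact le_of_eq (by ring)
  · intro b _ b' _ hbb
    rcases lt_or_gt_of_ne hbb with h | h
    · exact horth b b' h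
    · simpa only [mul_comm] using horth b' b h

end LagForm

/-! ### Convergence of the weighted quadratic form in the errors -/

section QuadraticForm

variable {Ω : Type*} {F₀ mΩ : MeasurableSpace Ω} {T : Ω ≃ᵐ Ω} {μ : Measure Ω}

lemma autocov_eq_natAbs (hT : MeasurePreserving T μ μ) (f : Ω → ℝ) (k : ℤ) :
    autocov μ T f k = autocov μ T f k.natAbs := by
  rcases Int.natAbs_eq k with h | h
  · exact congrArg _ h
  · rw [← autocov_neg hT]
    exact congrArg _ (by omega)

lemma sum_lag_mul_self (n : ℕ) (k : ℤ) (e : ℕ → ℝ) (γ : ℝ) :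
    ∑ a ∈ Finset.range n, ∑ b ∈ Finset.range n, (if (b : ℤ) - a = k then e a * e b - γ else 0) =
      ∑ i ∈ Finset.range (n - k.natAbs), (e i * e (i + k.natAbs) - γ) := by
  rcases Int.natAbs_eq k with h | h
  · have := sum_lag_eq_natCast n k.natAbs fun a b => e a * e b - γ
    rwa [← h] at this
  · have := sum_lag_eq_neg_natCast n k.natAbs fun a b => e a * e b - γ
    rw [← h] at this
    rw [this]
    simp only [mul_comm]

/-- The centered empirical autocovariance at lag `k`. -/
def nearLag (n : ℕ) (k : ℤ) (γ : ℝ) (e : ℕ → ℝ) : ℝ :=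
  (n : ℝ)⁻¹ * ∑ a ∈ Finset.range n, ∑ b ∈ Finset.range n,
    if (b : ℤ) - a = k then e a * e b - γ else 0

/-- The part of the quadratic form with lags larger than `N`. -/
def farLags (N n : ℕ) (v : ℤ → ℝ) (e : ℕ → ℝ) : ℝ :=
  ∑ b ∈ Finset.range n, ∑ a ∈ Finset.range n,
    if (N : ℤ) < (b : ℤ) - a then v ((b : ℤ) - a) * (e a * e b) else 0

/-- Centering is needed only at lags `|k| ≤ N`, as `γ` vanishes beyond. Large negative lags become
positive ones by reflecting the weight, the products `e a * e b` being symmetric. -/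
lemma lagForm_sub_eq_nearLag_add_farLags (N n : ℕ) (w γ : ℤ → ℝ) (e : ℕ → ℝ)
    (hγ : ∀ k : ℤ, N < k.natAbs → γ k = 0) :
    (n : ℝ)⁻¹ * lagForm w n e e - (n : ℝ)⁻¹ * ∑ a ∈ Finset.range n, ∑ b ∈ Finset.range n,
      w ((b : ℤ) - a) * γ ((b : ℤ) - a) =
    ∑ k ∈ Finset.Icc (-N : ℤ) N, w k * nearLag n k (γ k) e +
      ((n : ℝ)⁻¹ * farLags N n w e + (n : ℝ)⁻¹ * farLags N n (fun k => w (-k)) e) := by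
  set I := Finset.Icc (-N : ℤ) N
  have e1 : ∑ k ∈ I, w k * nearLag n k (γ k) e = (n : ℝ)⁻¹ * ∑ a ∈ Finset.range n,
      ∑ b ∈ Finset.range n, if (b : ℤ) - a ∈ I then w ((b : ℤ) - a) *
        (e a * e b - γ ((b : ℤ) - a)) else 0 := by
    simp only [nearLag, mul_left_comm (w _), ← Finset.mul_sum]
    congr 1
    simp only [Finset.mul_sum]
    rw [Finset.sum_comm]
    refine Finset.sum_congr rfl fun a _ => ?_
    rw [Finset.sum_comm]
    refine Finset.sum_congr rfl fun b _ => ?_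
    simp only [mul_ite, mul_zero, Finset.sum_ite_eq]
  have e2 : farLags N n (fun k => w (-k)) e = ∑ a ∈ Finset.range n, ∑ b ∈ Finset.range n,
      if (N : ℤ) < (a : ℤ) - b then w ((b : ℤ) - a) * (e a * e b) else 0 := by
    simp only [farLags, neg_sub]
    refine Finset.sum_congr rfl fun a _ => Finset.sum_congr rfl fun b _ => ?_
    rw [mul_comm (e b)]
  have e3 : farLags N n w e = ∑ a ∈ Finset.range n, ∑ b ∈ Finset.range n,
      if (N : ℤ) < (b : ℤ) - a then w ((b : ℤ) - a) * (e a * e b) else 0 := by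
    simp only [farLags]
    exact Finset.sum_comm
  rw [e1, e2, e3, lagForm, ← mul_sub, ← mul_add, ← mul_add]
  congr 1
  simp only [← Finset.sum_add_distrib, ← Finset.sum_sub_distrib]
  refine Finset.sum_congr rfl fun a _ => Finset.sum_congr rfl fun b _ => ?_
  by_cases h1 : (b : ℤ) - a ∈ I
  · have h2 := Finset.mem_Icc.1 h1
    rw [if_pos h1, if_neg (by omega), if_neg (by omega)]
    ring
  · rw [if_neg h1, hγ _ (by rw [Finset.mem_Icc] at h1; omega)]
    rw [Finset.mem_Icc] at h1
    by_cases h2 : (N : ℤ) < (b : ℤ) - a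
    · rw [if_pos h2, if_neg (by omega)]
      ring
    · rw [if_neg h2, if_pos (by omega)]
      ring

lemma memLp_nearLag [IsFiniteMeasure μ] {u : ℕ → Ω → ℝ}
    (hu : ∀ a b, MemLp (fun ω => u a ω * u b ω) 2 μ) (n : ℕ) (k : ℤ) (γ : ℝ) :
    MemLp (fun ω => nearLag n k γ fun a => u a ω) 2 μ := by
  have h : MemLp (fun ω => ∑ a ∈ Finset.range n, ∑ b ∈ Finset.range n,
      if (b : ℤ) - a = k then u a ω * u b ω - γ else 0) 2 μ := by
    refine memLp_finsetSum _ fun a _ => memLp_finsetSum _ fun b _ => ?_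
    split_ifs
    · exact (hu _ _).sub (memLp_const _)
    · exact MemLp.zero
  exact h.const_mul _

lemma memLp_farLags {u : ℕ → Ω → ℝ} (hu : ∀ a b, MemLp (fun ω => u a ω * u b ω) 2 μ)
    (N n : ℕ) (v : ℤ → ℝ) : MemLp (fun ω => farLags N n v fun a => u a ω) 2 μ := by
  refine memLp_finsetSum _ fun a _ => memLp_finsetSum _ fun b _ => ?_
  split_ifs
  · exact (hu _ _).const_mul _
  · exact MemLp.zero

/-- Convergence in `L²` of the empirical autocovariances of a bounded process. -/
lemma IsRegularShift.tendsto_near_lag [IsProbabilityMeasure μ] (hS : IsRegularShift F₀ μ T)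
    {f : Ω → ℝ} {M : ℝ} (hM : ∀ᵐ ω ∂μ, |f ω| ≤ M) {q : ℤ}
    (hfm : AEStronglyMeasurable[shiftAlgebra T F₀ q] f μ) (hf : MemLp f 2 μ) (k : ℤ) :
    Tendsto (fun n : ℕ => l2norm μ (fun ω => nearLag n k (autocov μ T f k)
      fun a => process T f (a + 1) ω)) atTop (𝓝 0) := by
  have hT := hS.measurePreserving
  set m := k.natAbs
  -- Boundedness of `f` puts the centered product in L², so the mean ergodic theorem applies to it;
  -- the sum at lag `k` is a Birkhoff sum of length `n - m`.
  set g : Ω → ℝ := fun ω => process T f 0 ω * process T f m ω - autocov μ T f k with hg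
  have hprod : MemLp (fun ω => process T f 0 ω * process T f m ω) 2 μ :=
    memLp_mul_of_bounded (memLp_process hT hf 0).1 (process_bounded hT hM 0) (memLp_process hT hf m)
  have hgL : MemLp g 2 μ := hprod.sub (memLp_const _)
  have hg0 : ∫ ω, g ω ∂μ = 0 := by
    rw [hg, integral_sub (hprod.integrable one_le_two) (integrable_const _),
      integral_process_mul_process_eq_autocov hT, sub_zero, ← autocov_eq_natAbs hT]
    simp
  have hgm : AEStronglyMeasurable[⨆ i : ℤ, shiftAlgebra T F₀ i] g μ := by
    refine AEStronglyMeasurable.sub (AEStronglyMeasurable.mul ?_ ?_) aestronglyMeasurable_const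
    · exact aestronglyMeasurable_of_le (le_iSup _ _) (aestronglyMeasurable_process hT hfm 0)
    · exact aestronglyMeasurable_of_le (le_iSup _ _) (aestronglyMeasurable_process hT hfm m)
  have h := (hS.tendsto_birkhoff hgL hg0 hgm 1).comp (tendsto_sub_atTop_nat m)
  refine squeeze_zero (fun _ => l2norm_nonneg) (fun n => ?_) h
  have e : ∀ ω, ∑ a ∈ Finset.range n, ∑ b ∈ Finset.range n, (if (b : ℤ) - a = k then
        process T f (a + 1) ω * process T f (b + 1) ω - autocov μ T f k else 0) =
      ∑ i ∈ Finset.range (n - m), process T g (i + 1) ω := by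
    intro ω
    have := sum_lag_mul_self n k (fun a => process T f (a + 1) ω) (autocov μ T f k)
    rw [this]
    refine Finset.sum_congr rfl fun i _ => ?_
    simp only [hg, process, iter_comp_apply]
    rw [show (0 : ℤ) + (i + 1) = i + 1 by ring,
      show ((i + m : ℕ) : ℤ) + 1 = m + (i + 1) by push_cast; ring]
  simp only [nearLag, e, Function.comp_apply]
  rw [l2norm_const_mul, l2norm_const_mul]
  rcases Nat.eq_zero_or_pos (n - m) with h0 | h0
  · simp [h0, l2norm]
  · refine mul_le_mul_of_nonneg_right ?_ l2norm_nonneg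
    have h1 : (0 : ℝ) < (n - m : ℕ) := by exact_mod_cast h0
    rw [abs_of_nonneg (by positivity), abs_of_nonneg (by positivity)]
    gcongr
    exact Nat.sub_le _ _

variable {s : Finset ℤ} {D : ℤ → Ω → ℝ}

/-- The finite moving sum of martingale differences. -/
def movingSum (T : Ω ≃ᵐ Ω) (s : Finset ℤ) (D : ℤ → Ω → ℝ) (ω : Ω) : ℝ :=
  ∑ j ∈ s, process T (D j) (-j) ω

lemma process_movingSum (i : ℤ) (ω : Ω) :
    process T (movingSum T s D) i ω = ∑ j ∈ s, process T (D j) (i - j) ω := by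
  simp [movingSum, process, iter_comp_apply, neg_add_eq_sub]

lemma natAbs_sub_le_of_mem {j j' : ℤ} (hj : j ∈ s) (hj' : j' ∈ s) :
    j' - j ≤ ((2 * ∑ i ∈ s, i.natAbs : ℕ) : ℤ) := by
  have h1 := Finset.single_le_sum (f := Int.natAbs) (fun _ _ => Nat.zero_le _) hj
  have h2 := Finset.single_le_sum (f := Int.natAbs) (fun _ _ => Nat.zero_le _) hj'
  omega

lemma memLp_movingSum (hS : IsRegularShift F₀ μ T)
    (hD : ∀ j, IsMartingaleDiff F₀ μ T (D j)) : MemLp (movingSum T s D) 2 μ :=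
  memLp_finsetSum _ fun j _ => memLp_process hS.measurePreserving (hD j).memLp _

lemma aestronglyMeasurable_movingSum (hS : IsRegularShift F₀ μ T)
    (hD : ∀ j, IsMartingaleDiff F₀ μ T (D j)) : AEStronglyMeasurable[shiftAlgebra T F₀
    (∑ i ∈ s, i.natAbs : ℕ)] (movingSum T s D) μ := by
  refine aestronglyMeasurable_sum _ fun j hj => ?_
  have h1 := Finset.single_le_sum (f := Int.natAbs) (fun _ _ => Nat.zero_le _) hj
  exact aestronglyMeasurable_of_le (shiftAlgebra_mono hS.mono (by omega))
    ((hD j).meas_process hS.measurePreserving (-j))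

/-- Two indices of `s` differ by at most `2 ∑ |i|`; at a larger lag the martingale differences never
meet at the same time. -/
lemma autocov_movingSum_eq_zero (hS : IsRegularShift F₀ μ T)
    (hD : ∀ j, IsMartingaleDiff F₀ μ T (D j)) {k : ℤ} (hk : 2 * ∑ i ∈ s, i.natAbs < k.natAbs) :
    autocov μ T (movingSum T s D) k = 0 := by
  have hT := hS.measurePreserving
  have hi : ∀ i j, Integrable
      (fun ω => process T (D i) (0 - i) ω * process T (D j) (k - j) ω) μ := fun i j =>
    integrable_mul_of_memLp (memLp_process hT (hD i).memLp _) (memLp_process hT (hD j).memLp _)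
  simp only [autocov, process_movingSum, Finset.sum_mul_sum]
  rw [integral_finsetSum _ fun i _ => integrable_finsetSum _ fun j _ => hi i j]
  refine Finset.sum_eq_zero fun i his => ?_
  rw [integral_finsetSum _ fun j _ => hi i j]
  refine Finset.sum_eq_zero fun j hjs => ?_
  have h1 := natAbs_sub_le_of_mem his hjs
  have h2 := natAbs_sub_le_of_mem hjs his
  exact (hD i).integral_process_mul_process hT hS.mono (hD j) (by omega)

lemma movingSum_bounded (hT : MeasurePreserving T μ μ)
    (hb : ∀ j, ∃ M : ℝ, ∀ᵐ ω ∂μ, |D j ω| ≤ M) : ∃ M : ℝ, ∀ᵐ ω ∂μ, |movingSum T s D ω| ≤ M := by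
  choose M hM using hb
  refine ⟨∑ j ∈ s, M j, ?_⟩
  filter_upwards [ae_all_iff.2 fun j : ℤ => process_bounded hT (hM j) (-j)]
    with ω h
  exact (Finset.abs_sum_le_sum_abs _ _).trans (Finset.sum_le_sum fun j _ => h j)

/-- Bilinear expansion over pairs of `s × s` and `l2norm_far_lags_le` for each pair. The constant
does not depend on the weights, which vary with `n` in the application. -/
lemma exists_l2norm_far_lags_le [IsProbabilityMeasure μ] (hS : IsRegularShift F₀ μ T)
    (hD : ∀ j, IsMartingaleDiff F₀ μ T (D j))
    (hb : ∀ j, ∃ M : ℝ, ∀ᵐ ω ∂μ, |D j ω| ≤ M) : ∃ K : ℝ, ∀ (v : ℤ → ℝ) (n : ℕ) (S : ℝ),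
    (∀ b < n, ∑ a ∈ Finset.range n, v ((b : ℤ) - a) ^ 2 ≤ S) →
    l2norm μ (fun ω => farLags (2 * ∑ i ∈ s, i.natAbs) n v
      fun a => process T (movingSum T s D) (a + 1) ω) ≤ K * √(n * S) := by
  have hT := hS.measurePreserving
  choose M hM using hb
  refine ⟨∑ j ∈ s, ∑ j' ∈ s, |M j'| * l2norm μ (D j), fun v n S hv => ?_⟩
  set N := 2 * ∑ i ∈ s, i.natAbs
  have e : ∀ ω, (∑ b ∈ Finset.range n, ∑ a ∈ Finset.range n,
      if (N : ℤ) < (b : ℤ) - a then v ((b : ℤ) - a) *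
        (process T (movingSum T s D) (a + 1) ω * process T (movingSum T s D) (b + 1) ω) else 0) =
      ∑ j ∈ s, ∑ j' ∈ s, ∑ b ∈ Finset.range n, ∑ a ∈ Finset.range n,
        if (N : ℤ) < (b : ℤ) - a then v ((b : ℤ) - a) *
          (process T (D j) (a + 1 - j) ω * process T (D j') (b + 1 - j') ω) else 0 := by
    intro ω
    have h : ∀ b a : ℕ, (if (N : ℤ) < (b : ℤ) - a then v ((b : ℤ) - a) *
        (process T (movingSum T s D) (a + 1) ω * process T (movingSum T s D) (b + 1) ω) else 0) =
        ∑ j ∈ s, ∑ j' ∈ s, if (N : ℤ) < (b : ℤ) - a then v ((b : ℤ) - a) *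
          (process T (D j) (a + 1 - j) ω * process T (D j') (b + 1 - j') ω) else 0 := by
      intro b a
      split_ifs
      · rw [process_movingSum, process_movingSum, Finset.sum_mul_sum]
        simp only [Finset.mul_sum]
      · simp
    simp only [h]
    rw [Finset.sum_congr rfl fun b _ => Finset.sum_comm, Finset.sum_comm]
    refine Finset.sum_congr rfl fun j _ => ?_
    rw [Finset.sum_congr rfl fun b _ => Finset.sum_comm, Finset.sum_comm]
  have hmem : ∀ j j', MemLp (fun ω => ∑ b ∈ Finset.range n, ∑ a ∈ Finset.range n,
        if (N : ℤ) < (b : ℤ) - a then v ((b : ℤ) - a) *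
          (process T (D j) (a + 1 - j) ω * process T (D j') (b + 1 - j') ω) else 0) 2 μ := by
    intro j j'
    refine memLp_finsetSum _ fun b _ => memLp_finsetSum _ fun a _ => ?_
    split_ifs
    · exact (memLp_mul_of_bounded (memLp_process hT (hD j).memLp _).1 (process_bounded hT (hM j) _)
        (memLp_process hT (hD j').memLp _)).const_mul _
    · exact MemLp.zero
  simp only [farLags, e]
  refine (l2norm_sum_le _ fun j _ => memLp_finsetSum _ fun j' _ => hmem j j').trans ?_
  rw [Finset.sum_mul]
  refine Finset.sum_le_sum fun j hj => ?_
  refine (l2norm_sum_le _ fun j' _ => hmem j j').trans ?_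
  rw [Finset.sum_mul]
  refine Finset.sum_le_sum fun j' hj' => ?_
  exact l2norm_far_lags_le hS (hD j) (hD j') (hM j) (hM j') (natAbs_sub_le_of_mem hj hj') v n S hv

/-- Law of large numbers for the weighted quadratic form of a moving sum. -/
lemma tendsto_lagForm_movingSum [IsProbabilityMeasure μ] (hS : IsRegularShift F₀ μ T)
    (hD : ∀ j, IsMartingaleDiff F₀ μ T (D j))
    (hb : ∀ j, ∃ M : ℝ, ∀ᵐ ω ∂μ, |D j ω| ≤ M) {w : ℕ → ℤ → ℝ} {ρ : ℤ → ℝ} (hw : IsLagWeight μ w ρ) :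
    Tendsto (fun n : ℕ => ∫ ω, |(n : ℝ)⁻¹ * lagForm (w n) n
        (fun a => process T (movingSum T s D) (a + 1) ω)
        (fun a => process T (movingSum T s D) (a + 1) ω) -
      (n : ℝ)⁻¹ * ∫ ω', lagForm (w n) n (fun a => process T (movingSum T s D) (a + 1) ω')
        (fun a => process T (movingSum T s D) (a + 1) ω') ∂μ| ∂μ) atTop (𝓝 0) := by
  have hT := hS.measurePreserving
  obtain ⟨C, hC⟩ := hw.bounded
  obtain ⟨M, hM⟩ := movingSum_bounded (s := s) hT hb
  obtain ⟨K, hK⟩ := exists_l2norm_far_lags_le (s := s) hS hD hb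
  have hfL := memLp_movingSum (s := s) hS hD
  have hfm := aestronglyMeasurable_movingSum (s := s) hS hD
  have hzero := fun k => autocov_movingSum_eq_zero (s := s) hS hD (k := k)
  set f := movingSum T s D
  set N := 2 * ∑ i ∈ s, i.natAbs
  set I := Finset.Icc (-N : ℤ) N
  set S : ℕ → ℝ := fun n => ∑ k ∈ Finset.Ioo (-n : ℤ) n, w n k ^ 2 with hSdef
  set near : ℕ → ℤ → Ω → ℝ := fun n k ω => nearLag n k (autocov μ T f k)
    fun a => process T f (a + 1) ω
  set far : ℕ → (ℤ → ℝ) → Ω → ℝ := fun n v ω => farLags N n v fun a => process T f (a + 1) ω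
  have hfp : ∀ i, MemLp (process T f i) 2 μ := fun i => memLp_process hT hfL i
  have hprod : ∀ a b : ℕ, MemLp (fun ω => process T f (a + 1) ω * process T f (b + 1) ω) 2 μ :=
    fun a b => memLp_mul_of_bounded (hfp _).1 (process_bounded hT hM _) (hfp _)
  have hnearL : ∀ n k, MemLp (near n k) 2 μ := fun n k => memLp_nearLag hprod _ _ _
  have hfarL : ∀ n v, MemLp (far n v) 2 μ := fun n v => memLp_farLags hprod _ _ _
  -- The near lags are finitely many with bounded weights; each of the two far parts costs `n⁻¹ √(n
  -- S_n) = √(S_n / n)`, which vanishes by `IsLagWeight.small`.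
  have hlim : Tendsto (fun n : ℕ => ∑ k ∈ I, C * l2norm μ (near n k) +
      (K * √((n : ℝ)⁻¹ * S n) + K * √((n : ℝ)⁻¹ * S n))) atTop (𝓝 0) := by
    have h1 : Tendsto (fun n : ℕ => ∑ k ∈ I, C * l2norm μ (near n k)) atTop
        (𝓝 (∑ k ∈ I, C * 0)) :=
      tendsto_finsetSum _ fun k _ => (hS.tendsto_near_lag hM hfm hfL k).const_mul C
    have h2 := (hw.small.sqrt).const_mul K
    simpa using h1.add (h2.add h2)
  refine squeeze_zero (fun _ => integral_nonneg fun _ => abs_nonneg _) (fun n => ?_) hlim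
  rw [integral_lagForm_process hT hfL]
  simp only [fun ω => lagForm_sub_eq_nearLag_add_farLags N n (w n) (autocov μ T f)
    (fun a => process T f (a + 1) ω) hzero]
  have hm1 : MemLp (fun ω => ∑ k ∈ I, w n k * near n k ω) 2 μ :=
    memLp_linear_combination _ _ (hnearL n)
  have hm2 := (hfarL n (w n)).const_mul (n : ℝ)⁻¹
  have hm3 := (hfarL n (fun k => w n (-k))).const_mul (n : ℝ)⁻¹
  refine (integral_abs_le_l2norm (hm1.add (hm2.add hm3))).trans ?_
  refine (l2norm_add_le hm1 (hm2.add hm3)).trans (add_le_add ?_ ?_)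
  · refine (l2norm_sum_le _ fun k _ => (hnearL n k).const_mul _).trans ?_
    refine Finset.sum_le_sum fun k _ => ?_
    rw [l2norm_const_mul]
    exact mul_le_mul_of_nonneg_right (hC n k) l2norm_nonneg
  · have hsq : (n : ℝ)⁻¹ * √(n * S n) = √((n : ℝ)⁻¹ * S n) := by
      rcases Nat.eq_zero_or_pos n with rfl | hn
      · simp
      · have hn0 : (0 : ℝ) < n := by exact_mod_cast hn
        rw [show (n : ℝ)⁻¹ * S n = (n : ℝ)⁻¹ ^ 2 * (n * S n) by field_simp,
          Real.sqrt_mul (sq_nonneg _), Real.sqrt_sq (by positivity)]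
    have hn : (0 : ℝ) ≤ (n : ℝ)⁻¹ := by positivity
    refine (l2norm_add_le hm2 hm3).trans (add_le_add ?_ ?_)
    · rw [l2norm_const_mul, abs_of_nonneg hn, ← hsq, mul_left_comm]
      exact mul_le_mul_of_nonneg_left (hK _ n (S n) fun b hbn =>
        sum_sub_natCast_le n hbn (fun k => w n k ^ 2) fun _ => sq_nonneg _) hn
    · rw [l2norm_const_mul, abs_of_nonneg hn, ← hsq, mul_left_comm]
      refine mul_le_mul_of_nonneg_left (hK _ n (S n) fun b hbn => ?_) hn
      simp only [neg_sub]
      exact sum_natCast_sub_le n hbn (fun k => w n k ^ 2) fun _ => sq_nonneg _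

/-- Convergence in `L¹` of the weighted quadratic form of the errors. -/
theorem IsHannanProcess.tendsto_lagForm [IsProbabilityMeasure μ] {ε₀ : Ω → ℝ}
    (hε : IsHannanProcess F₀ μ T ε₀) {w : ℕ → ℤ → ℝ} {ρ : ℤ → ℝ} (hw : IsLagWeight μ w ρ) :
    Tendsto (fun n : ℕ => ∫ ω, |(n : ℝ)⁻¹ * lagForm (w n) n (fun a => process T ε₀ (a + 1) ω)
      (fun a => process T ε₀ (a + 1) ω) - ∑' k : ℤ, autocov μ T ε₀ k * ρ k| ∂μ) atTop (𝓝 0) := by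
  have hT := hε.measurePreserving
  have hS := hε.isRegularShift
  obtain ⟨C, hC0, hC⟩ := hw.multiplier
  obtain ⟨H, hH⟩ := hε.exists_isBessel
  set L := ∑' k : ℤ, autocov μ T ε₀ k * ρ k
  set Q : ℕ → (ℕ → Ω → ℝ) → Ω → ℝ := fun n u ω =>
    (n : ℝ)⁻¹ * lagForm (w n) n (fun a => u a ω) (fun a => u a ω) with hQ
  have hmean : Tendsto (fun n : ℕ => |∫ ω, Q n (fun a => process T ε₀ (a + 1)) ω ∂μ - L|) atTop
      (𝓝 0) := by
    have h := hw.tendsto_integral hT hε.memLp hε.summable_autocov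
    have h2 := (h.sub_const L).abs
    rw [sub_self, abs_zero] at h2
    simpa only [← integral_const_mul] using h2
  rw [Metric.tendsto_atTop]
  intro δ hδ
  -- The errors, the moving sum and their difference will have Bessel bounds `H`, `H + δ'` and `δ'`;
  -- the displayed quantity is the resulting L¹ cost of the replacement. It is paid twice, for the
  -- forms and for their means; the law of large numbers and the convergence of the means take the
  -- other two quarters of `δ`.
  obtain ⟨δ', hδ', hsmall⟩ : ∃ δ' > 0, C * (δ' * H + (H + δ') * δ') < δ / 4 := by
    have hcont : Tendsto (fun x : ℝ => C * (x * H + (H + x) * x)) (𝓝[>] 0) (𝓝 0) := by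
      have : Continuous fun x : ℝ => C * (x * H + (H + x) * x) := by fun_prop
      have h := this.tendsto 0
      simp only [zero_mul, mul_zero, add_zero] at h
      exact h.mono_left nhdsWithin_le_nhds
    obtain ⟨x, hx1, hx2⟩ := ((hcont.eventually (gt_mem_nhds (show 0 < δ / 4 by positivity))).and
      self_mem_nhdsWithin).exists
    exact ⟨x, hx2, hx1⟩
  obtain ⟨s, D, hD, hDb, hB⟩ := hε.exists_approx hδ'
  have hfL := memLp_movingSum (s := s) hS hD
  have hlln := tendsto_lagForm_movingSum (s := s) hS hD hDb hw
  set f := movingSum T s D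
  set e : ℕ → Ω → ℝ := fun a => process T ε₀ (a + 1)
  set u : ℕ → Ω → ℝ := fun a => process T f (a + 1) with hu
  have hB1 : IsBessel μ (fun a ω => e a ω - u a ω) δ' := by
    refine hB.congr_ae fun a => Eventually.of_forall fun ω => ?_
    simp only [hu, f, process_movingSum, e]
  have hB2 : IsBessel μ u (H + δ') :=
    (hH.sub hB1).congr_ae fun a => Eventually.of_forall fun ω => by simp [e]
  have hQi : ∀ n v, (∀ a, MemLp (v a) 2 μ) → Integrable (Q n v) μ := fun n v hv =>
    (integrable_lagForm hv hv _ _).const_mul _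
  have hdiff : ∀ n, ∫ ω, |Q n e ω - Q n u ω| ∂μ ≤ C * (δ' * H + (H + δ') * δ') := by
    intro n
    have h1 := hC n _ _ _ _ hB1 hH
    have h2 := hC n _ _ _ _ hB2 hB1
    have hi1 := (integrable_lagForm hB1.memLp hH.memLp (w n) n)
    have hi2 := (integrable_lagForm hB2.memLp hB1.memLp (w n) n)
    -- `B(e, e) - B(u, u) = B(e - u, e) + B(u, e - u)`.
    have eq : ∀ ω, Q n e ω - Q n u ω =
        (n : ℝ)⁻¹ * (lagForm (w n) n (fun a => e a ω - u a ω) (fun a => e a ω) +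
          lagForm (w n) n (fun a => u a ω) (fun a => e a ω - u a ω)) := by
      intro ω
      have a1 := lagForm_add_left (w n) n (fun a => e a ω - u a ω) (fun a => u a ω)
        (fun a => e a ω)
      have a2 := lagForm_add_right (w n) n (fun a => u a ω) (fun a => e a ω - u a ω)
        (fun a => u a ω)
      simp only [sub_add_cancel] at a1 a2
      simp only [hQ]
      rw [a1, a2]
      ring
    calc ∫ ω, |Q n e ω - Q n u ω| ∂μ
        ≤ ∫ ω, (n : ℝ)⁻¹ * (|lagForm (w n) n (fun a => e a ω - u a ω) (fun a => e a ω)| +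
          |lagForm (w n) n (fun a => u a ω) (fun a => e a ω - u a ω)|) ∂μ := by
          refine integral_mono ((hQi n e hH.memLp).sub (hQi n u hB2.memLp)).abs
            ((hi1.abs.add hi2.abs).const_mul _) fun ω => ?_
          simp only [eq, abs_mul]
          rw [abs_of_nonneg (show (0 : ℝ) ≤ (n : ℝ)⁻¹ by positivity)]
          gcongr
          exact abs_add_le _ _
      _ ≤ (n : ℝ)⁻¹ * (C * n * δ' * H + C * n * (H + δ') * δ') := by
          rw [integral_const_mul, integral_add hi1.abs hi2.abs]
          gcongr
      _ = (n : ℝ)⁻¹ * n * (C * (δ' * H + (H + δ') * δ')) := by ring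
      _ ≤ 1 * (C * (δ' * H + (H + δ') * δ')) := by
          have := hH.nonneg
          gcongr
          rcases Nat.eq_zero_or_pos n with rfl | hn
          · simp
          · exact (inv_mul_cancel₀ (by positivity)).le
      _ = _ := one_mul _
  obtain ⟨N1, hN1⟩ := eventually_atTop.1
    (hlln.eventually (gt_mem_nhds (show 0 < δ / 4 by positivity)))
  obtain ⟨N2, hN2⟩ := eventually_atTop.1
    (hmean.eventually (gt_mem_nhds (show 0 < δ / 4 by positivity)))
  refine ⟨max N1 N2, fun n hn => ?_⟩
  have h1 := hN1 n (le_of_max_le_left hn)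
  have h2 := hN2 n (le_of_max_le_right hn)
  have h3 := hdiff n
  simp only [← integral_const_mul] at h1
  rw [Real.dist_0_eq_abs, abs_of_nonneg (integral_nonneg fun _ => abs_nonneg _)]
  have ie := hQi n e hH.memLp
  have iu := hQi n u hB2.memLp
  have h4 : |∫ ω, Q n u ω ∂μ - ∫ ω, Q n e ω ∂μ| ≤ C * (δ' * H + (H + δ') * δ') := by
    rw [abs_sub_comm, ← integral_sub ie iu]
    exact abs_integral_le_integral_abs.trans h3
  have h5 : ∫ ω, |Q n e ω - L| ∂μ ≤ ∫ ω, (|Q n e ω - Q n u ω| +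
      |Q n u ω - ∫ ω', Q n u ω' ∂μ| + (|∫ ω, Q n u ω ∂μ - ∫ ω, Q n e ω ∂μ| +
      |∫ ω, Q n e ω ∂μ - L|)) ∂μ := by
    refine integral_mono (ie.sub (integrable_const _)).abs
      (((ie.sub iu).abs.add (iu.sub (integrable_const _)).abs).add (integrable_const _))
      fun ω => ?_
    calc |Q n e ω - L| = |((Q n e ω - Q n u ω) + (Q n u ω - ∫ ω', Q n u ω' ∂μ)) +
        ((∫ ω, Q n u ω ∂μ - ∫ ω, Q n e ω ∂μ) + (∫ ω, Q n e ω ∂μ - L))| := by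
          congr 1
          ring
      _ ≤ _ := (abs_add_le _ _).trans (add_le_add (abs_add_le _ _) (abs_add_le _ _))
  rw [integral_add (by exact (ie.sub iu).abs.add (iu.sub (integrable_const _)).abs)
    (integrable_const _), integral_add (by exact (ie.sub iu).abs)
    (by exact (iu.sub (integrable_const _)).abs), integral_const] at h5
  simp only [probReal_univ, one_smul] at h5
  refine h5.trans_lt ?_
  have h1' : ∫ ω, |Q n u ω - ∫ ω', Q n u ω' ∂μ| ∂μ < δ / 4 := h1
  linarith

end QuadraticForm

/-! ### Lag weights from a taper kernel and a design -/

section Multiplier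

variable {Ω : Type*} {mΩ : MeasurableSpace Ω} {μ : Measure Ω}

/-- `∑_{m, m' < n, m' - m = k} z_m z'_{m'}`. -/
def lagProd (n : ℕ) (z z' : ℕ → ℝ) (k : ℤ) : ℝ :=
  ∑ m ∈ Finset.range n, ∑ m' ∈ Finset.range n, if (m' : ℤ) - m = k then z m * z' m' else 0

lemma sum_ite_sub_eq_le_one (n : ℕ) (m : ℤ) (k : ℤ) :
    ∑ m' ∈ Finset.range n, (if (m' : ℤ) - m = k then (1 : ℝ) else 0) ≤ 1 := by
  rw [← Finset.sum_filter, Finset.sum_const, nsmul_eq_mul, mul_one]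
  have : (Finset.filter (fun m' : ℕ => (m' : ℤ) - m = k) (Finset.range n)).card ≤ 1 := by
    rw [Finset.card_le_one]
    intro a ha b hb
    rw [Finset.mem_filter] at ha hb
    omega
  exact_mod_cast this

/-- `|z z'| ≤ (z² + z'²) / 2`, and on a given diagonal each index occurs at most once. -/
lemma abs_lagProd_le_one (n : ℕ) {z z' : ℕ → ℝ} (hz : ∑ m ∈ Finset.range n, z m ^ 2 ≤ 1)
    (hz' : ∑ m ∈ Finset.range n, z' m ^ 2 ≤ 1) (k : ℤ) : |lagProd n z z' k| ≤ 1 := by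
  have h1 : |lagProd n z z' k| ≤ ∑ m ∈ Finset.range n, ∑ m' ∈ Finset.range n,
      (z m ^ 2 / 2 * (if (m' : ℤ) - m = k then (1 : ℝ) else 0) +
        z' m' ^ 2 / 2 * (if (m' : ℤ) - m = k then (1 : ℝ) else 0)) := by
    refine (Finset.abs_sum_le_sum_abs _ _).trans (Finset.sum_le_sum fun m _ => ?_)
    refine (Finset.abs_sum_le_sum_abs _ _).trans (Finset.sum_le_sum fun m' _ => ?_)
    split_ifs
    · rw [abs_le]
      constructor <;> nlinarith [sq_nonneg (z m + z' m'), sq_nonneg (z m - z' m')]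
    · simp
  refine h1.trans ?_
  simp only [Finset.sum_add_distrib]
  have h2 : ∑ m ∈ Finset.range n, ∑ m' ∈ Finset.range n,
      z m ^ 2 / 2 * (if (m' : ℤ) - m = k then (1 : ℝ) else 0) ≤ 1 / 2 := by
    calc _ ≤ ∑ m ∈ Finset.range n, z m ^ 2 / 2 := by
          refine Finset.sum_le_sum fun m _ => ?_
          rw [← Finset.mul_sum]
          exact mul_le_of_le_one_right (by positivity) (sum_ite_sub_eq_le_one n m k)
      _ ≤ 1 / 2 := by
          rw [← Finset.sum_div]
          gcongr
  have h3 : ∑ m ∈ Finset.range n, ∑ m' ∈ Finset.range n,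
      z' m' ^ 2 / 2 * (if (m' : ℤ) - m = k then (1 : ℝ) else 0) ≤ 1 / 2 := by
    rw [Finset.sum_comm]
    calc _ ≤ ∑ m ∈ Finset.range n, z' m ^ 2 / 2 := by
          refine Finset.sum_le_sum fun m _ => ?_
          rw [← Finset.mul_sum]
          refine mul_le_of_le_one_right (by positivity) ?_
          refine le_trans (le_of_eq ?_) (sum_ite_sub_eq_le_one n m (-k))
          refine Finset.sum_congr rfl fun i _ => if_congr (by omega) rfl rfl
      _ ≤ 1 / 2 := by
          rw [← Finset.sum_div]
          gcongr
  linarith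

/-- The sequence `z` restricted to `{0, …, n - 1}` and shifted by `s`. -/
def shiftedSeq (n : ℕ) (z : ℕ → ℝ) (s : ℤ) (a : ℕ) : ℝ :=
  ∑ m ∈ Finset.range n, if (m : ℤ) - a = s then z m else 0

lemma shiftedSeq_sq_le (n : ℕ) (z : ℕ → ℝ) (s : ℤ) (a : ℕ) :
    shiftedSeq n z s a ^ 2 ≤ ∑ m ∈ Finset.range n, if (m : ℤ) - a = s then z m ^ 2 else 0 := by
  by_cases h : ∃ m ∈ Finset.range n, (m : ℤ) - a = s
  · obtain ⟨m, hm, hms⟩ := h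
    rw [shiftedSeq, Finset.sum_eq_single_of_mem m hm, Finset.sum_eq_single_of_mem m hm, if_pos hms,
      if_pos hms]
    · intro b _ hb
      rw [if_neg (by omega)]
    · intro b _ hb
      rw [if_neg (by omega)]
  · push Not at h
    rw [shiftedSeq, Finset.sum_eq_zero fun m hm => if_neg (h m hm),
      Finset.sum_eq_zero fun m hm => if_neg (h m hm)]
    simp

/-- For each position `a`, the shifts place every `z m` at `a` exactly once, so each `a` receives a
total of at most `1`. -/
lemma sum_shiftedSeq_sq_le (n : ℕ) {z : ℕ → ℝ} (hz : ∑ m ∈ Finset.range n, z m ^ 2 ≤ 1) :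
    ∑ s ∈ Finset.Ioo (-n : ℤ) n, ∑ a ∈ Finset.range n, shiftedSeq n z s a ^ 2 ≤ n := by
  calc _ ≤ ∑ s ∈ Finset.Ioo (-n : ℤ) n, ∑ a ∈ Finset.range n, ∑ m ∈ Finset.range n,
        (if (m : ℤ) - a = s then z m ^ 2 else 0) :=
        Finset.sum_le_sum fun s _ => Finset.sum_le_sum fun a _ => shiftedSeq_sq_le n z s a
    _ = ∑ a ∈ Finset.range n, ∑ m ∈ Finset.range n, z m ^ 2 :=
        (sum_eq_sum_lag n fun a m => z m ^ 2).symm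
    _ ≤ ∑ a ∈ Finset.range n, 1 := Finset.sum_le_sum fun a _ => hz
    _ = n := by simp

/-- The constraint `m' - m = b - a` says that `m - a` and `m' - b` are a common shift `s`; for fixed
`s` the sum factorizes into two linear forms. This is what allows Cauchy–Schwarz. -/
lemma lagForm_lagProd (n : ℕ) (z z' u v : ℕ → ℝ) :
    lagForm (lagProd n z z') n u v = ∑ s ∈ Finset.Ioo (-n : ℤ) n,
      (∑ a ∈ Finset.range n, shiftedSeq n z s a * u a) *
        ∑ b ∈ Finset.range n, shiftedSeq n z' s b * v b := by
  simp only [lagForm, Finset.sum_mul_sum]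
  rw [Finset.sum_comm]
  rw [Finset.sum_comm' (s := Finset.Ioo (-n : ℤ) n) (t := fun _ => Finset.range n)
    (t' := Finset.range n) (s' := fun _ => Finset.Ioo (-n : ℤ) n) (by simp)]
  rw [Finset.sum_comm]
  refine Finset.sum_congr rfl fun a ha => ?_
  rw [Finset.sum_comm]
  refine Finset.sum_congr rfl fun b hb => ?_
  have e : ∀ s, shiftedSeq n z s a * u a * (shiftedSeq n z' s b * v b) =
      (∑ m ∈ Finset.range n, ∑ m' ∈ Finset.range n, if (m : ℤ) - a = s then
        (if (m' : ℤ) - b = s then z m * z' m' else 0) else 0) * (u a * v b) := by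
    intro s
    rw [mul_mul_mul_comm, shiftedSeq, shiftedSeq, Finset.sum_mul_sum]
    congr 1
    refine Finset.sum_congr rfl fun m _ => Finset.sum_congr rfl fun m' _ => ?_
    split_ifs <;> simp
  simp only [e, ← Finset.sum_mul]
  congr 1
  rw [Finset.sum_comm, lagProd]
  refine Finset.sum_congr rfl fun m hm => ?_
  rw [Finset.sum_comm]
  refine Finset.sum_congr rfl fun m' hm' => ?_
  rw [Finset.mem_range] at ha hb hm hm'
  rw [Finset.sum_ite_eq, if_pos (show (m : ℤ) - a ∈ Finset.Ioo (-n : ℤ) n by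
    rw [Finset.mem_Ioo]; omega)]
  exact if_congr (by omega) rfl rfl

/-- Cauchy–Schwarz in L² and the Bessel bounds for each shift, then Cauchy–Schwarz over the shifts;
the squared coefficients sum to at most `n`. -/
lemma integral_abs_lagForm_lagProd_le {u v : ℕ → Ω → ℝ} {Hu Hv : ℝ} (hu : IsBessel μ u Hu)
    (hv : IsBessel μ v Hv) (n : ℕ) {z z' : ℕ → ℝ} (hz : ∑ m ∈ Finset.range n, z m ^ 2 ≤ 1)
    (hz' : ∑ m ∈ Finset.range n, z' m ^ 2 ≤ 1) :
    ∫ ω, |lagForm (lagProd n z z') n (fun a => u a ω) (fun a => v a ω)| ∂μ ≤ n * Hu * Hv := by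
  set A : ℤ → ℝ := fun s => ∑ a ∈ Finset.range n, shiftedSeq n z s a ^ 2
  set B : ℤ → ℝ := fun s => ∑ a ∈ Finset.range n, shiftedSeq n z' s a ^ 2
  set I := Finset.Ioo (-n : ℤ) n
  have hA : ∀ s, 0 ≤ A s := fun s => Finset.sum_nonneg fun _ _ => sq_nonneg _
  have hB : ∀ s, 0 ≤ B s := fun s => Finset.sum_nonneg fun _ _ => sq_nonneg _
  have hUL : ∀ s, MemLp (fun ω => ∑ a ∈ Finset.range n, shiftedSeq n z s a * u a ω) 2 μ :=
    fun s => memLp_linear_combination _ _ hu.memLp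
  have hVL : ∀ s, MemLp (fun ω => ∑ a ∈ Finset.range n, shiftedSeq n z' s a * v a ω) 2 μ :=
    fun s => memLp_linear_combination _ _ hv.memLp
  have hi := fun s => (integrable_mul_of_memLp (hUL s) (hVL s)).abs
  have h0 := hu.nonneg
  have h0' := hv.nonneg
  calc _ ≤ ∫ ω, ∑ s ∈ I, |(∑ a ∈ Finset.range n, shiftedSeq n z s a * u a ω) *
        ∑ b ∈ Finset.range n, shiftedSeq n z' s b * v b ω| ∂μ := by
        refine integral_mono (integrable_lagForm hu.memLp hv.memLp _ _).abs
          (integrable_finsetSum _ fun s _ => hi s) fun ω => ?_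
        simp only [lagForm_lagProd]
        exact Finset.abs_sum_le_sum_abs _ _
    _ = ∑ s ∈ I, ∫ ω, |(∑ a ∈ Finset.range n, shiftedSeq n z s a * u a ω) *
        ∑ b ∈ Finset.range n, shiftedSeq n z' s b * v b ω| ∂μ :=
        integral_finsetSum _ fun s _ => hi s
    _ ≤ ∑ s ∈ I, Hu * Hv * (√(A s) * √(B s)) := by
        refine Finset.sum_le_sum fun s _ => (integral_abs_mul_le (hUL s) (hVL s)).trans ?_
        calc _ ≤ (Hu * √(A s)) * (Hv * √(B s)) :=
              mul_le_mul (hu.bound n _) (hv.bound n _) l2norm_nonneg (by positivity)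
          _ = _ := by ring
    _ = Hu * Hv * ∑ s ∈ I, √(A s) * √(B s) := by rw [Finset.mul_sum]
    _ ≤ Hu * Hv * (√(∑ s ∈ I, A s) * √(∑ s ∈ I, B s)) := by
        gcongr
        exact Real.sum_sqrt_mul_sqrt_le _ hA hB
    _ ≤ Hu * Hv * (√n * √n) := by
        gcongr
        · exact sum_shiftedSeq_sq_le n hz
        · exact sum_shiftedSeq_sq_le n hz'
    _ = n * Hu * Hv := by
        rw [Real.mul_self_sqrt (Nat.cast_nonneg n)]
        ring

/-- A taper kernel is a cosine transform of an integrable function. -/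
lemma IsTaperKernel.exists_cos_transform {K : ℝ → ℝ} (hK : IsTaperKernel K) :
    ∃ κ : ℝ → ℝ, Integrable κ ∧ ∀ t, K t = ∫ θ, κ θ * Real.cos (2 * Real.pi * θ * t) := by
  set f : ℝ → ℂ := fun t => (K t : ℂ) with hf
  have hfc : Continuous f := Complex.continuous_ofReal.comp hK.continuous
  have hfi : Integrable f :=
    hfc.integrable_of_hasCompactSupport (hK.compactSupport.comp_left Complex.ofReal_zero)
  have hF := hK.integrable_fourier
  refine ⟨fun θ => (𝓕 f θ).re, hF.re, fun t => ?_⟩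
  set E : ℝ → ℝ → ℂ := fun t θ => Complex.exp (((2 * Real.pi * θ * t : ℝ) : ℂ) * Complex.I) * 𝓕 f θ
    with hE
  have hEi : ∀ t, Integrable (E t) := fun t =>
    hF.bdd_mul (c := 1) (by fun_prop) (Eventually.of_forall fun θ =>
      (Complex.norm_exp_ofReal_mul_I _).le)
  have hre : ∀ t, K t = ∫ θ, (E t θ).re := by
    intro t
    have h := congrFun (hfc.fourierInv_fourier_eq hfi hF) t
    rw [Real.fourierInv_eq'] at h
    have h2 : (K t : ℂ) = ∫ θ, E t θ := by
      rw [show (K t : ℂ) = f t from rfl, ← h]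
      refine integral_congr_ae (Eventually.of_forall fun θ => ?_)
      simp only [hE, RCLike.inner_apply, conj_trivial, smul_eq_mul]
      congr 4
      ring
    have h3 := congrArg Complex.re h2
    rw [Complex.ofReal_re] at h3
    rw [h3]
    exact (integral_re (𝕜 := ℂ) (hEi t)).symm
  -- Averaging the inversion formula at `t` and `-t`, allowed by evenness of `K`, cancels the sine
  -- terms and leaves the real part of the transform against a cosine.
  have h4 : K t = (∫ θ, (E t θ).re + (E (-t) θ).re) / 2 := by
    have hadd : ∫ θ, (E t θ).re + (E (-t) θ).re = (∫ θ, (E t θ).re) + ∫ θ, (E (-t) θ).re :=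
      integral_add (hEi t).re (hEi (-t)).re
    rw [hadd, ← hre, ← hre, hK.symm]
    ring
  rw [h4, ← integral_div]
  refine integral_congr_ae (Eventually.of_forall fun θ => ?_)
  simp only [hE, Complex.mul_re, Complex.exp_ofReal_mul_I_re, Complex.exp_ofReal_mul_I_im, mul_neg,
    Real.cos_neg, Real.sin_neg]
  ring

/-- The quadratic forms with weights `K(k / h) ∑_m z_m z'_{m+k}` in Bessel sequences are bounded in
`L¹`, uniformly in `h`. -/
lemma integral_abs_lagForm_taper_le {K κ : ℝ → ℝ} (hκ : Integrable κ)
    (hK : ∀ t, K t = ∫ θ, κ θ * Real.cos (2 * Real.pi * θ * t)) {u v : ℕ → Ω → ℝ} {Hu Hv : ℝ}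
    (hu : IsBessel μ u Hu) (hv : IsBessel μ v Hv) (n : ℕ) {z z' : ℕ → ℝ}
    (hz : ∑ m ∈ Finset.range n, z m ^ 2 ≤ 1) (hz' : ∑ m ∈ Finset.range n, z' m ^ 2 ≤ 1) (h : ℝ) :
    ∫ ω, |lagForm (fun k => K (k / h) * lagProd n z z' k) n (fun a => u a ω) (fun a => v a ω)| ∂μ ≤
      (2 * ∫ θ, |κ θ|) * n * Hu * Hv := by
  set Y : Ω → ℝ := fun ω =>
    lagForm (fun k => K (k / h) * lagProd n z z' k) n (fun a => u a ω) (fun a => v a ω) with hY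
  have hYi : Integrable Y μ := integrable_lagForm hu.memLp hv.memLp _ _
  -- The absolute value is dualized by a sign: the L¹ norm becomes linear in the weights, so that
  -- exchanging it with the integral over `θ` involves only finite sums.
  set sgn : ℝ → ℝ := fun y => if 0 ≤ y then 1 else -1 with hsgn
  have hsm : Measurable sgn :=
    Measurable.ite measurableSet_Ici measurable_const measurable_const
  have hs1 : ∀ y, |sgn y| ≤ 1 := by
    intro y
    simp only [hsgn]
    split_ifs <;> simp
  set σ : Ω → ℝ := fun ω => sgn (Y ω) with hσ
  have hσm : AEStronglyMeasurable σ μ :=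
    (hsm.comp_aemeasurable hYi.1.aemeasurable).aestronglyMeasurable
  have hσi : ∀ {g : Ω → ℝ}, Integrable g μ → Integrable (fun ω => σ ω * g ω) μ := fun hg =>
    hg.bdd_mul hσm (c := 1) (Eventually.of_forall fun ω => hs1 _)
  have habs : ∀ y : ℝ, |y| = sgn y * y := by
    intro y
    simp only [hsgn]
    split_ifs with h0
    · rw [abs_of_nonneg h0, one_mul]
    · rw [abs_of_neg (not_le.1 h0), neg_one_mul]
  set e : ℕ → ℕ → ℝ := fun a b => ∫ ω, σ ω * (u a ω * v b ω) ∂μ with he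
  set N := Finset.range n
  have hlag : ∀ w : ℤ → ℝ, ∫ ω, σ ω * lagForm w n (fun a => u a ω) (fun a => v a ω) ∂μ =
      ∑ a ∈ N, ∑ b ∈ N, w ((b : ℤ) - a) * e a b := by
    intro w
    have hint : ∀ a b : ℕ, Integrable (fun ω => w ((b : ℤ) - a) * (σ ω * (u a ω * v b ω))) μ :=
      fun a b => (hσi (integrable_mul_of_memLp (hu.memLp a) (hv.memLp b))).const_mul _
    calc _ = ∫ ω, ∑ a ∈ N, ∑ b ∈ N, w ((b : ℤ) - a) * (σ ω * (u a ω * v b ω)) ∂μ := by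
          refine integral_congr_ae (Eventually.of_forall fun ω => ?_)
          simp only [lagForm, Finset.mul_sum]
          refine Finset.sum_congr rfl fun a _ => Finset.sum_congr rfl fun b _ => ?_
          ring
      _ = _ := by
          rw [integral_finsetSum _ fun a _ => integrable_finsetSum _ fun b _ => hint a b]
          refine Finset.sum_congr rfl fun a _ => ?_
          rw [integral_finsetSum _ fun b _ => hint a b]
          exact Finset.sum_congr rfl fun b _ => integral_const_mul _ _
  have hcosi : ∀ t, Integrable fun θ => κ θ * Real.cos (2 * Real.pi * θ * t) := fun t =>
    hκ.mul_bdd (c := 1) (by fun_prop) (Eventually.of_forall fun θ => Real.abs_cos_le_one _)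
  set Z : ℝ → Ω → ℝ := fun θ ω =>
    lagForm (fun k => Real.cos (2 * Real.pi * θ * (k / h)) * lagProd n z z' k) n
      (fun a => u a ω) (fun a => v a ω) with hZ
  have hswap : ∫ ω, |Y ω| ∂μ = ∫ θ, κ θ * ∫ ω, σ ω * Z θ ω ∂μ := by
    simp only [habs]
    rw [hlag]
    simp only [hZ, hlag, Finset.mul_sum]
    have hi : ∀ a b : ℕ, Integrable fun θ => κ θ * (Real.cos (2 * Real.pi * θ *
        (((b : ℤ) - a : ℤ) / h)) * lagProd n z z' ((b : ℤ) - a) * e a b) := by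
      intro a b
      refine ((hcosi (((b : ℤ) - a : ℤ) / h)).mul_const
        (lagProd n z z' ((b : ℤ) - a) * e a b)).congr (Eventually.of_forall fun θ => ?_)
      simp only
      ring
    rw [integral_finsetSum _ fun a _ => integrable_finsetSum _ fun b _ => hi a b]
    refine Finset.sum_congr rfl fun a _ => ?_
    rw [integral_finsetSum _ fun b _ => hi a b]
    refine Finset.sum_congr rfl fun b _ => ?_
    rw [hK, mul_assoc, ← integral_mul_const]
    refine integral_congr_ae (Eventually.of_forall fun θ => ?_)
    simp only
    ring
  have hZb : ∀ θ, |∫ ω, σ ω * Z θ ω ∂μ| ≤ 2 * (n * Hu * Hv) := by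
    intro θ
    set c : ℝ := 2 * Real.pi * θ / h with hc
    have hcosb : ∀ a : ℕ, |Real.cos (c * a)| ≤ 1 := fun a => Real.abs_cos_le_one _
    have hsinb : ∀ a : ℕ, |Real.sin (c * a)| ≤ 1 := fun a => Real.abs_sin_le_one _
    have huc := hu.modulate (fun a => Real.cos (c * a)) hcosb
    have hvc := hv.modulate (fun a => Real.cos (c * a)) hcosb
    have hus := hu.modulate (fun a => Real.sin (c * a)) hsinb
    have hvs := hv.modulate (fun a => Real.sin (c * a)) hsinb
    -- `cos(cb - ca)` is the sum of a product of cosines and one of sines, so the modulation moves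
    -- from the weight to the sequences, whose Bessel bounds it preserves. The two terms account for
    -- the factor `2` in the constant.
    have hsplit : ∀ ω, Z θ ω = lagForm (lagProd n z z') n (fun a => Real.cos (c * a) * u a ω)
        (fun a => Real.cos (c * a) * v a ω) + lagForm (lagProd n z z') n
        (fun a => Real.sin (c * a) * u a ω) (fun a => Real.sin (c * a) * v a ω) := by
      intro ω
      simp only [hZ, lagForm, ← Finset.sum_add_distrib]
      refine Finset.sum_congr rfl fun a _ => Finset.sum_congr rfl fun b _ => ?_
      have : 2 * Real.pi * θ * (((b : ℤ) - a : ℤ) / h) = c * b - c * a := by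
        rw [hc]
        push_cast
        ring
      rw [this, Real.cos_sub]
      ring
    have hi1 := integrable_lagForm huc.memLp hvc.memLp (lagProd n z z') n
    have hi2 := integrable_lagForm hus.memLp hvs.memLp (lagProd n z z') n
    have hZi : Integrable (Z θ) μ := integrable_lagForm hu.memLp hv.memLp _ _
    calc _ ≤ ∫ ω, |σ ω * Z θ ω| ∂μ := abs_integral_le_integral_abs
      _ ≤ ∫ ω, (|lagForm (lagProd n z z') n (fun a => Real.cos (c * a) * u a ω)
            (fun a => Real.cos (c * a) * v a ω)| + |lagForm (lagProd n z z') n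
            (fun a => Real.sin (c * a) * u a ω) (fun a => Real.sin (c * a) * v a ω)|) ∂μ := by
          refine integral_mono (hσi hZi).abs (hi1.abs.add hi2.abs) fun ω => ?_
          simp only [abs_mul]
          refine (mul_le_of_le_one_left (abs_nonneg _) (hs1 _)).trans ?_
          rw [hsplit]
          exact abs_add_le _ _
      _ ≤ n * Hu * Hv + n * Hu * Hv := by
          rw [integral_add hi1.abs hi2.abs]
          exact add_le_add (integral_abs_lagForm_lagProd_le huc hvc n hz hz')
            (integral_abs_lagForm_lagProd_le hus hvs n hz hz')
      _ = _ := by ring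
  rw [hswap]
  calc _ ≤ ∫ θ, |κ θ| * (2 * (n * Hu * Hv)) := by
        refine (Real.le_norm_self _).trans (norm_integral_le_of_norm_le (hκ.abs.mul_const _)
          (Eventually.of_forall fun θ => ?_))
        rw [Real.norm_eq_abs, abs_mul]
        gcongr
        exact hZb θ
    _ = _ := by
        rw [integral_mul_const]
        ring

end Multiplier

/-! ### The tapered correlations of the columns as lag weights -/

section TaperWeight

variable {Ω : Type*} {mΩ : MeasurableSpace Ω} {μ : Measure Ω}

/-- The support of the taper leaves at most `2 A h + 1` lags, each of weight at most `C`. -/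
lemma sum_taper_sq_le {K : ℝ → ℝ} {A C : ℝ} (hA : 0 ≤ A) (hC : ∀ t, |K t| ≤ C)
    (hsupp : ∀ t, A < |t| → K t = 0) {h : ℝ} (hh : 0 < h) (g : ℤ → ℝ) (hg : ∀ k, |g k| ≤ 1)
    (s : Finset ℤ) : ∑ k ∈ s, (K (k / h) * g k) ^ 2 ≤ C ^ 2 * (2 * (A * h) + 1) := by
  set N : ℤ := ⌊A * h⌋ with hN
  have hN0 : 0 ≤ N := Int.floor_nonneg.2 (by positivity)
  have hterm : ∀ k : ℤ, (K (k / h) * g k) ^ 2 ≤ if k ∈ Finset.Icc (-N) N then C ^ 2 else 0 := by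
    intro k
    split_ifs with hk
    · rw [mul_pow]
      have h1 : K (k / h) ^ 2 ≤ C ^ 2 := by
        rw [← sq_abs]
        exact pow_le_pow_left₀ (abs_nonneg _) (hC _) 2
      have h2 : g k ^ 2 ≤ 1 := by
        rw [← sq_abs]
        exact pow_le_one₀ (abs_nonneg _) (hg k)
      calc _ ≤ C ^ 2 * 1 := mul_le_mul h1 h2 (sq_nonneg _) (sq_nonneg _)
        _ = _ := mul_one _
    · rw [hsupp, zero_mul, zero_pow two_ne_zero]
      rw [abs_div, abs_of_pos hh, lt_div_iff₀ hh]
      by_contra! hcon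
      refine hk (Finset.mem_Icc.2 ?_)
      rw [← abs_le, hN, Int.le_floor]
      simpa using hcon
  calc _ ≤ ∑ k ∈ s, if k ∈ Finset.Icc (-N) N then C ^ 2 else 0 :=
        Finset.sum_le_sum fun k _ => hterm k
    _ ≤ ∑ k ∈ Finset.Icc (-N) N, C ^ 2 := by
        rw [← Finset.sum_filter]
        refine Finset.sum_le_sum_of_subset_of_nonneg (fun k hk => (Finset.mem_filter.1 hk).2)
          fun _ _ _ => sq_nonneg _
    _ = C ^ 2 * (2 * N + 1) := by
        rw [Finset.sum_const, Int.card_Icc, nsmul_eq_mul]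
        have : (((N + 1 - -N).toNat : ℕ) : ℝ) = 2 * N + 1 := by
          have : (((N + 1 - -N).toNat : ℕ) : ℤ) = 2 * N + 1 := by omega
          exact_mod_cast this
        rw [this, mul_comm]
    _ ≤ _ := by
        gcongr
        exact Int.floor_le _

/-- The weights `K(k / h_n) ∑_m z_m z'_{m+k}` are lag weights. -/
lemma isLagWeight_taper {K : ℝ → ℝ} (hK : IsTaperKernel K) {h : ℕ → ℝ} (hpos : ∀ n, 0 < h n)
    (htop : Tendsto h atTop atTop) (hsmall : Tendsto (fun n : ℕ => h n / n) atTop (𝓝 0))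
    {z z' : ℕ → ℕ → ℝ} (hz : ∀ n, ∑ m ∈ Finset.range n, z n m ^ 2 ≤ 1)
    (hz' : ∀ n, ∑ m ∈ Finset.range n, z' n m ^ 2 ≤ 1) {ρ : ℤ → ℝ}
    (hρ : ∀ k, Tendsto (fun n => lagProd n (z n) (z' n) k) atTop (𝓝 (ρ k))) :
    IsLagWeight μ (fun n k => K (k / h n) * lagProd n (z n) (z' n) k) ρ := by
  obtain ⟨C, hC⟩ := hK.continuous.bounded_above_of_compact_support hK.compactSupport
  simp only [Real.norm_eq_abs] at hC
  obtain ⟨A, hA⟩ := hK.compactSupport.isCompact.isBounded.subset_closedBall (0 : ℝ)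
  -- The radius of the enclosing ball may be negative when the support is empty; `max A 0` serves as
  -- a nonnegative radius.
  have hsupp : ∀ t, max A 0 < |t| → K t = 0 := by
    intro t ht
    by_contra hcon
    have := hA (subset_tsupport K (Function.mem_support.2 hcon))
    rw [mem_closedBall_zero_iff, Real.norm_eq_abs] at this
    exact absurd this (not_le.2 ((le_max_left _ _).trans_lt ht))
  have hg : ∀ n k, |lagProd n (z n) (z' n) k| ≤ 1 := fun n k => abs_lagProd_le_one n (hz n) (hz' n) k
  refine ⟨?_, ⟨C, fun n k => ?_⟩, ?_, fun k => ?_⟩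
  · obtain ⟨κ, hκ, hKκ⟩ := hK.exists_cos_transform
    exact ⟨2 * ∫ θ, |κ θ|, by positivity, fun n u v Hu Hv hu hv =>
      integral_abs_lagForm_taper_le hκ hKκ hu hv n (hz n) (hz' n) (h n)⟩
  · rw [abs_mul]
    exact (mul_le_of_le_one_right (abs_nonneg _) (hg n k)).trans (hC _)
  · have hlim : Tendsto (fun n : ℕ => C ^ 2 * (2 * max A 0 * (h n / n) + (n : ℝ)⁻¹)) atTop (𝓝 0) := by
      simpa using ((hsmall.const_mul (2 * max A 0)).add
        (tendsto_inv_atTop_nhds_zero_nat (𝕜 := ℝ))).const_mul (C ^ 2)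
    refine squeeze_zero (fun n => by positivity) (fun n => ?_) hlim
    calc _ ≤ (n : ℝ)⁻¹ * (C ^ 2 * (2 * (max A 0 * h n) + 1)) := by
          gcongr
          exact sum_taper_sq_le (le_max_right _ _) hC hsupp (hpos n) _ (hg n) _
      _ = _ := by ring
  · have h1 : Tendsto (fun n => K (k / h n)) atTop (𝓝 1) := by
      rw [← hK.zero]
      exact (hK.continuous.tendsto 0).comp (htop.const_div_atTop _)
    simpa using h1.mul (hρ k)

end TaperWeight

/-! ### Finite rank perturbations of a Bessel sequence -/

section Perturbation

variable {Ω : Type*} {mΩ : MeasurableSpace Ω} {μ : Measure Ω}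

lemma lagForm_swap (w : ℤ → ℝ) (n : ℕ) (u v : ℕ → ℝ) :
    lagForm w n u v = lagForm (fun k => w (-k)) n v u := by
  rw [lagForm, lagForm, Finset.sum_comm]
  refine Finset.sum_congr rfl fun a _ => Finset.sum_congr rfl fun b _ => ?_
  rw [neg_sub, mul_comm (u b)]

lemma sum_Ioo_neg (n : ℕ) (g : ℤ → ℝ) :
    ∑ k ∈ Finset.Ioo (-n : ℤ) n, g (-k) = ∑ k ∈ Finset.Ioo (-n : ℤ) n, g k := by
  refine Finset.sum_nbij' (fun k => -k) (fun k => -k) ?_ ?_ ?_ ?_ ?_ <;> simp [Finset.mem_Ioo] <;>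
    omega

/-- Cauchy–Schwarz: the inner product of the coefficients with a vector of norm at most `1` is
bounded by their Euclidean norm. -/
lemma isBessel_of_rank_one {y : Ω → ℝ} (hy : MemLp y 2 μ) {z : ℕ → ℝ}
    (hz : ∀ n, ∑ m ∈ Finset.range n, z m ^ 2 ≤ 1) :
    IsBessel μ (fun a ω => z a * y ω) (l2norm μ y) where
  memLp a := hy.const_mul _
  nonneg := l2norm_nonneg
  bound n c := by
    simp only [← mul_assoc, ← Finset.sum_mul]
    rw [l2norm_const_mul, mul_comm]
    refine mul_le_mul_of_nonneg_left ?_ l2norm_nonneg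
    refine Real.abs_le_sqrt ((Finset.sum_mul_sq_le_sq_mul_sq _ _ _).trans ?_)
    exact mul_le_of_le_one_right (Finset.sum_nonneg fun _ _ => sq_nonneg _) (hz n)

/-- Summing first over the rank one factor leaves a linear form in `u` whose coefficients satisfy `c
a ^ 2 ≤ ∑ w²`. The Bessel bound then costs `√(n ∑ w²)`, against the order `n` of a general pair of
Bessel sequences; this gain makes the passage to residuals harmless. -/
lemma integral_abs_lagForm_rank_one_le {u : ℕ → Ω → ℝ} {H : ℝ} (hu : IsBessel μ u H) {y : Ω → ℝ}
    (hy : MemLp y 2 μ) {z : ℕ → ℝ} (n : ℕ) (hz : ∑ m ∈ Finset.range n, z m ^ 2 ≤ 1)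
    (w : ℤ → ℝ) :
    ∫ ω, |lagForm w n (fun a => u a ω) (fun a => z a * y ω)| ∂μ ≤
      H * √(n * ∑ k ∈ Finset.Ioo (-n : ℤ) n, w k ^ 2) * l2norm μ y := by
  set c : ℕ → ℝ := fun a => ∑ b ∈ Finset.range n, w ((b : ℤ) - a) * z b with hc
  have heq : ∀ ω, lagForm w n (fun a => u a ω) (fun a => z a * y ω) =
      (∑ a ∈ Finset.range n, c a * u a ω) * y ω := by
    intro ω
    simp only [lagForm, hc, Finset.sum_mul]
    refine Finset.sum_congr rfl fun a _ => Finset.sum_congr rfl fun b _ => ?_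
    ring
  simp only [heq]
  refine (integral_abs_mul_le (memLp_linear_combination _ _ hu.memLp) hy).trans ?_
  refine mul_le_mul_of_nonneg_right ((hu.bound n c).trans ?_) l2norm_nonneg
  refine mul_le_mul_of_nonneg_left (Real.sqrt_le_sqrt ?_) hu.nonneg
  calc _ ≤ ∑ a ∈ Finset.range n, ∑ k ∈ Finset.Ioo (-n : ℤ) n, w k ^ 2 := by
        refine Finset.sum_le_sum fun a ha => ?_
        refine (Finset.sum_mul_sq_le_sq_mul_sq _ _ _).trans ?_
        refine (mul_le_of_le_one_right (Finset.sum_nonneg fun _ _ => sq_nonneg _) hz).trans ?_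
        exact sum_natCast_sub_le n (Finset.mem_range.1 ha) (fun k => w k ^ 2) fun k => sq_nonneg _
    _ = _ := by simp

variable {p : ℕ}

lemma lagForm_sum_right {ι : Type*} (s : Finset ι) (w : ℤ → ℝ) (n : ℕ) (u : ℕ → ℝ)
    (v : ι → ℕ → ℝ) :
    lagForm w n u (fun a => ∑ j ∈ s, v j a) = ∑ j ∈ s, lagForm w n u (v j) := by
  simp only [lagForm]
  rw [Finset.sum_comm (s := s)]
  refine Finset.sum_congr rfl fun a _ => ?_
  rw [Finset.sum_comm (s := s)]
  refine Finset.sum_congr rfl fun b _ => ?_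
  rw [Finset.mul_sum, Finset.mul_sum]

lemma integral_abs_lagForm_finite_rank_le {u : ℕ → Ω → ℝ} {H : ℝ} (hu : IsBessel μ u H)
    {y : Fin p → Ω → ℝ} (hy : ∀ j, MemLp (y j) 2 μ) {Y : ℝ} (hY : ∀ j, l2norm μ (y j) ≤ Y)
    {z : Fin p → ℕ → ℝ} (n : ℕ) (hz : ∀ j, ∑ m ∈ Finset.range n, z j m ^ 2 ≤ 1) (w : ℤ → ℝ) :
    ∫ ω, |lagForm w n (fun a => u a ω) (fun a => ∑ j, z j a * y j ω)| ∂μ ≤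
      H * √(n * ∑ k ∈ Finset.Ioo (-n : ℤ) n, w k ^ 2) * (p * Y) := by
  have hi : ∀ j, Integrable (fun ω => lagForm w n (fun a => u a ω) (fun a => z j a * y j ω)) μ :=
    fun j => integrable_lagForm hu.memLp (fun a => (hy j).const_mul _) _ _
  have h0 := hu.nonneg
  calc _ ≤ ∫ ω, ∑ j, |lagForm w n (fun a => u a ω) (fun a => z j a * y j ω)| ∂μ := by
        refine integral_mono ?_ (integrable_finsetSum _ fun j _ => (hi j).abs) fun ω => ?_
        · exact (integrable_lagForm hu.memLp (fun a => memLp_linear_combination _ _ hy) _ _).abs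
        · simp only [lagForm_sum_right]
          exact Finset.abs_sum_le_sum_abs _ _
    _ = ∑ j, ∫ ω, |lagForm w n (fun a => u a ω) (fun a => z j a * y j ω)| ∂μ :=
        integral_finsetSum _ fun j _ => (hi j).abs
    _ ≤ ∑ j : Fin p, H * √(n * ∑ k ∈ Finset.Ioo (-n : ℤ) n, w k ^ 2) * Y := by
        refine Finset.sum_le_sum fun j _ =>
          (integral_abs_lagForm_rank_one_le hu (hy j) n (hz j) w).trans ?_
        gcongr
        exact hY j
    _ = _ := by
        rw [Finset.sum_const, Finset.card_univ, Fintype.card_fin, nsmul_eq_mul]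
        ring

/-- A finite rank perturbation of a Bessel sequence changes the quadratic form by a term of order
`√(n ∑_k w_k²)` in `L¹`. -/
lemma integral_abs_lagForm_sub_le {u : ℕ → Ω → ℝ} {H : ℝ} (hu : IsBessel μ u H)
    {y : Fin p → Ω → ℝ} (hy : ∀ j, MemLp (y j) 2 μ) {Y : ℝ} (hY : ∀ j, l2norm μ (y j) ≤ Y)
    {z : Fin p → ℕ → ℝ} (n : ℕ) (hz : ∀ j m, ∑ i ∈ Finset.range m, z j i ^ 2 ≤ 1) (w : ℤ → ℝ) :
    ∫ ω, |lagForm w n (fun a => u a ω - ∑ j, z j a * y j ω) (fun a => u a ω - ∑ j, z j a * y j ω) -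
        lagForm w n (fun a => u a ω) (fun a => u a ω)| ∂μ ≤
      √(n * ∑ k ∈ Finset.Ioo (-n : ℤ) n, w k ^ 2) * (2 * H * (p * Y) + (p * Y) * (p * Y)) := by
  set e : ℕ → Ω → ℝ := fun a ω => ∑ j, z j a * y j ω with he
  have hB : IsBessel μ e (p * Y) := by
    refine (IsBessel.sum Finset.univ fun j _ => isBessel_of_rank_one (hy j) (hz j)).mono ?_
    refine (Finset.sum_le_sum fun j _ => hY j).trans ?_
    simp
  have hi1 := (integrable_lagForm hu.memLp hB.memLp w n).abs
  have hi2 := (integrable_lagForm hu.memLp hB.memLp (fun k => w (-k)) n).abs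
  have hi3 := (integrable_lagForm hB.memLp hB.memLp w n).abs
  set S := √(n * ∑ k ∈ Finset.Ioo (-n : ℤ) n, w k ^ 2) with hS
  have hS' : √(n * ∑ k ∈ Finset.Ioo (-n : ℤ) n, w (-k) ^ 2) = S := by
    rw [sum_Ioo_neg n fun k => w k ^ 2]
  have b1 := integral_abs_lagForm_finite_rank_le hu hy hY n (fun j => hz j n) w
  have b2 := integral_abs_lagForm_finite_rank_le hu hy hY n (fun j => hz j n) fun k => w (-k)
  have b3 := integral_abs_lagForm_finite_rank_le hB hy hY n (fun j => hz j n) w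
  rw [hS'] at b2
  rw [← hS] at b1 b3
  -- Expanding the square leaves two cross terms and the form of the perturbation with itself. The
  -- cross term with the perturbation on the left is rewritten with the reflected weight, so that
  -- the same estimate covers it.
  have hpt : ∀ ω, |lagForm w n (fun a => u a ω - e a ω) (fun a => u a ω - e a ω) -
      lagForm w n (fun a => u a ω) (fun a => u a ω)| ≤
      |lagForm w n (fun a => u a ω) (fun a => e a ω)| +
        |lagForm (fun k => w (-k)) n (fun a => u a ω) (fun a => e a ω)| +
        |lagForm w n (fun a => e a ω) (fun a => e a ω)| := by
    intro ω
    have hu' : (fun a => u a ω) = fun a => (u a ω - e a ω) + e a ω := by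
      funext a
      ring
    have h1 : lagForm w n (fun a => u a ω) (fun a => u a ω) =
        lagForm w n (fun a => u a ω - e a ω) (fun a => u a ω) +
          lagForm w n (fun a => e a ω) (fun a => u a ω) := by
      rw [← lagForm_add_left]
      simp
    have h2 : lagForm w n (fun a => u a ω - e a ω) (fun a => u a ω) =
        lagForm w n (fun a => u a ω - e a ω) (fun a => u a ω - e a ω) +
          lagForm w n (fun a => u a ω - e a ω) (fun a => e a ω) := by
      rw [← lagForm_add_right]
      simp
    have h3 : lagForm w n (fun a => u a ω) (fun a => e a ω) =
        lagForm w n (fun a => u a ω - e a ω) (fun a => e a ω) +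
          lagForm w n (fun a => e a ω) (fun a => e a ω) := by
      rw [← lagForm_add_left]
      simp
    rw [← lagForm_swap w n (fun a => e a ω) (fun a => u a ω)]
    rw [h1, h2]
    set A := lagForm w n (fun a => u a ω - e a ω) (fun a => e a ω)
    have hA : A = lagForm w n (fun a => u a ω) (fun a => e a ω) -
      lagForm w n (fun a => e a ω) (fun a => e a ω) := by linarith
    rw [hA]
    generalize lagForm w n (fun a => u a ω) (fun a => e a ω) = p1
    generalize lagForm w n (fun a => e a ω) (fun a => u a ω) = p2
    generalize lagForm w n (fun a => e a ω) (fun a => e a ω) = p3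
    generalize lagForm w n (fun a => u a ω - e a ω) (fun a => u a ω - e a ω) = p4
    rw [show p4 - (p4 + (p1 - p3) + p2) = -p1 + -p2 + p3 by ring]
    refine (abs_add_three _ _ _).trans ?_
    rw [abs_neg, abs_neg]
  have hsub : ∀ a, MemLp (fun ω => u a ω - e a ω) 2 μ := fun a => (hu.memLp a).sub (hB.memLp a)
  calc _ ≤ ∫ ω, (|lagForm w n (fun a => u a ω) (fun a => e a ω)| +
        |lagForm (fun k => w (-k)) n (fun a => u a ω) (fun a => e a ω)| +
        |lagForm w n (fun a => e a ω) (fun a => e a ω)|) ∂μ := by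
        refine integral_mono ?_ ((hi1.add hi2).add hi3) hpt
        exact ((integrable_lagForm hsub hsub w n).sub
          (integrable_lagForm hu.memLp hu.memLp w n)).abs
    _ ≤ H * S * (p * Y) + H * S * (p * Y) + p * Y * S * (p * Y) := by
        refine (integral_add (hi1.add hi2) hi3).trans_le (add_le_add ?_ b3)
        exact (integral_add hi1 hi2).trans_le (add_le_add b1 b2)
    _ = _ := by ring

end Perturbation

/-! ### From the errors to the residuals -/

section Residual

variable {Ω : Type*} {F₀ mΩ : MeasurableSpace Ω} {μ : Measure Ω} [IsProbabilityMeasure μ]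
  {T : Ω ≃ᵐ Ω} {ε₀ : Ω → ℝ} {p : ℕ}

/-- Hannan's quadratic forms are not affected by a bounded finite rank perturbation of the errors,
such as the passage to the residuals. -/
theorem IsHannanProcess.tendsto_lagForm_sub (hε : IsHannanProcess F₀ μ T ε₀) {w : ℕ → ℤ → ℝ}
    {ρ : ℤ → ℝ} (hw : IsLagWeight μ w ρ) {y : ℕ → Fin p → Ω → ℝ} {Y : ℝ}
    (hy : ∀ n j, MemLp (y n j) 2 μ) (hY : ∀ᶠ n in atTop, ∀ j, l2norm μ (y n j) ≤ Y)
    {z : ℕ → Fin p → ℕ → ℝ} (hz : ∀ n j m, ∑ i ∈ Finset.range m, z n j i ^ 2 ≤ 1) :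
    Tendsto (fun n : ℕ => ∫ ω, |(n : ℝ)⁻¹ * lagForm (w n) n
        (fun a => process T ε₀ (a + 1) ω - ∑ j, z n j a * y n j ω)
        (fun a => process T ε₀ (a + 1) ω - ∑ j, z n j a * y n j ω) -
        ∑' k : ℤ, autocov μ T ε₀ k * ρ k| ∂μ) atTop (𝓝 0) := by
  obtain ⟨H, hH⟩ := hε.exists_isBessel
  set c := 2 * H * (p * Y) + (p * Y) * (p * Y) with hc
  set S : ℕ → ℝ := fun n => (n : ℝ)⁻¹ * ∑ k ∈ Finset.Ioo (-n : ℤ) n, w n k ^ 2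
  have hlim : Tendsto (fun n => √(S n) * c + ∫ ω, |(n : ℝ)⁻¹ * lagForm (w n) n
      (fun a => process T ε₀ (a + 1) ω) (fun a => process T ε₀ (a + 1) ω) -
        ∑' k : ℤ, autocov μ T ε₀ k * ρ k| ∂μ) atTop (𝓝 0) := by
    have h1 : Tendsto (fun n => √(S n)) atTop (𝓝 0) := by
      rw [← Real.sqrt_zero]
      exact (Real.continuous_sqrt.tendsto 0).comp hw.small
    simpa using (h1.mul_const c).add (hε.tendsto_lagForm hw)
  refine squeeze_zero' (Eventually.of_forall fun n => integral_nonneg fun _ => abs_nonneg _) ?_ hlim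
  filter_upwards [hY, eventually_gt_atTop 0] with n hYn hn
  have hn0 : (0 : ℝ) < n := by exact_mod_cast hn
  have hsub : ∀ a, MemLp (fun ω => process T ε₀ ((a : ℕ) + 1) ω - ∑ j, z n j a * y n j ω) 2 μ :=
    fun a => (hH.memLp a).sub (memLp_linear_combination _ _ (hy n))
  have hi1 := integrable_lagForm hsub hsub (w n) n
  have hi2 := integrable_lagForm hH.memLp hH.memLp (w n) n
  have hb := integral_abs_lagForm_sub_le hH (hy n) hYn n (hz n) (w n)
  have hsq : (n : ℝ)⁻¹ * √(n * ∑ k ∈ Finset.Ioo (-n : ℤ) n, w n k ^ 2) = √(S n) := by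
    rw [← Real.sqrt_sq hn0.le, ← Real.sqrt_inv, ← Real.sqrt_mul (by positivity)]
    congr 1
    simp only [S]
    rw [Real.sqrt_sq hn0.le]
    field_simp
  set A : Ω → ℝ := fun ω => lagForm (w n) n
    (fun a => process T ε₀ (a + 1) ω - ∑ j, z n j a * y n j ω)
    (fun a => process T ε₀ (a + 1) ω - ∑ j, z n j a * y n j ω)
  set B : Ω → ℝ := fun ω => lagForm (w n) n
    (fun a => process T ε₀ (a + 1) ω) (fun a => process T ε₀ (a + 1) ω)
  set g : ℝ := ∑' k : ℤ, autocov μ T ε₀ k * ρ k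
  have hj1 : Integrable (fun ω => (n : ℝ)⁻¹ * |A ω - B ω|) μ := (hi1.sub hi2).abs.const_mul _
  have hj2 : Integrable (fun ω => |(n : ℝ)⁻¹ * B ω - g|) μ :=
    ((hi2.const_mul _).sub (integrable_const _)).abs
  calc ∫ ω, |(n : ℝ)⁻¹ * A ω - g| ∂μ
      ≤ ∫ ω, ((n : ℝ)⁻¹ * |A ω - B ω| + |(n : ℝ)⁻¹ * B ω - g|) ∂μ := by
        refine integral_mono ((hi1.const_mul _).sub (integrable_const _)).abs (hj1.add hj2)
          fun ω => ?_
        change |(n : ℝ)⁻¹ * A ω - g| ≤ (n : ℝ)⁻¹ * |A ω - B ω| + |(n : ℝ)⁻¹ * B ω - g|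
        calc |(n : ℝ)⁻¹ * A ω - g| = |(n : ℝ)⁻¹ * (A ω - B ω) + ((n : ℝ)⁻¹ * B ω - g)| := by
              congr 1
              ring
          _ ≤ _ := abs_add_le _ _
          _ = _ := by rw [abs_mul, abs_of_pos (inv_pos.2 hn0)]
    _ = (n : ℝ)⁻¹ * ∫ ω, |A ω - B ω| ∂μ + ∫ ω, |(n : ℝ)⁻¹ * B ω - g| ∂μ := by
        rw [integral_add hj1 hj2, integral_const_mul]
    _ ≤ √(S n) * c + ∫ ω, |(n : ℝ)⁻¹ * B ω - g| ∂μ := by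
        refine add_le_add ?_ le_rfl
        rw [← hsq, mul_assoc]
        exact mul_le_mul_of_nonneg_left hb (by positivity)

end Residual

/-! ### The estimator as a quadratic form in the residuals -/

section DesignAlgebra

variable {p : ℕ} {x : ℕ → Fin p → ℝ}

/-- The first `n` entries of the normalized `j`-th column of the design, followed by zeros. -/
def normCol (x : ℕ → Fin p → ℝ) (n : ℕ) (j : Fin p) (a : ℕ) : ℝ :=
  if a < n then x a j / colNorm x n j else 0

lemma normCol_of_lt {n a : ℕ} (h : a < n) (j : Fin p) :
    normCol x n j a = x a j / colNorm x n j := if_pos h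

lemma sum_normCol_sq_le (x : ℕ → Fin p → ℝ) (n : ℕ) (j : Fin p) (m : ℕ) :
    ∑ a ∈ Finset.range m, normCol x n j a ^ 2 ≤ 1 := by
  calc _ ≤ ∑ a ∈ Finset.range m, if a ∈ Finset.range n then (x a j / colNorm x n j) ^ 2 else 0 := by
        refine Finset.sum_le_sum fun a _ => le_of_eq ?_
        simp only [normCol, Finset.mem_range, ite_pow, zero_pow two_ne_zero]
    _ ≤ ∑ a ∈ Finset.range n, (x a j / colNorm x n j) ^ 2 := by
        rw [← Finset.sum_filter]
        exact Finset.sum_le_sum_of_subset_of_nonneg (fun k hk => (Finset.mem_filter.1 hk).2)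
          fun _ _ _ => sq_nonneg _
    _ ≤ 1 := by
        simp only [div_pow, ← Finset.sum_div]
        rw [colNorm, Real.sq_sqrt (Finset.sum_nonneg fun _ _ => sq_nonneg _)]
        exact div_self_le_one _

lemma lagProd_normCol_natCast (x : ℕ → Fin p → ℝ) (n k : ℕ) (j l : Fin p) :
    lagProd n (normCol x n j) (normCol x n l) k = lagCorr x n k j l := by
  rw [lagProd, sum_lag_eq_natCast n k fun a b => normCol x n j a * normCol x n l b, lagCorr]
  refine Finset.sum_congr rfl fun i hi => ?_
  rw [Finset.mem_range] at hi
  rw [normCol_of_lt (by omega), normCol_of_lt (by omega), div_mul_div_comm]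

lemma lagProd_normCol_neg_natCast (x : ℕ → Fin p → ℝ) (n k : ℕ) (j l : Fin p) :
    lagProd n (normCol x n j) (normCol x n l) (-(k : ℤ)) = lagCorr x n k l j := by
  rw [lagProd, sum_lag_eq_neg_natCast n k fun a b => normCol x n j a * normCol x n l b, lagCorr]
  refine Finset.sum_congr rfl fun i hi => ?_
  rw [Finset.mem_range] at hi
  rw [normCol_of_lt (by omega), normCol_of_lt (by omega), div_mul_div_comm, mul_comm (x (i + k) j),
    mul_comm (colNorm x n j)]

/-- The matrices `R(k)`, `k ∈ ℤ`, with `R(-k) = R(k)ᵗ`. -/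
def lagLimitInt (x : ℕ → Fin p → ℝ) : ℤ → Matrix (Fin p) (Fin p) ℝ
  | (k : ℕ) => lagLimit x k
  | Int.negSucc k => (lagLimit x (k + 1))ᵀ

lemma IsHannanDesign.tendsto_lagCorr (hx : IsHannanDesign x) (k : ℕ) (j l : Fin p) :
    Tendsto (fun n => lagCorr x n k j l) atTop (𝓝 (lagLimit x k j l)) :=
  tendsto_nhds_limUnder (hx.lag_limit_exists k j l)

lemma IsHannanDesign.tendsto_lagProd (hx : IsHannanDesign x) (j l : Fin p) (k : ℤ) :
    Tendsto (fun n => lagProd n (normCol x n j) (normCol x n l) k) atTop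
      (𝓝 (lagLimitInt x k j l)) := by
  match k with
  | (k : ℕ) =>
    simp only [lagProd_normCol_natCast]
    exact hx.tendsto_lagCorr k j l
  | Int.negSucc k =>
    simp only [Int.negSucc_eq, ← Nat.cast_succ, lagProd_normCol_neg_natCast]
    exact hx.tendsto_lagCorr (k + 1) l j

/-- The normalized Gram matrix `D(n)⁻¹ XᵗX D(n)⁻¹`. -/
def normGram (x : ℕ → Fin p → ℝ) (n : ℕ) : Matrix (Fin p) (Fin p) ℝ :=
  Matrix.of fun j l => lagCorr x n 0 j l

/-- The normalized design matrix `X D(n)⁻¹`. -/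
def normDesign (x : ℕ → Fin p → ℝ) (n : ℕ) : Matrix (Fin n) (Fin p) ℝ :=
  Matrix.of fun i j => normCol x n j i

lemma IsHannanDesign.tendsto_normGram_inv (hx : IsHannanDesign x) :
    Tendsto (fun n => (normGram x n)⁻¹) atTop (𝓝 (lagLimit x 0)⁻¹) := by
  have h1 : Tendsto (normGram x) atTop (𝓝 (lagLimit x 0)) :=
    tendsto_pi_nhds.2 fun j => tendsto_pi_nhds.2 fun l => hx.tendsto_lagCorr 0 j l
  refine (continuousAt_matrix_inv _ ?_).tendsto.comp h1
  rw [Ring.inverse_eq_inv']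
  exact continuousAt_inv₀ hx.posDef.det_pos.ne'

lemma IsHannanDesign.eventually_isUnit_det (hx : IsHannanDesign x) :
    ∀ᶠ n in atTop, IsUnit (normGram x n).det := by
  have h1 : Tendsto (normGram x) atTop (𝓝 (lagLimit x 0)) :=
    tendsto_pi_nhds.2 fun j => tendsto_pi_nhds.2 fun l => hx.tendsto_lagCorr 0 j l
  have h2 := (continuous_id.matrix_det.tendsto (lagLimit x 0)).comp h1
  filter_upwards [h2.eventually_ne hx.posDef.det_pos.ne'] with n hn
  exact isUnit_iff_ne_zero.2 hn

lemma IsHannanDesign.eventually_colNorm_ne_zero (hx : IsHannanDesign x) :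
    ∀ᶠ n in atTop, ∀ j, colNorm x n j ≠ 0 :=
  eventually_all.2 fun j => (hx.colNorm_tendsto j).eventually_ne_atTop 0

lemma designMatrix_eq_mul {n : ℕ} (hd : ∀ j, colNorm x n j ≠ 0) :
    designMatrix x n = normDesign x n * colNormMatrix x n := by
  ext i j
  rw [colNormMatrix, Matrix.mul_diagonal]
  simp only [designMatrix, normDesign, Matrix.of_apply]
  rw [normCol_of_lt i.2, div_mul_cancel₀ _ (hd j)]

lemma transpose_mul_normDesign (x : ℕ → Fin p → ℝ) (n : ℕ) :
    (normDesign x n)ᵀ * normDesign x n = normGram x n := by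
  ext j l
  simp only [Matrix.mul_apply, Matrix.transpose_apply, normDesign, normGram, Matrix.of_apply,
    lagCorr, Nat.sub_zero, add_zero]
  rw [← Fin.sum_univ_eq_sum_range fun m => x m j * x m l / (colNorm x n j * colNorm x n l)]
  refine Finset.sum_congr rfl fun i _ => ?_
  rw [normCol_of_lt i.2, normCol_of_lt i.2, div_mul_div_comm]

lemma gram_eq {n : ℕ} (hd : ∀ j, colNorm x n j ≠ 0) :
    (designMatrix x n)ᵀ * designMatrix x n =
      colNormMatrix x n * normGram x n * colNormMatrix x n := by
  rw [designMatrix_eq_mul hd, Matrix.transpose_mul, ← transpose_mul_normDesign,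
    show (colNormMatrix x n)ᵀ = colNormMatrix x n from Matrix.diagonal_transpose _]
  simp only [Matrix.mul_assoc]

lemma isUnit_det_colNormMatrix {n : ℕ} (hd : ∀ j, colNorm x n j ≠ 0) :
    IsUnit (colNormMatrix x n).det := by
  rw [colNormMatrix, Matrix.det_diagonal, isUnit_iff_ne_zero]
  exact Finset.prod_ne_zero_iff.2 fun j _ => hd j

lemma colNorm_mul_gram_inv_mul {n : ℕ} (hd : ∀ j, colNorm x n j ≠ 0) :
    colNormMatrix x n * ((designMatrix x n)ᵀ * designMatrix x n)⁻¹ * (designMatrix x n)ᵀ =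
      (normGram x n)⁻¹ * (normDesign x n)ᵀ := by
  have hD := isUnit_det_colNormMatrix hd
  rw [gram_eq hd, Matrix.mul_inv_rev, Matrix.mul_inv_rev, designMatrix_eq_mul hd,
    Matrix.transpose_mul, show (colNormMatrix x n)ᵀ = colNormMatrix x n from
      Matrix.diagonal_transpose _, Matrix.mul_nonsing_inv_cancel_left _ _ hD]
  rw [Matrix.mul_assoc, Matrix.nonsing_inv_mul_cancel_left _ _ hD]

lemma mul_gram_inv_mul_colNorm {n : ℕ} (hd : ∀ j, colNorm x n j ≠ 0) :
    designMatrix x n * (((designMatrix x n)ᵀ * designMatrix x n)⁻¹ * colNormMatrix x n) =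
      normDesign x n * (normGram x n)⁻¹ := by
  have hD := isUnit_det_colNormMatrix hd
  rw [gram_eq hd, Matrix.mul_inv_rev, Matrix.mul_inv_rev, designMatrix_eq_mul hd]
  simp only [Matrix.mul_assoc]
  rw [Matrix.nonsing_inv_mul _ hD, Matrix.mul_one, Matrix.mul_nonsing_inv_cancel_left _ _ hD]

lemma empAutocov_eq (e : ℕ → ℝ) (n : ℕ) (k : ℤ) :
    empAutocov e n k = (n : ℝ)⁻¹ * ∑ a ∈ Finset.range n, ∑ b ∈ Finset.range n,
      if (b : ℤ) - a = k then e a * e b else 0 := by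
  rw [empAutocov]
  congr 1
  rcases Int.natAbs_eq k with h | h
  · conv_rhs => rw [h]
    rw [sum_lag_eq_natCast n k.natAbs fun a b => e a * e b]
  · conv_rhs => rw [h]
    rw [sum_lag_eq_neg_natCast n k.natAbs fun a b => e a * e b]
    exact Finset.sum_congr rfl fun i _ => mul_comm _ _

/-- Both the empirical autocovariances and the correlations of the columns are sums along diagonals.
In the fourfold sum over column indices `a, b` and residual indices `i, i'` with equal lags, the
taper may be attached to either pair; summing over the columns first turns their correlations into
the weights of a form in the residuals. -/
lemma normDesign_taperedCov {K : ℝ → ℝ} (hK : ∀ t, K (-t) = K t) (h : ℝ) (e : ℕ → ℝ) (n : ℕ)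
    (j l : Fin p) :
    ((normDesign x n)ᵀ * taperedCov K h e n * normDesign x n) j l =
      (n : ℝ)⁻¹ * lagForm (fun k => K (k / h) * lagProd n (normCol x n j) (normCol x n l) k) n e e := by
  set N := Finset.range n
  have hL : ((normDesign x n)ᵀ * taperedCov K h e n * normDesign x n) j l =
      ∑ a ∈ N, ∑ b ∈ N, normCol x n j a * (K (((a : ℝ) - b) / h) * empAutocov e n ((a : ℤ) - b)) *
        normCol x n l b := by
    simp only [Matrix.mul_apply, Matrix.transpose_apply, normDesign, taperedCov, Matrix.of_apply,
      Finset.sum_mul]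
    rw [Finset.sum_comm, ← Fin.sum_univ_eq_sum_range (fun a => ∑ b ∈ N, normCol x n j a *
      (K (((a : ℝ) - b) / h) * empAutocov e n ((a : ℤ) - b)) * normCol x n l b)]
    refine Finset.sum_congr rfl fun a _ => ?_
    rw [← Fin.sum_univ_eq_sum_range (fun b => normCol x n j a *
      (K (((a : ℝ) - b) / h) * empAutocov e n ((a : ℤ) - b)) * normCol x n l b)]
  rw [hL]
  have hsym : ∀ a b : ℕ, empAutocov e n ((a : ℤ) - b) = empAutocov e n ((b : ℤ) - a) := by
    intro a b
    rw [empAutocov, empAutocov, ← Int.natAbs_neg, neg_sub]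
  calc _ = ∑ a ∈ N, ∑ b ∈ N, ∑ i ∈ N, ∑ i' ∈ N, (n : ℝ)⁻¹ * (K (((i' : ℤ) - i : ℤ) / h) *
        (if (b : ℤ) - a = (i' : ℤ) - i then normCol x n j a * normCol x n l b else 0) *
          (e i * e i')) := by
        refine Finset.sum_congr rfl fun a _ => Finset.sum_congr rfl fun b _ => ?_
        rw [hsym, empAutocov_eq]
        simp only [Finset.mul_sum, Finset.sum_mul]
        refine Finset.sum_congr rfl fun i _ => Finset.sum_congr rfl fun i' _ => ?_
        by_cases hi : (i' : ℤ) - i = (b : ℤ) - a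
        · rw [if_pos hi, if_pos hi.symm, hi, ← hK (((a : ℝ) - b) / h)]
          push_cast
          rw [← neg_div, neg_sub]
          ring
        · rw [if_neg hi, if_neg (Ne.symm hi)]
          ring
    _ = _ := by
        simp only [lagForm, lagProd, Finset.mul_sum, Finset.sum_mul]
        rw [Finset.sum_congr rfl fun a _ => Finset.sum_comm, Finset.sum_comm]
        refine Finset.sum_congr rfl fun i _ => ?_
        rw [Finset.sum_congr rfl fun a _ => Finset.sum_comm, Finset.sum_comm]

lemma covEstimator_eq {n : ℕ} (hd : ∀ j, colNorm x n j ≠ 0) {K : ℝ → ℝ} (hK : ∀ t, K (-t) = K t)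
    (h : ℝ) (y : ℕ → ℝ) :
    covEstimator K h x y n = (normGram x n)⁻¹ * (Matrix.of fun j l => (n : ℝ)⁻¹ *
      lagForm (fun k => K (k / h) * lagProd n (normCol x n j) (normCol x n l) k) n
        (residual x y n) (residual x y n)) * (normGram x n)⁻¹ := by
  have hA : (Matrix.of fun j l => (n : ℝ)⁻¹ *
      lagForm (fun k => K (k / h) * lagProd n (normCol x n j) (normCol x n l) k) n
        (residual x y n) (residual x y n)) =
      (normDesign x n)ᵀ * taperedCov K h (residual x y n) n * normDesign x n := by
    ext j l
    rw [Matrix.of_apply, normDesign_taperedCov hK]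
  rw [hA, covEstimator, colNorm_mul_gram_inv_mul hd]
  have h2 := mul_gram_inv_mul_colNorm hd
  simp only [Matrix.mul_assoc] at h2 ⊢
  rw [h2]

/-- The normalized estimation error `D(n) (β̂ - β)`. -/
def normError (x : ℕ → Fin p → ℝ) (n : ℕ) (e : ℕ → ℝ) (j : Fin p) : ℝ :=
  ∑ l, (normGram x n)⁻¹ j l * ∑ a ∈ Finset.range n, normCol x n l a * e a

/-- `β̂ - β = (XᵗX)⁻¹ Xᵗ ε`; after normalization by `D(n)` the fitted error is a combination of the
`p` normalized columns, a perturbation of rank at most `p`. -/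
lemma residual_eq {n : ℕ} (hd : ∀ j, colNorm x n j ≠ 0) (hR : IsUnit (normGram x n).det)
    (β : Fin p → ℝ) (e : ℕ → ℝ) {i : ℕ} (hi : i < n) :
    residual x (fun i => ∑ j, x i j * β j + e i) n i =
      e i - ∑ j, normCol x n j i * normError x n e j := by
  have hD := isUnit_det_colNormMatrix hd
  set X := designMatrix x n
  set D := colNormMatrix x n
  have hG : IsUnit (Xᵀ * X).det := by
    rw [gram_eq hd, Matrix.det_mul, Matrix.det_mul]
    exact (hD.mul hR).mul hD
  have hls : leastSquares x (fun i => ∑ j, x i j * β j + e i) n =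
      β + (Xᵀ * X)⁻¹ *ᵥ (Xᵀ *ᵥ fun i : Fin n => e i) := by
    have hy : (fun i : Fin n => ∑ j, x i j * β j + e i) = X *ᵥ β + fun i : Fin n => e i := by
      funext i
      simp [X, designMatrix, Matrix.mulVec, dotProduct]
    rw [leastSquares, hy, Matrix.mulVec_add, Matrix.mulVec_add, Matrix.mulVec_mulVec,
      Matrix.mulVec_mulVec, Matrix.mul_assoc, Matrix.nonsing_inv_mul _ hG, Matrix.one_mulVec]
  have herr : D *ᵥ ((Xᵀ * X)⁻¹ *ᵥ (Xᵀ *ᵥ fun i : Fin n => e i)) = normError x n e := by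
    rw [Matrix.mulVec_mulVec, Matrix.mulVec_mulVec, colNorm_mul_gram_inv_mul hd,
      ← Matrix.mulVec_mulVec]
    funext j
    simp only [Matrix.mulVec, dotProduct, normError, Matrix.transpose_apply, normDesign,
      Matrix.of_apply]
    refine Finset.sum_congr rfl fun l _ => ?_
    rw [← Fin.sum_univ_eq_sum_range fun a => normCol x n l a * e a]
  rw [residual, hls, ← herr]
  simp only [Pi.add_apply, mul_add, Finset.sum_add_distrib]
  rw [add_sub_add_left_eq_sub]
  congr 1
  refine Finset.sum_congr rfl fun j _ => ?_
  rw [show D = Matrix.diagonal (colNorm x n) from rfl, Matrix.mulVec_diagonal, normCol_of_lt hi]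
  rw [← mul_assoc, div_mul_cancel₀ _ (hd j)]

lemma lagForm_congr {w : ℤ → ℝ} {n : ℕ} {u u' v v' : ℕ → ℝ} (hu : ∀ a < n, u a = u' a)
    (hv : ∀ a < n, v a = v' a) : lagForm w n u v = lagForm w n u' v' := by
  refine Finset.sum_congr rfl fun a ha => Finset.sum_congr rfl fun b hb => ?_
  rw [hu a (Finset.mem_range.1 ha), hv b (Finset.mem_range.1 hb)]

/-- `∑_k γ(k) R(k)`. -/
def longRunCov (γ : ℤ → ℝ) (x : ℕ → Fin p → ℝ) : Matrix (Fin p) (Fin p) ℝ :=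
  Matrix.of fun j l => ∑' k : ℤ, γ k * lagLimitInt x k j l

/-- The real form `R(0)⁻¹ (∑_k γ(k) R(k)) R(0)⁻¹` of the limiting covariance matrix. -/
def realLimitCov (γ : ℤ → ℝ) (x : ℕ → Fin p → ℝ) : Matrix (Fin p) (Fin p) ℝ :=
  (lagLimit x 0)⁻¹ * longRunCov γ x * (lagLimit x 0)⁻¹

end DesignAlgebra

/-! ### Consistency for a fixed design -/

section Consistency

variable {Ω : Type*} {F₀ mΩ : MeasurableSpace Ω} {μ : Measure Ω} {T : Ω ≃ᵐ Ω} {ε₀ : Ω → ℝ} {p : ℕ}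
  {x : ℕ → Fin p → ℝ}

/-- The normalized columns have norm at most `1`, so the Bessel bound controls their products with
the errors. As the inverse Gram matrices converge, this bounds `D(n) (β̂ - β)` in L² for large `n`.
-/
lemma l2norm_normError_le {u : ℕ → Ω → ℝ} {H : ℝ} (hu : IsBessel μ u H) (x : ℕ → Fin p → ℝ) (n : ℕ)
    (j : Fin p) :
    l2norm μ (fun ω => normError x n (fun a => u a ω) j) ≤ H * ∑ l, |(normGram x n)⁻¹ j l| := by
  have hm : ∀ l, MemLp (fun ω => ∑ a ∈ Finset.range n, normCol x n l a * u a ω) 2 μ :=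
    fun l => memLp_linear_combination _ _ hu.memLp
  refine (l2norm_sum_le Finset.univ fun l _ => (hm l).const_mul ((normGram x n)⁻¹ j l)).trans ?_
  rw [Finset.mul_sum]
  refine Finset.sum_le_sum fun l _ => ?_
  rw [l2norm_const_mul, mul_comm]
  refine mul_le_mul_of_nonneg_right ((hu.bound n _).trans ?_) (abs_nonneg _)
  exact mul_le_of_le_one_right hu.nonneg (Real.sqrt_le_one.2 (sum_normCol_sq_le x n l n))

/-- The condition on the bandwidth implies `h_n / n → 0`, unless the errors vanish. -/
lemma tendsto_bandwidth_div (hL : MemLp ε₀ 2 μ) (hne : ¬ ε₀ =ᵐ[μ] 0) {h : ℕ → ℝ}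
    (hpos : ∀ n, 0 < h n) (htop : Tendsto h atTop atTop)
    (hcond : Tendsto
      (fun n : ℕ => h n * ∫ ω, |ε₀ ω| ^ 2 * min 1 (h n / n * |ε₀ ω| ^ 2) ∂μ) atTop (𝓝 0)) :
    Tendsto (fun n : ℕ => h n / n) atTop (𝓝 0) := by
  have hint : ∀ c : ℝ, 0 ≤ c → Integrable (fun ω => |ε₀ ω| ^ 2 * min 1 (c * |ε₀ ω| ^ 2)) μ := by
    intro c hc
    have h2 : Integrable (fun ω => |ε₀ ω| ^ 2) μ := by simpa using hL.integrable_sq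
    refine h2.mono (h2.1.mul (aestronglyMeasurable_const.inf (h2.1.const_mul c)))
      (Eventually.of_forall fun ω => ?_)
    rw [norm_mul]
    refine mul_le_of_le_one_right (norm_nonneg _) ?_
    rw [Real.norm_eq_abs, abs_of_nonneg (le_min zero_le_one (by positivity))]
    exact min_le_left _ _
  set m : ℝ := ∫ ω, |ε₀ ω| ^ 2 * min 1 (1 * |ε₀ ω| ^ 2) ∂μ with hm
  have hm0 : 0 < m := by
    have hnn : ∀ ω, 0 ≤ |ε₀ ω| ^ 2 * min 1 (1 * |ε₀ ω| ^ 2) := fun ω =>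
      mul_nonneg (by positivity) (le_min zero_le_one (by positivity))
    refine lt_of_le_of_ne (integral_nonneg hnn) fun h0 => hne ?_
    have := (integral_eq_zero_iff_of_nonneg hnn (hint 1 zero_le_one)).1 (hm ▸ h0.symm)
    filter_upwards [this] with ω hω
    by_contra hcon
    have hp : 0 < |ε₀ ω| ^ 2 := by
      have := abs_pos.2 hcon
      positivity
    have : 0 < |ε₀ ω| ^ 2 * min 1 (1 * |ε₀ ω| ^ 2) := mul_pos hp (lt_min one_pos (by simpa using hp))
    exact this.ne' hω
  -- For `c, x ≥ 0`, `min 1 c * min 1 x ≤ min 1 (c x)` separates the ratio from the errors and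
  -- leaves the constant `m > 0`.
  have hlow : ∀ n : ℕ, min 1 (h n / n) * m ≤
      ∫ ω, |ε₀ ω| ^ 2 * min 1 (h n / n * |ε₀ ω| ^ 2) ∂μ := by
    intro n
    have hc : 0 ≤ h n / n := div_nonneg (hpos n).le (Nat.cast_nonneg n)
    rw [hm, ← integral_const_mul]
    refine integral_mono ((hint 1 zero_le_one).const_mul _) (hint _ hc) fun ω => ?_
    simp only [one_mul]
    rw [mul_left_comm]
    refine mul_le_mul_of_nonneg_left (le_min ?_ ?_) (by positivity)
    · exact mul_le_one₀ (min_le_left _ _) (le_min zero_le_one (by positivity)) (min_le_left _ _)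
    · exact mul_le_mul (min_le_right _ _) (min_le_right _ _) (le_min zero_le_one (by positivity)) hc
  have hmin : Tendsto (fun n : ℕ => min 1 (h n / n)) atTop (𝓝 0) := by
    have h1 := hcond.div_const m
    rw [zero_div] at h1
    refine squeeze_zero' (Eventually.of_forall fun n =>
      le_min zero_le_one (div_nonneg (hpos n).le (Nat.cast_nonneg n))) ?_ h1
    filter_upwards [htop.eventually_ge_atTop 1] with n hn
    rw [le_div_iff₀ hm0]
    have h0 : 0 ≤ min 1 (h n / n) * m :=
      mul_nonneg (le_min zero_le_one (div_nonneg (hpos n).le (Nat.cast_nonneg n))) hm0.le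
    nlinarith [hlow n]
  -- Once the minimum is below `1` it equals `h n / n`.
  refine hmin.congr' ?_
  filter_upwards [hmin.eventually_lt_const one_pos] with n hn
  rw [min_lt_iff] at hn
  exact min_eq_right (hn.resolve_left (lt_irrefl _)).le

variable [IsProbabilityMeasure μ]

/-- The quadratic forms in the residuals which constitute the estimator converge in `L¹`. -/
lemma IsHannanProcess.tendsto_lagForm_residual (hε : IsHannanProcess F₀ μ T ε₀)
    (hx : IsHannanDesign x) {K : ℝ → ℝ} (hK : IsTaperKernel K) {h : ℕ → ℝ} (hpos : ∀ n, 0 < h n)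
    (htop : Tendsto h atTop atTop) (hsmall : Tendsto (fun n : ℕ => h n / n) atTop (𝓝 0))
    (j l : Fin p) :
    Tendsto (fun n : ℕ => ∫ ω, |(n : ℝ)⁻¹ * lagForm
        (fun k => K (k / h n) * lagProd n (normCol x n j) (normCol x n l) k) n
        (fun a => process T ε₀ (a + 1) ω - ∑ j, normCol x n j a *
          normError x n (fun a => process T ε₀ (a + 1) ω) j)
        (fun a => process T ε₀ (a + 1) ω - ∑ j, normCol x n j a *
          normError x n (fun a => process T ε₀ (a + 1) ω) j) -
        longRunCov (autocov μ T ε₀) x j l| ∂μ) atTop (𝓝 0) := by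
  obtain ⟨H, hH⟩ := hε.exists_isBessel
  have hw : IsLagWeight μ (fun n k => K (k / h n) *
      lagProd n (normCol x n j) (normCol x n l) k) fun k => lagLimitInt x k j l :=
    isLagWeight_taper hK hpos htop hsmall (fun n => sum_normCol_sq_le x n j n)
      (fun n => sum_normCol_sq_le x n l n) fun k => hx.tendsto_lagProd j l k
  have hlim : ∀ i : Fin p, Tendsto (fun n => H * ∑ l, |(normGram x n)⁻¹ i l|) atTop
      (𝓝 (H * ∑ l, |(lagLimit x 0)⁻¹ i l|)) := fun i =>
    (tendsto_finsetSum _ fun l _ =>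
      ((tendsto_pi_nhds.1 (tendsto_pi_nhds.1 hx.tendsto_normGram_inv i) l).abs)).const_mul H
  -- One constant for all coordinates: the sum of the nonnegative limiting bounds, increased by `1`
  -- to exceed each of them strictly.
  set Y : ℝ := ∑ i : Fin p, (H * ∑ l, |(lagLimit x 0)⁻¹ i l|) + 1 with hY
  have h0 := hH.nonneg
  have hYb : ∀ᶠ n in atTop, ∀ i : Fin p,
      l2norm μ (fun ω => normError x n (fun a => process T ε₀ (a + 1) ω) i) ≤ Y := by
    refine eventually_all.2 fun i => ?_
    have hlt : H * ∑ l, |(lagLimit x 0)⁻¹ i l| < Y := by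
      rw [hY]
      refine lt_add_of_le_of_pos ?_ one_pos
      exact Finset.single_le_sum (f := fun i => H * ∑ l, |(lagLimit x 0)⁻¹ i l|)
        (fun i _ => by positivity) (Finset.mem_univ i)
    filter_upwards [(hlim i).eventually_lt_const hlt] with n hn
    exact (l2norm_normError_le hH x n i).trans hn.le
  refine hε.tendsto_lagForm_sub hw (y := fun n i ω =>
    normError x n (fun a => process T ε₀ (a + 1) ω) i) (z := fun n => normCol x n)
    (fun n i => ?_) hYb fun n i m => sum_normCol_sq_le x n i m
  exact memLp_linear_combination _ _ fun l => memLp_linear_combination _ _ hH.memLp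

/-- The entries of `B A B`, when `B_n → B` and `A_n → A` in `L¹`. -/
lemma tendsto_integral_abs_mul_mul {A : ℕ → Fin p → Fin p → Ω → ℝ} {A' : Matrix (Fin p) (Fin p) ℝ}
    {B : ℕ → Matrix (Fin p) (Fin p) ℝ} {B' : Matrix (Fin p) (Fin p) ℝ}
    (hAi : ∀ n i k, Integrable (A n i k) μ) (hB : Tendsto B atTop (𝓝 B'))
    (hA : ∀ i k, Tendsto (fun n => ∫ ω, |A n i k ω - A' i k| ∂μ) atTop (𝓝 0)) (j l : Fin p) :
    Tendsto (fun n => ∫ ω, |(B n * (Matrix.of fun i k => A n i k ω) * B n) j l -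
      (B' * A' * B') j l| ∂μ) atTop (𝓝 0) := by
  have hBe : ∀ i k, Tendsto (fun n => B n i k) atTop (𝓝 (B' i k)) := fun i k =>
    tendsto_pi_nhds.1 (tendsto_pi_nhds.1 hB i) k
  have hlim1 : Tendsto (fun n => ∑ i, ∑ k, |B n j i * B n k l| * ∫ ω, |A n i k ω - A' i k| ∂μ)
      atTop (𝓝 0) := by
    have := tendsto_finsetSum Finset.univ fun i _ => tendsto_finsetSum Finset.univ fun k _ =>
      (((hBe j i).mul (hBe k l)).abs).mul (hA i k)
    simpa using this
  have hlim2 : Tendsto (fun n => |(B n * A' * B n) j l - (B' * A' * B') j l|) atTop (𝓝 0) := by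
    have h1 : Tendsto (fun n => B n * A' * B n) atTop (𝓝 (B' * A' * B')) :=
      (hB.mul_const A').mul hB
    have h2 := (tendsto_pi_nhds.1 (tendsto_pi_nhds.1 h1 j) l).sub_const ((B' * A' * B') j l)
    simpa using h2.abs
  have hmul : ∀ (P Q : Matrix (Fin p) (Fin p) ℝ), (P * Q * P) j l =
      ∑ i, ∑ k, P j i * P k l * Q i k := by
    intro P Q
    simp only [Matrix.mul_apply, Finset.sum_mul]
    rw [Finset.sum_comm]
    refine Finset.sum_congr rfl fun i _ => Finset.sum_congr rfl fun k _ => ?_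
    ring
  have hlim := hlim1.add hlim2
  rw [add_zero] at hlim
  refine squeeze_zero (fun n => integral_nonneg fun _ => abs_nonneg _) (fun n => ?_) hlim
  have hi : ∀ i k, Integrable (fun ω => |B n j i * B n k l| * |A n i k ω - A' i k|) μ :=
    fun i k => ((hAi n i k).sub (integrable_const _)).abs.const_mul _
  have hsum : Integrable (fun ω => ∑ i, ∑ k, |B n j i * B n k l| * |A n i k ω - A' i k|) μ :=
    integrable_finsetSum _ fun i _ => integrable_finsetSum _ fun k _ => hi i k
  calc _ ≤ ∫ ω, (∑ i, ∑ k, |B n j i * B n k l| * |A n i k ω - A' i k| +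
        |(B n * A' * B n) j l - (B' * A' * B') j l|) ∂μ := by
        refine integral_mono_of_nonneg (Eventually.of_forall fun _ => abs_nonneg _)
          (hsum.add (integrable_const _)) (Eventually.of_forall fun ω => ?_)
        have e1 : (B n * (Matrix.of fun i k => A n i k ω) * B n) j l - (B' * A' * B') j l =
            (∑ i, ∑ k, B n j i * B n k l * (A n i k ω - A' i k)) +
              ((B n * A' * B n) j l - (B' * A' * B') j l) := by
          rw [hmul (B n), hmul (B n) A']
          simp only [mul_sub, Finset.sum_sub_distrib, Matrix.of_apply]
          ring
        simp only [e1]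
        refine (abs_add_le _ _).trans (add_le_add ?_ le_rfl)
        refine (Finset.abs_sum_le_sum_abs _ _).trans (Finset.sum_le_sum fun i _ => ?_)
        refine (Finset.abs_sum_le_sum_abs _ _).trans (Finset.sum_le_sum fun k _ => ?_)
        rw [abs_mul]
    _ = _ := by
        rw [integral_add hsum (integrable_const _), integral_finsetSum _ fun i _ =>
          integrable_finsetSum _ fun k _ => hi i k]
        congr 1
        · refine Finset.sum_congr rfl fun i _ => ?_
          rw [integral_finsetSum _ fun k _ => hi i k]
          exact Finset.sum_congr rfl fun k _ => integral_const_mul _ _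
        · simp

lemma lintegral_ofReal_sub {f : Ω → ℝ} (hf : Integrable f μ) (c : ℝ) :
    ∫⁻ ω, ‖((f ω : ℝ) : ℂ) - ((c : ℝ) : ℂ)‖ₑ ∂μ = ENNReal.ofReal (∫ ω, |f ω - c| ∂μ) := by
  have : ∀ ω, ‖((f ω : ℝ) : ℂ) - ((c : ℝ) : ℂ)‖ₑ = ‖f ω - c‖ₑ := by
    intro ω
    rw [← Complex.ofReal_sub, ← ofReal_norm, ← ofReal_norm, Complex.norm_real]
  simp only [this]
  exact (ofReal_integral_norm_eq_lintegral_enorm (hf.sub (integrable_const c))).symm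

/-- Consistency of the estimator for a fixed design, when `h_n / n → 0`. -/
theorem IsHannanProcess.tendsto_lintegral_covEstimator (hε : IsHannanProcess F₀ μ T ε₀)
    (hx : IsHannanDesign x) {K : ℝ → ℝ} (hK : IsTaperKernel K) {h : ℕ → ℝ} (hpos : ∀ n, 0 < h n)
    (htop : Tendsto h atTop atTop) (hsmall : Tendsto (fun n : ℕ => h n / n) atTop (𝓝 0))
    (β : Fin p → ℝ) (j l : Fin p) :
    Tendsto (fun n : ℕ => ∫⁻ ω, ‖((covEstimator K (h n) x
        (fun i => ∑ j, x i j * β j + process T ε₀ (i + 1) ω) n j l : ℝ) : ℂ) -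
        ((realLimitCov (autocov μ T ε₀) x j l : ℝ) : ℂ)‖ₑ ∂μ) atTop (𝓝 0) := by
  obtain ⟨H, hH⟩ := hε.exists_isBessel
  set e : ℕ → ℕ → Ω → ℝ := fun n a ω => process T ε₀ (a + 1) ω - ∑ j, normCol x n j a *
    normError x n (fun a => process T ε₀ (a + 1) ω) j
  set A : ℕ → Fin p → Fin p → Ω → ℝ := fun n i k ω => (n : ℝ)⁻¹ * lagForm
    (fun m => K (m / h n) * lagProd n (normCol x n i) (normCol x n k) m) n
      (fun a => e n a ω) (fun a => e n a ω)
  have heL : ∀ n a, MemLp (e n a) 2 μ := fun n a => (hH.memLp a).sub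
    (memLp_linear_combination _ _ fun i => memLp_linear_combination _ _ fun l =>
      memLp_linear_combination _ _ hH.memLp)
  have hAi : ∀ n i k, Integrable (A n i k) μ := fun n i k =>
    (integrable_lagForm (heL n) (heL n) _ n).const_mul _
  have hmain := tendsto_integral_abs_mul_mul (μ := μ) hAi hx.tendsto_normGram_inv
    (A' := longRunCov (autocov μ T ε₀) x)
    (fun i k => hε.tendsto_lagForm_residual hx hK hpos htop hsmall i k) j l
  have hmain' := ENNReal.tendsto_ofReal hmain
  rw [ENNReal.ofReal_zero] at hmain'
  refine hmain'.congr' ?_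
  filter_upwards [hx.eventually_colNorm_ne_zero, hx.eventually_isUnit_det] with n hd hR
  have hcov : ∀ ω, covEstimator K (h n) x
      (fun i => ∑ j, x i j * β j + process T ε₀ (i + 1) ω) n j l =
      ((normGram x n)⁻¹ * (Matrix.of fun i k => A n i k ω) * (normGram x n)⁻¹) j l := by
    intro ω
    rw [covEstimator_eq hd hK.symm]
    refine congrFun₂ (congrArg (fun M => (normGram x n)⁻¹ * M * (normGram x n)⁻¹) ?_) j l
    ext i k
    refine congrArg ((n : ℝ)⁻¹ * ·) ?_
    exact lagForm_congr (fun a ha => residual_eq hd hR β (fun a => process T ε₀ (a + 1) ω) ha)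
      fun a ha => residual_eq hd hR β (fun a => process T ε₀ (a + 1) ω) ha
  simp only [hcov]
  rw [lintegral_ofReal_sub]
  · rfl
  · simp only [Matrix.mul_apply, Finset.sum_mul, Matrix.of_apply]
    exact integrable_finsetSum _ fun i _ => integrable_finsetSum _ fun k _ =>
      ((hAi n k i).const_mul _).mul_const _

/-- Consistency of the estimator for a fixed design. -/
theorem IsHannanProcess.tendsto_lintegral_covEstimator_of_bandwidth
    (hε : IsHannanProcess F₀ μ T ε₀) (hx : IsHannanDesign x) {K : ℝ → ℝ} (hK : IsTaperKernel K)
    {h : ℕ → ℝ} (hpos : ∀ n, 0 < h n) (htop : Tendsto h atTop atTop)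
    (hcond : Tendsto
      (fun n : ℕ => h n * ∫ ω, |ε₀ ω| ^ 2 * min 1 (h n / n * |ε₀ ω| ^ 2) ∂μ) atTop (𝓝 0))
    (β : Fin p → ℝ) (j l : Fin p) :
    Tendsto (fun n : ℕ => ∫⁻ ω, ‖((covEstimator K (h n) x
        (fun i => ∑ j, x i j * β j + process T ε₀ (i + 1) ω) n j l : ℝ) : ℂ) -
        ((realLimitCov (autocov μ T ε₀) x j l : ℝ) : ℂ)‖ₑ ∂μ) atTop (𝓝 0) := by
  by_cases hne : ε₀ =ᵐ[μ] 0
  swap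
  · exact hε.tendsto_lintegral_covEstimator hx hK hpos htop
      (tendsto_bandwidth_div hε.memLp hne hpos htop hcond) β j l
  -- For vanishing errors the bandwidth condition says nothing about `h n / n`; instead the
  -- residuals, the estimator and the limit are all zero, as soon as the Gram matrix is invertible.
  have hproc : ∀ i, process T ε₀ i =ᵐ[μ] 0 := fun i =>
    process_congr_ae hε.measurePreserving hne i
  have hγ : autocov μ T ε₀ = 0 := by
    funext k
    rw [autocov, integral_congr_ae (g := fun _ => (0 : ℝ)), integral_zero, Pi.zero_apply]
    filter_upwards [hproc 0] with ω h0
    simp [h0]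
  have hlim : realLimitCov (autocov μ T ε₀) x = 0 := by
    have : longRunCov (autocov μ T ε₀) x = 0 := by
      ext i k
      simp [longRunCov, hγ]
    rw [realLimitCov, this]
    simp
  refine tendsto_const_nhds.congr' ?_
  filter_upwards [hx.eventually_colNorm_ne_zero, hx.eventually_isUnit_det] with n hd hR
  rw [hlim]
  refine (lintegral_eq_zero_of_ae_eq_zero ?_).symm
  filter_upwards [ae_all_iff.2 hproc] with ω hω
  have hres : ∀ a < n, residual x (fun i => ∑ j, x i j * β j + process T ε₀ (i + 1) ω) n a = 0 := by
    intro a ha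
    rw [residual_eq hd hR β (fun a => process T ε₀ (a + 1) ω) ha]
    simp [normError, hω]
  have hcov : covEstimator K (h n) x
      (fun i => ∑ j, x i j * β j + process T ε₀ (i + 1) ω) n = 0 := by
    rw [covEstimator_eq hd hK.symm]
    have : (Matrix.of fun j l => (n : ℝ)⁻¹ *
        lagForm (fun k => K (k / h n) * lagProd n (normCol x n j) (normCol x n l) k) n
        (residual x (fun i => ∑ j, x i j * β j + process T ε₀ (i + 1) ω) n)
        (residual x (fun i => ∑ j, x i j * β j + process T ε₀ (i + 1) ω) n)) = 0 := by
      ext i k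
      rw [Matrix.of_apply, lagForm_congr (u' := 0) (v' := 0) hres hres]
      simp [lagForm]
    rw [this]
    simp
  rw [hcov]
  simp

end Consistency

/-! ### Complex measures as combinations of finite measures -/

section ComplexCombination

variable {X : Type*} [MeasurableSpace X] {ι : Type*} [Fintype ι]

/-- The Jordan decompositions of the real and imaginary parts. Integrals against complex measures
thereby reduce to integrals against four finite measures. -/
lemma exists_eq_sum_measure (M : ComplexMeasure X) :
    ∃ (c : Fin 4 → ℂ) (ν : Fin 4 → Measure X), (∀ i, IsFiniteMeasure (ν i)) ∧
      ∀ A, MeasurableSet A → M A = ∑ i, c i * ((ν i).real A : ℂ) := by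
  set J := (ComplexMeasure.re M).toJordanDecomposition
  set J' := (ComplexMeasure.im M).toJordanDecomposition
  refine ⟨![1, -1, Complex.I, -Complex.I], ![J.posPart, J.negPart, J'.posPart, J'.negPart],
    fun i => ?_, fun A hA => ?_⟩
  · fin_cases i
    exacts [J.posPart_finite, J.negPart_finite, J'.posPart_finite, J'.negPart_finite]
  · have h1 := (ComplexMeasure.re M).apply_eq_posPart_real_sub_negPart_real hA
    have h2 := (ComplexMeasure.im M).apply_eq_posPart_real_sub_negPart_real hA
    have h3 : M A = ((ComplexMeasure.re M A : ℝ) : ℂ) + ((ComplexMeasure.im M A : ℝ) : ℂ) * Complex.I :=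
      (Complex.re_add_im (M A)).symm
    rw [h3, h1, h2]
    simp only [Fin.sum_univ_four, J, J']
    simp
    ring

/-- The complex measure `∑_i c_i ν_i`. -/
def measureCombination (c : ι → ℂ) (ν : ι → Measure X) [∀ i, IsFiniteMeasure (ν i)] :
    ComplexMeasure X :=
  (∑ i, (c i).re • (ν i).toSignedMeasure).toComplexMeasure (∑ i, (c i).im • (ν i).toSignedMeasure)

lemma measureCombination_apply (c : ι → ℂ) (ν : ι → Measure X) [∀ i, IsFiniteMeasure (ν i)]
    {A : Set X} (hA : MeasurableSet A) :
    measureCombination c ν A = ∑ i, c i * ((ν i).real A : ℂ) := by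
  rw [measureCombination, SignedMeasure.toComplexMeasure_apply]
  have h : ∀ r : ι → ℝ, (∑ i, r i • (ν i).toSignedMeasure) A = ∑ i, r i * (ν i).real A := by
    intro r
    rw [FunLike.coe_sum]
    simp only [Finset.sum_apply, _root_.smul_apply, smul_eq_mul,
      Measure.toSignedMeasure_apply_measurable hA]
  rw [h, h]
  apply Complex.ext <;> simp

variable {M : ComplexMeasure X} {c : ι → ℂ} {ν : ι → Measure X} [∀ i, IsFiniteMeasure (ν i)]

/-- The integral against a complex combination of finite measures. -/
lemma integral_eq_sum_integral (hM : ∀ A, MeasurableSet A → M A = ∑ i, c i * ((ν i).real A : ℂ))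
    {g : X → ℂ} (hg : ∀ i, Integrable g (ν i)) :
    VectorMeasure.integral M g (ContinuousLinearMap.mul ℝ ℂ) = ∑ i, c i * ∫ x, g x ∂(ν i) := by
  -- `N` dominates every `ν i` and, up to the factor `C`, the variation of `M`. All integrals become
  -- extensions of set functions over the same L¹ space of `N`; they agree on indicators, hence on
  -- its integrable functions by linearity and density.
  set N : Measure X := ∑ i, ν i with hN
  have hνN : ∀ i, ν i ≤ N := fun i => by
    rw [hN]
    exact Measure.le_iff.2 fun s _ => by
      rw [Measure.finsetSum_apply]
      exact Finset.single_le_sum (f := fun i => ν i s) (fun _ _ => zero_le) (Finset.mem_univ i)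
  have hgN : Integrable g N := by
    rw [hN]
    exact integrable_finsetSum_measure.2 fun i _ => hg i
  set C : ℝ≥0∞ := ∑ i, ‖c i‖ₑ with hC
  have hCt : C ≠ ∞ := ENNReal.sum_ne_top.2 fun i _ => enorm_ne_top
  have hvar : M.variation ≤ C • N := by
    refine VectorMeasure.variation_le_of_forall_enorm_le fun A hA => ?_
    rw [hM A hA, Measure.smul_apply, smul_eq_mul, hC, Finset.sum_mul]
    refine (enorm_sum_le _ _).trans (Finset.sum_le_sum fun i _ => ?_)
    rw [enorm_mul]
    gcongr
    rw [← ofReal_norm, Complex.norm_real, Real.norm_eq_abs, abs_of_nonneg measureReal_nonneg,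
      ofReal_measureReal]
    exact hνN i A
  have hT := dominatedFinMeasAdditive_cbmApplyMeasure M (ContinuousLinearMap.mul ℝ ℂ)
  have hT' := hT.of_measure_le_smul hCt hvar (ContinuousLinearMap.opNorm_nonneg _)
  have hW : ∀ i, DominatedFinMeasAdditive N (weightedSMul (ν i) : Set X → ℂ →L[ℝ] ℂ) 1 := fun i =>
    (dominatedFinMeasAdditive_weightedSMul (ν i)).of_measure_le (hνN i) zero_le_one
  have e1 : ∀ f : X → ℂ, Integrable f N → VectorMeasure.integral M f (ContinuousLinearMap.mul ℝ ℂ) =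
      setToFun N _ hT' f := fun f hf => by
    rw [VectorMeasure.integral_eq_setToFun]
    exact (setToFun_congr_measure_of_integrable C hCt hvar hT' hT f hf).symm
  have e2 : ∀ i, ∀ f : X → ℂ, Integrable f N → ∫ x, f x ∂(ν i) = setToFun N _ (hW i) f :=
    fun i f hf => by
      rw [MeasureTheory.integral_eq_setToFun]
      exact (setToFun_congr_measure_of_integrable 1 ENNReal.one_ne_top (by simpa using hνN i)
        (hW i) _ f hf).symm
  have key : ∀ f : X → ℂ, Integrable f N →
      setToFun N _ hT' f = ∑ i, c i * setToFun N _ (hW i) f := by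
    intro f hf
    refine Integrable.induction
      (fun f => setToFun N _ hT' f = ∑ i, c i * setToFun N _ (hW i) f) ?_ ?_ ?_ ?_ hf
    · intro b s hs hNs
      rw [setToFun_indicator_const hT' hs hNs.ne]
      simp only [setToFun_indicator_const (hW _) hs hNs.ne]
      change b * M s = _
      rw [hM s hs, Finset.mul_sum]
      refine Finset.sum_congr rfl fun i _ => ?_
      rw [weightedSMul_apply, Complex.real_smul]
      ring
    · intro f g _ hf hg h1 h2
      rw [setToFun_add hT' hf hg, h1, h2, ← Finset.sum_add_distrib]
      refine Finset.sum_congr rfl fun i _ => ?_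
      rw [setToFun_add (hW i) hf hg, mul_add]
    · refine isClosed_eq (continuous_setToFun hT') (continuous_finsetSum _ fun i _ => ?_)
      exact continuous_const.mul (continuous_setToFun (hW i))
    · intro f g hfg _ h
      rw [← setToFun_congr_ae hT' hfg, h]
      refine Finset.sum_congr rfl fun i _ => ?_
      rw [setToFun_congr_ae (hW i) hfg]
  rw [e1 g hgN, key g hgN]
  exact Finset.sum_congr rfl fun i _ => by rw [e2 i g hgN]

end ComplexCombination

/-! ### Weak limits of positive semidefinite matrix densities -/

section WeakLimit

variable {E : Type*} [MetricSpace E] [MeasurableSpace E] [BorelSpace E]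

/-- A complex combination of finite measures is determined by the integrals of nonnegative
continuous functions, up to passing to limits. -/
lemma sum_measureReal_mem {ι : Type*} [Fintype ι] {c : ι → ℂ} {ν : ι → Measure E}
    [∀ i, IsFiniteMeasure (ν i)] {Q : Set ℂ} (hQ : IsClosed Q)
    (h : ∀ φ : C(E, ℝ), (∀ t, 0 ≤ φ t) → (∀ t, φ t ≤ 1) →
      ∑ i, c i * ∫ t, (φ t : ℂ) ∂(ν i) ∈ Q) {A : Set E}
    (hA : MeasurableSet A) : ∑ i, c i * ((ν i).real A : ℂ) ∈ Q := by
  -- Thickened indicators are continuous with values in `[0, 1]` and converge to the indicator of a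
  -- closed set.
  have hclosed : ∀ F : Set E, IsClosed F → ∑ i, c i * ((ν i).real F : ℂ) ∈ Q := by
    intro F hF
    have hδ : ∀ m : ℕ, (0 : ℝ) < 1 / (m + 1) := fun m => Nat.one_div_pos_of_nat
    have hlim : ∀ i, Tendsto (fun m : ℕ => ∫ t, (thickenedIndicator (hδ m) F t : ℝ) ∂(ν i)) atTop
        (𝓝 ((ν i).real F)) := fun i =>
      tendsto_integral_thickenedIndicator_of_isClosed (ν i) hF hδ tendsto_one_div_add_atTop_nhds_zero_nat
    have hlim2 : Tendsto (fun m : ℕ => ∑ i, c i *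
        ((∫ t, (thickenedIndicator (hδ m) F t : ℝ) ∂(ν i) : ℝ) : ℂ)) atTop
        (𝓝 (∑ i, c i * ((ν i).real F : ℂ))) :=
      tendsto_finsetSum _ fun i _ =>
        ((Complex.continuous_ofReal.tendsto _).comp (hlim i)).const_mul _
    refine hQ.mem_of_tendsto hlim2 (Eventually.of_forall fun m => ?_)
    have := h ⟨fun t => (thickenedIndicator (hδ m) F t : ℝ),
      NNReal.continuous_coe.comp (thickenedIndicator (hδ m) F).continuous⟩ (fun t => NNReal.coe_nonneg _)
      fun t => NNReal.coe_le_one.2 (thickenedIndicator_le_one _ _ _)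
    simpa only [ContinuousMap.coe_mk, integral_complex_ofReal] using this
  set N : Measure E := ∑ i, ν i with hN
  have hνN : ∀ i s, ν i s ≤ N s := fun i s => by
    rw [hN, Measure.finsetSum_apply]
    exact Finset.single_le_sum (f := fun i => ν i s) (fun _ _ => zero_le) (Finset.mem_univ i)
  -- Inner regularity of the sum `N` provides the same closed sets `F m` for all the `ν i`.
  have hex : ∀ m : ℕ, ∃ F, F ⊆ A ∧ IsClosed F ∧ N (A \ F) < ENNReal.ofReal (1 / (m + 1)) := fun m =>
    hA.exists_isClosed_sdiff_lt (measure_ne_top _ _)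
      (ENNReal.ofReal_pos.2 Nat.one_div_pos_of_nat).ne'
  choose F hFA hFc hFN using hex
  have hlim : ∀ i, Tendsto (fun m => (ν i).real (F m)) atTop (𝓝 ((ν i).real A)) := by
    intro i
    have hb : ∀ m : ℕ, |(ν i).real (F m) - (ν i).real A| ≤ 1 / ((m : ℝ) + 1) := by
      intro m
      have h1 : (ν i).real (A \ F m) = (ν i).real A - (ν i).real (F m) :=
        measureReal_sdiff (hFA m) (hFc m).measurableSet
      rw [abs_sub_comm, ← h1, abs_of_nonneg measureReal_nonneg]
      exact ENNReal.toReal_le_of_le_ofReal (by positivity) ((hνN i _).trans (hFN m).le)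
    exact tendsto_iff_norm_sub_tendsto_zero.2 (squeeze_zero (fun m => norm_nonneg _) hb
      tendsto_one_div_add_atTop_nhds_zero_nat)
  exact hQ.mem_of_tendsto (tendsto_finsetSum Finset.univ fun i _ =>
    ((Complex.continuous_ofReal.tendsto _).comp (hlim i)).const_mul (c i))
    (Eventually.of_forall fun m => hclosed (F m) (hFc m))

/-- It writes the complex density `ā b` as a combination of four nonnegative densities, to which
weak compactness of finite measures applies. -/
lemma polarization (a b : ℂ) : ∑ s : Fin 4, (-Complex.I) ^ (s : ℕ) / 4 *
    ((‖a + Complex.I ^ (s : ℕ) * b‖ ^ 2 : ℝ) : ℂ) = (starRingEnd ℂ) a * b := by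
  have h : ∀ z : ℂ, ((‖z‖ ^ 2 : ℝ) : ℂ) = (starRingEnd ℂ) z * z := fun z => by
    rw [Complex.conj_mul']
    push_cast
    ring
  have hI : Complex.I ^ 2 = -1 := Complex.I_sq
  have hI3 : Complex.I ^ 3 = -Complex.I := Complex.I_pow_three
  simp only [h, Fin.sum_univ_four]
  simp only [Fin.val_zero, Fin.val_one, Fin.val_two, pow_zero, pow_one, Fin.isValue, map_add,
    map_mul, Complex.conj_I, hI, one_mul, map_neg, map_one]
  rw [show ((3 : Fin 4) : ℕ) = 3 from rfl, hI3]
  simp only [map_neg, Complex.conj_I, neg_neg]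
  rw [show (-Complex.I) ^ 2 = -1 by rw [neg_sq, hI], show (-Complex.I) ^ 3 = Complex.I by
    rw [Odd.neg_pow (by decide), hI3, neg_neg]]
  ring_nf
  simp only [hI]
  ring

variable [CompactSpace E] {lam : Measure E} [IsFiniteMeasure lam]

lemma integrable_of_continuous {g : E → ℂ} (hg : Continuous g) (ν : Measure E) [IsFiniteMeasure ν] :
    Integrable g ν := by
  obtain ⟨C, hC⟩ := isCompact_univ.exists_bound_of_continuousOn hg.continuousOn
  exact Integrable.of_bound hg.aestronglyMeasurable C
    (Eventually.of_forall fun t => hC t (Set.mem_univ t))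

/-- Weak compactness for the measures with density `‖g_n‖²`. -/
lemma exists_tendsto_integral_mul_norm_sq (U : Ultrafilter ℕ) {g : ℕ → E → ℂ}
    (hg : ∀ n, Continuous (g n)) {C : ℝ} (hC : ∀ n, ∫ t, ‖g n t‖ ^ 2 ∂lam ≤ C) :
    ∃ ν : Measure E, IsFiniteMeasure ν ∧ ∀ φ : C(E, ℂ),
      Tendsto (fun n => ∫ t, φ t * ((‖g n t‖ ^ 2 : ℝ) : ℂ) ∂lam) U (𝓝 (∫ t, φ t ∂ν)) := by
  have hcont : ∀ n, Continuous fun t => ‖g n t‖ ^ 2 := fun n => (hg n).norm.pow 2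
  have hint : ∀ n, Integrable (fun t => ‖g n t‖ ^ 2) lam := by
    intro n
    have h := (integrable_of_continuous (g := fun t => ((‖g n t‖ ^ 2 : ℝ) : ℂ))
      (Complex.continuous_ofReal.comp (hcont n)) lam).re
    exact h
  set d : ℕ → E → ℝ≥0∞ := fun n t => ENNReal.ofReal (‖g n t‖ ^ 2) with hd
  have hdm : ∀ n, Measurable (d n) := fun n => (hcont n).measurable.ennreal_ofReal
  have hmass : ∀ n, lam.withDensity (d n) Set.univ ≤ ENNReal.ofReal C := by
    intro n
    rw [withDensity_apply _ MeasurableSet.univ, Measure.restrict_univ,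
      ← ofReal_integral_eq_lintegral_ofReal (hint n) (Eventually.of_forall fun _ => sq_nonneg _)]
    exact ENNReal.ofReal_le_ofReal (hC n)
  have hfin : ∀ n, IsFiniteMeasure (lam.withDensity (d n)) := fun n =>
    ⟨(hmass n).trans_lt ENNReal.ofReal_lt_top⟩
  set θ : ℕ → FiniteMeasure E := fun n => ⟨lam.withDensity (d n), hfin n⟩ with hθ
  have hθm : ∀ n, θ n ∈ {μ : FiniteMeasure E | μ.mass ≤ C.toNNReal} := by
    intro n
    have := hmass n
    rw [Set.mem_ofPred_eq, ← ENNReal.coe_le_coe, FiniteMeasure.ennreal_mass]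
    exact this
  -- On a compact space the finite measures of bounded mass form a compact set, so the image
  -- ultrafilter converges.
  obtain ⟨ν, -, hν⟩ := (isCompact_setOfPred_finiteMeasure_le_of_compactSpace E
    C.toNNReal).ultrafilter_le_nhds' (U.map θ) (Ultrafilter.mem_map.2 (Eventually.of_forall hθm))
  refine ⟨ν, inferInstance, fun φ => ?_⟩
  have hν' : Tendsto θ U (𝓝 ν) := hν
  have h := (FiniteMeasure.tendsto_iff_forall_integral_rclike_tendsto ℂ).1 hν'
    (BoundedContinuousFunction.mkOfCompact φ)
  refine h.congr fun n => ?_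
  change ∫ t, φ t ∂(lam.withDensity (d n)) = _
  rw [integral_withDensity_eq_integral_toReal_smul (hdm n)
    (Eventually.of_forall fun _ => ENNReal.ofReal_lt_top)]
  refine integral_congr_ae (Eventually.of_forall fun t => ?_)
  simp only [hd]
  rw [ENNReal.toReal_ofReal (sq_nonneg _), Complex.real_smul, mul_comm]

/-- Weak compactness for the matrix measures with densities `ζ̄_j ζ_l`. -/
theorem exists_matrix_limit {p : ℕ} {ζ : ℕ → Fin p → E → ℂ} (hζ : ∀ n j, Continuous (ζ n j))
    (hb : ∀ n j, ∫ t, ‖ζ n j t‖ ^ 2 ∂lam ≤ 1) :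
    ∃ (M : Matrix (Fin p) (Fin p) (ComplexMeasure E)) (U : Ultrafilter ℕ),
      (U : Filter ℕ) ≤ atTop ∧
      (∀ A, MeasurableSet A → (Matrix.of fun j l => M j l A).PosSemidef) ∧
      ∀ (g : C(E, ℂ)) (j l : Fin p),
        Tendsto (fun n => ∫ t, g t * ((starRingEnd ℂ) (ζ n j t) * ζ n l t) ∂lam) U
          (𝓝 (VectorMeasure.integral (M j l) g (ContinuousLinearMap.mul ℝ ℂ))) := by
  -- One ultrafilter serves all triples `(j, l, s)` at once, with no successive extraction of
  -- subsequences.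
  set U : Ultrafilter ℕ := Ultrafilter.of atTop
  set q : Fin p → Fin p → Fin 4 → ℕ → E → ℂ := fun j l s n t =>
    ζ n j t + Complex.I ^ (s : ℕ) * ζ n l t with hq
  have hqc : ∀ j l s n, Continuous (q j l s n) := fun j l s n =>
    (hζ n j).add (continuous_const.mul (hζ n l))
  have hsq : ∀ {g : E → ℂ}, Continuous g → Integrable (fun t => ‖g t‖ ^ 2) lam := by
    intro g hg
    exact (integrable_of_continuous (g := fun t => ((‖g t‖ ^ 2 : ℝ) : ℂ))
      (Complex.continuous_ofReal.comp (hg.norm.pow 2)) lam).re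
  have hqb : ∀ j l s n, ∫ t, ‖q j l s n t‖ ^ 2 ∂lam ≤ 4 := by
    intro j l s n
    calc _ ≤ ∫ t, (2 * ‖ζ n j t‖ ^ 2 + 2 * ‖ζ n l t‖ ^ 2) ∂lam := by
          refine integral_mono (hsq (hqc j l s n)) (((hsq (hζ n j)).const_mul 2).add
            ((hsq (hζ n l)).const_mul 2)) fun t => ?_
          have h1 : ‖q j l s n t‖ ≤ ‖ζ n j t‖ + ‖ζ n l t‖ := by
            refine (norm_add_le _ _).trans (add_le_add le_rfl (le_of_eq ?_))
            rw [norm_mul, norm_pow, Complex.norm_I, one_pow, one_mul]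
          simp only
          nlinarith [norm_nonneg (q j l s n t), sq_nonneg (‖ζ n j t‖ - ‖ζ n l t‖)]
      _ = 2 * ∫ t, ‖ζ n j t‖ ^ 2 ∂lam + 2 * ∫ t, ‖ζ n l t‖ ^ 2 ∂lam := by
          rw [integral_add ((hsq (hζ n j)).const_mul 2) ((hsq (hζ n l)).const_mul 2),
            integral_const_mul, integral_const_mul]
      _ ≤ 4 := by linarith [hb n j, hb n l]
  choose ν hνf hν using fun j l s =>
    exists_tendsto_integral_mul_norm_sq (lam := lam) U (hqc j l s) (hqb j l s)
  set c : Fin 4 → ℂ := fun s => (-Complex.I) ^ (s : ℕ) / 4 with hc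
  have hlim : ∀ (g : C(E, ℂ)) (j l : Fin p),
      Tendsto (fun n => ∫ t, g t * ((starRingEnd ℂ) (ζ n j t) * ζ n l t) ∂lam) U
        (𝓝 (∑ s, c s * ∫ t, g t ∂(ν j l s))) := by
    intro g j l
    refine (tendsto_finsetSum Finset.univ fun s _ => (hν j l s g).const_mul (c s)).congr fun n => ?_
    simp only [← integral_const_mul]
    rw [← integral_finsetSum _ fun s _ => ?_]
    · refine integral_congr_ae (Eventually.of_forall fun t => ?_)
      simp only
      rw [← polarization, Finset.mul_sum]
      refine Finset.sum_congr rfl fun s _ => ?_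
      simp only [hc, hq]
      ring
    · refine (integrable_of_continuous ?_ lam).const_mul _
      exact g.continuous.mul (Complex.continuous_ofReal.comp ((hqc j l s n).norm.pow 2))
  refine ⟨fun j l => measureCombination c (ν j l), U, Ultrafilter.of_le _, fun A hA => ?_,
    fun g j l => ?_⟩
  swap
  · rw [integral_eq_sum_integral (fun A hA => measureCombination_apply c (ν j l) hA)
      fun s => integrable_of_continuous g.continuous _]
    exact hlim g j l
  -- A closed condition on a linear combination of the entries passes from the densities to the
  -- limits along `U`, and then from continuous test functions to measurable sets.
  have hform : ∀ (b : Fin p → Fin p → ℂ) (Q : Set ℂ), IsClosed Q →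
      (∀ (φ : C(E, ℝ)) (n : ℕ), (∀ t, 0 ≤ φ t) →
        ∑ j, ∑ l, b j l * ∫ t, (φ t : ℂ) * ((starRingEnd ℂ) (ζ n j t) * ζ n l t) ∂lam ∈ Q) →
      ∑ j, ∑ l, b j l * measureCombination c (ν j l) A ∈ Q := by
    intro b Q hQ h
    have key := sum_measureReal_mem (ι := Fin p × Fin p × Fin 4)
      (c := fun i => b i.1 i.2.1 * c i.2.2) (ν := fun i => ν i.1 i.2.1 i.2.2) hQ ?_ hA
    · simp only [Fintype.sum_prod_type, mul_assoc, ← Finset.mul_sum] at key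
      simpa only [measureCombination_apply c _ hA] using key
    · intro φ hφ _
      simp only [Fintype.sum_prod_type, mul_assoc, ← Finset.mul_sum]
      refine hQ.mem_of_tendsto (tendsto_finsetSum Finset.univ fun j _ =>
        tendsto_finsetSum Finset.univ fun l _ => (hlim ⟨fun t => (φ t : ℂ),
          Complex.continuous_ofReal.comp φ.continuous⟩ j l).const_mul (b j l))
        (Eventually.of_forall fun n => h φ n hφ)
  have hnonneg : ∀ v : Fin p → ℂ, 0 ≤ star v ⬝ᵥ
      ((Matrix.of fun j l => measureCombination c (ν j l) A) *ᵥ v) := by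
    intro v
    have := hform (fun j l => (starRingEnd ℂ) (v j) * v l) {z | 0 ≤ z}
      (isClosed_le continuous_const continuous_id) fun φ n hφ => ?_
    · simp only [Set.mem_ofPred_eq] at this
      refine this.trans_eq ?_
      simp only [dotProduct, Matrix.mulVec, Finset.mul_sum, Matrix.of_apply, Pi.star_apply]
      refine Finset.sum_congr rfl fun j _ => Finset.sum_congr rfl fun l _ => ?_
      rw [RCLike.star_def]
      ring
    · have hint : ∀ j l, Integrable (fun t => (starRingEnd ℂ) (v j) * v l *
          ((φ t : ℂ) * ((starRingEnd ℂ) (ζ n j t) * ζ n l t))) lam := fun j l =>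
        (integrable_of_continuous ((Complex.continuous_ofReal.comp φ.continuous).mul
          ((Complex.continuous_conj.comp (hζ n j)).mul (hζ n l))) lam).const_mul _
      simp only [Set.mem_ofPred_eq, ← integral_const_mul]
      -- Before the limit, the quadratic form at `v` is the integral of `φ |∑ v_j ζ_j|²`, hence
      -- nonnegative.
      have e : ∑ j, ∑ l, ∫ t, (starRingEnd ℂ) (v j) * v l *
          ((φ t : ℂ) * ((starRingEnd ℂ) (ζ n j t) * ζ n l t)) ∂lam =
          ∫ t, ((φ t * ‖∑ j, v j * ζ n j t‖ ^ 2 : ℝ) : ℂ) ∂lam := by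
        rw [← Finset.sum_congr rfl fun j _ => integral_finsetSum _ fun l _ => hint j l,
          ← integral_finsetSum _ fun j _ => integrable_finsetSum _ fun l _ => hint j l]
        refine integral_congr_ae (Eventually.of_forall fun t => ?_)
        have h2 : ((‖∑ j, v j * ζ n j t‖ ^ 2 : ℝ) : ℂ) =
            (starRingEnd ℂ) (∑ j, v j * ζ n j t) * ∑ j, v j * ζ n j t := by
          rw [Complex.conj_mul']
          push_cast
          ring
        simp only
        rw [Complex.ofReal_mul, h2, map_sum, Finset.sum_mul_sum, Finset.mul_sum]
        refine Finset.sum_congr rfl fun j _ => ?_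
        rw [Finset.mul_sum]
        refine Finset.sum_congr rfl fun l _ => ?_
        rw [map_mul]
        ring
      rw [e, integral_complex_ofReal]
      exact Complex.zero_le_real.2 (integral_nonneg fun t => mul_nonneg (hφ t) (sq_nonneg _))
  -- Nonnegativity in the complex order includes being real, and a complex matrix with a real
  -- quadratic form is Hermitian.
  refine Matrix.PosSemidef.of_dotProduct_mulVec_nonneg ?_ hnonneg
  rw [← Matrix.isSymmetric_toEuclideanLin_iff, LinearMap.isSymmetric_iff_inner_map_self_real]
  intro v
  set N : Matrix (Fin p) (Fin p) ℂ := Matrix.of fun j l => measureCombination c (ν j l) A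
  have h : inner ℂ v (Matrix.toEuclideanLin N v) = star v.ofLp ⬝ᵥ (N *ᵥ v.ofLp) := by
    rw [EuclideanSpace.inner_eq_star_dotProduct, dotProduct_comm]
    rfl
  have him : (starRingEnd ℂ) (inner ℂ v (Matrix.toEuclideanLin N v)) =
      inner ℂ v (Matrix.toEuclideanLin N v) := by
    rw [h, Complex.conj_eq_iff_im]
    exact (Complex.le_def.1 (hnonneg v.ofLp)).2.symm
  rw [← inner_conj_symm (Matrix.toEuclideanLin N v) v, him, him]

end WeakLimit

/-! ### The spectral density and the spectral measure -/

section Spectral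

/-- `e^{ikt}`. -/
def expInt (k : ℤ) (t : ℝ) : ℂ := Complex.exp (Complex.I * k * t)

lemma continuous_expInt (k : ℤ) : Continuous (expInt k) := by
  unfold expInt
  fun_prop

lemma norm_expInt (k : ℤ) (t : ℝ) : ‖expInt k t‖ = 1 := by
  rw [expInt, show Complex.I * k * t = ((k * t : ℝ) : ℂ) * Complex.I by push_cast; ring,
    Complex.norm_exp_ofReal_mul_I]

lemma conj_expInt (k : ℤ) (t : ℝ) : (starRingEnd ℂ) (expInt k t) = expInt (-k) t := by
  rw [expInt, expInt, ← Complex.exp_conj]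
  congr 1
  simp

lemma expInt_mul (k m : ℤ) (t : ℝ) : expInt k t * expInt m t = expInt (k + m) t := by
  rw [expInt, expInt, expInt, ← Complex.exp_add]
  congr 1
  push_cast
  ring

lemma integral_expInt (k : ℤ) :
    ∫ t in (-Real.pi)..Real.pi, expInt k t = if k = 0 then 2 * (Real.pi : ℂ) else 0 := by
  split_ifs with hk
  · simp only [hk, expInt, Int.cast_zero, mul_zero, zero_mul, Complex.exp_zero]
    rw [intervalIntegral.integral_const, Complex.real_smul]
    push_cast
    ring
  · have hc : Complex.I * k ≠ 0 := mul_ne_zero Complex.I_ne_zero (Int.cast_ne_zero.2 hk)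
    unfold expInt
    rw [integral_exp_mul_complex hc, div_eq_zero_iff]
    left
    rw [sub_eq_zero, Complex.exp_eq_exp_iff_exists_int]
    exact ⟨k, by push_cast; ring⟩

lemma integral_mul_tsum_expInt {X : Type*} [MeasurableSpace X] {ν : Measure X} [IsFiniteMeasure ν]
    {τ : X → ℝ} (hτ : Measurable τ) {g : X → ℂ} (hg : Measurable g) (hg1 : ∀ x, ‖g x‖ ≤ 1)
    {γ : ℤ → ℝ} (hγ : Summable fun k => |γ k|) :
    ∫ x, g x * ∑' k, (γ k : ℂ) * expInt k (τ x) ∂ν =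
      ∑' k, (γ k : ℂ) * ∫ x, g x * expInt k (τ x) ∂ν := by
  have hm : ∀ k, AEStronglyMeasurable (fun x => g x * ((γ k : ℂ) * expInt k (τ x))) ν := fun k =>
    (hg.mul (((continuous_expInt k).measurable.comp hτ).const_mul _)).aestronglyMeasurable
  have hb : ∀ k x, ‖g x * ((γ k : ℂ) * expInt k (τ x))‖ ≤ |γ k| := by
    intro k x
    rw [norm_mul, norm_mul, norm_expInt, mul_one, Complex.norm_real, Real.norm_eq_abs]
    exact mul_le_of_le_one_left (abs_nonneg _) (hg1 x)
  have hi : ∀ k, Integrable (fun x => g x * ((γ k : ℂ) * expInt k (τ x))) ν := fun k =>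
    Integrable.of_bound (hm k) _ (Eventually.of_forall (hb k))
  have hs : Summable fun k => ∫ x, ‖g x * ((γ k : ℂ) * expInt k (τ x))‖ ∂ν := by
    refine Summable.of_nonneg_of_le (fun k => integral_nonneg fun _ => norm_nonneg _) (fun k => ?_)
      (hγ.mul_right (ν.real Set.univ))
    refine (integral_mono (hi k).norm (integrable_const _) (hb k)).trans_eq ?_
    rw [integral_const, smul_eq_mul, mul_comm]
  have h := integral_tsum_of_summable_integral_norm hi hs
  simp only [← tsum_mul_left]
  rw [← h]
  refine tsum_congr fun k => ?_
  rw [← integral_const_mul]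
  refine integral_congr_ae (Eventually.of_forall fun x => ?_)
  simp only
  ring

lemma spectralDensity_eq (γ : ℤ → ℝ) (t : ℝ) :
    spectralDensity γ t = (2 * (Real.pi : ℂ))⁻¹ * ∑' k : ℤ, (γ k : ℂ) * expInt k t := rfl

/-- The Fourier coefficients of the spectral density. -/
theorem integral_expInt_mul_spectralDensity {γ : ℤ → ℝ} (hγ : Summable fun k => |γ k|)
    (hsymm : ∀ k, γ (-k) = γ k) (k : ℤ) :
    (γ k : ℂ) = ∫ t in (-Real.pi)..Real.pi, expInt k t * spectralDensity γ t := by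
  have hpi : -Real.pi ≤ Real.pi := by linarith [Real.pi_pos]
  simp only [spectralDensity_eq, mul_left_comm _ (2 * (Real.pi : ℂ))⁻¹]
  rw [intervalIntegral.integral_const_mul, intervalIntegral.integral_of_le hpi,
    integral_mul_tsum_expInt (τ := fun t => t) measurable_id (continuous_expInt k).measurable
      (fun t => (norm_expInt k t).le) hγ]
  simp only [expInt_mul, ← intervalIntegral.integral_of_le hpi, integral_expInt]
  -- With `e^{ikt}` both in the coefficient and in the series, only the index `-k` survives;
  -- evenness of `γ` restores `γ(k)`.
  rw [tsum_eq_single (-k)]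
  · rw [if_pos (by ring), hsymm]
    field_simp
  · intro m hm
    rw [if_neg (by omega), mul_zero]

/-- Lebesgue measure on `[-π, π]`, normalized to a probability measure. -/
def circleMeasure : Measure (Set.Icc (-Real.pi) Real.pi) :=
  ENNReal.ofReal (2 * Real.pi)⁻¹ • Measure.comap Subtype.val volume

lemma integral_circleMeasure (g : ℝ → ℂ) :
    ∫ t, g t ∂circleMeasure = (2 * (Real.pi : ℂ))⁻¹ * ∫ t in (-Real.pi)..Real.pi, g t := by
  have hpi : -Real.pi ≤ Real.pi := by linarith [Real.pi_pos]
  rw [circleMeasure, integral_smul_measure, integral_subtype_comap measurableSet_Icc,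
    integral_Icc_eq_integral_Ioc, intervalIntegral.integral_of_le hpi,
    ENNReal.toReal_ofReal (by positivity), Complex.real_smul]
  push_cast
  rfl

lemma isFiniteMeasure_circleMeasure : IsFiniteMeasure circleMeasure := by
  refine ⟨?_⟩
  rw [circleMeasure, Measure.smul_apply, comap_subtype_coe_apply measurableSet_Icc]
  simp only [Set.image_univ, Subtype.range_coe_subtype, Set.ofPred_mem_eq, Real.volume_Icc,
    smul_eq_mul]
  exact ENNReal.mul_lt_top ENNReal.ofReal_lt_top ENNReal.ofReal_lt_top

/-- The trigonometric polynomial `∑_{a < n} z_a e^{-iat}`. -/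
def trigPoly (n : ℕ) (z : ℕ → ℝ) (t : ℝ) : ℂ := ∑ a ∈ Finset.range n, (z a : ℂ) * expInt (-a) t

lemma continuous_trigPoly (n : ℕ) (z : ℕ → ℝ) : Continuous (trigPoly n z) :=
  continuous_finsetSum _ fun _ _ => continuous_const.mul (continuous_expInt _)

/-- By orthogonality of the exponentials only pairs with `b - a = k` remain. The sign in `e^{-iat}`
is chosen so that the lag comes out as `k` and not `-k`. -/
lemma integral_trigPoly (n : ℕ) (z z' : ℕ → ℝ) (k : ℤ) :
    ∫ t, expInt k t * ((starRingEnd ℂ) (trigPoly n z t) * trigPoly n z' t) ∂circleMeasure =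
      (lagProd n z z' k : ℂ) := by
  have hpt : ∀ t, expInt k t * ((starRingEnd ℂ) (trigPoly n z t) * trigPoly n z' t) =
      ∑ a ∈ Finset.range n, ∑ b ∈ Finset.range n,
        (z a * z' b : ℂ) * expInt (k + a - b) t := by
    intro t
    rw [trigPoly, trigPoly, map_sum, Finset.sum_mul_sum, Finset.mul_sum]
    refine Finset.sum_congr rfl fun a _ => ?_
    rw [Finset.mul_sum]
    refine Finset.sum_congr rfl fun b _ => ?_
    rw [map_mul, conj_expInt, neg_neg, Complex.conj_ofReal, sub_eq_add_neg, ← expInt_mul,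
      ← expInt_mul]
    ring
  have hi : ∀ a b : ℕ, IntervalIntegrable (fun t => (z a * z' b : ℂ) * expInt (k + a - b) t) volume
      (-Real.pi) Real.pi := fun a b =>
    (continuous_const.mul (continuous_expInt _)).intervalIntegrable _ _
  rw [integral_circleMeasure fun t => expInt k t *
    ((starRingEnd ℂ) (trigPoly n z t) * trigPoly n z' t)]
  simp only [hpt]
  rw [intervalIntegral.integral_finsetSum fun a _ => ?_]
  · rw [lagProd]
    push_cast
    rw [Finset.mul_sum]
    refine Finset.sum_congr rfl fun a _ => ?_
    rw [intervalIntegral.integral_finsetSum fun b _ => hi a b, Finset.mul_sum]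
    refine Finset.sum_congr rfl fun b _ => ?_
    rw [intervalIntegral.integral_const_mul, integral_expInt]
    by_cases h : (b : ℤ) - a = k
    · rw [if_pos h, if_pos (by omega)]
      push_cast
      field_simp
    · rw [if_neg h, if_neg (by omega)]
      simp
  · have := continuous_finsetSum (Finset.range n) fun (b : ℕ) _ =>
      (continuous_const (y := (z a * z' b : ℂ))).mul (continuous_expInt (k + a - b))
    exact this.intervalIntegrable _ _

lemma integral_norm_trigPoly_sq_le {n : ℕ} {z : ℕ → ℝ}
    (hz : ∑ a ∈ Finset.range n, z a ^ 2 ≤ 1) : ∫ t, ‖trigPoly n z t‖ ^ 2 ∂circleMeasure ≤ 1 := by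
  have h := integral_trigPoly n z z 0
  have h2 : ∫ t, expInt 0 t * ((starRingEnd ℂ) (trigPoly n z t) * trigPoly n z t) ∂circleMeasure =
      ((∫ t, ‖trigPoly n z t‖ ^ 2 ∂circleMeasure : ℝ) : ℂ) := by
    rw [← integral_complex_ofReal]
    refine integral_congr_ae (Eventually.of_forall fun t => ?_)
    simp only
    rw [Complex.conj_mul']
    simp [expInt]
  rw [h2, Complex.ofReal_inj] at h
  change ∫ t, ‖trigPoly n z t‖ ^ 2 ∂circleMeasure = _ at h
  rw [h]
  exact (le_abs_self _).trans (abs_lagProd_le_one n hz hz 0)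

variable {p : ℕ} {x : ℕ → Fin p → ℝ}

/-- The limits `R(k)` have a spectral measure. -/
theorem IsHannanDesign.exists_isSpectralMeasure (hx : IsHannanDesign x) :
    ∃ M, IsSpectralMeasure (lagLimit x) M := by
  have := isFiniteMeasure_circleMeasure
  obtain ⟨M, U, hU, hpos, hlim⟩ := exists_matrix_limit (lam := circleMeasure)
    (ζ := fun n j (t : Set.Icc (-Real.pi) Real.pi) => trigPoly n (normCol x n j) t)
    (fun n j => (continuous_trigPoly n _).comp continuous_subtype_val)
    fun n j => integral_norm_trigPoly_sq_le (sum_normCol_sq_le x n j n)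
  refine ⟨M, hpos, fun k => ?_⟩
  ext j l
  have h1 := hlim ⟨fun t => expInt k t, (continuous_expInt k).comp continuous_subtype_val⟩ j l
  have h2 : Tendsto (fun n => ((lagProd n (normCol x n j) (normCol x n l) k : ℝ) : ℂ)) U
      (𝓝 (lagLimit x k j l : ℂ)) :=
    (Complex.continuous_ofReal.tendsto _).comp ((hx.tendsto_lagProd j l k).mono_left hU)
  -- The Fourier coefficients of the approximating densities are the lag products, which converge
  -- along the full sequence; the limit along `U` must coincide with theirs.
  have h3 := tendsto_nhds_unique (h2.congr fun n =>
    (integral_trigPoly n (normCol x n j) (normCol x n l) k).symm) h1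
  rw [Matrix.map_apply, h3, MatrixMeasure.integral, Matrix.of_apply]
  simp [expInt]

lemma IsHannanDesign.isSpectralMeasure (hx : IsHannanDesign x) :
    IsSpectralMeasure (lagLimit x) (spectralMeasure x) := by
  have h := hx.exists_isSpectralMeasure
  rw [spectralMeasure, dif_pos h]
  exact h.choose_spec

end Spectral

/-! ### The limiting covariance matrix in the time domain -/

section LimitCov

variable {p : ℕ} {x : ℕ → Fin p → ℝ} {R : ℕ → Matrix (Fin p) (Fin p) ℝ} {M : MatrixMeasure p}

/-- Hermitian values make the entry `(l, j)` the conjugate of the entry `(j, l)`. This supplies the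
Fourier coefficients at negative lags, of which the definition of a spectral measure says nothing.
-/
lemma IsSpectralMeasure.integral_transpose (hM : IsSpectralMeasure R M) (j l : Fin p) {g : ℝ → ℂ}
    (hg : Continuous g) :
    M.integral g l j = (starRingEnd ℂ) (M.integral (fun t => (starRingEnd ℂ) (g t)) j l) := by
  obtain ⟨c, ν, hν, hc⟩ := exists_eq_sum_measure (M j l)
  have hc' : ∀ A, MeasurableSet A → M l j A = ∑ i, (starRingEnd ℂ) (c i) * ((ν i).real A : ℂ) := by
    intro A hA
    have h : (starRingEnd ℂ) (M j l A) = M l j A := (hM.posSemidef A hA).1.apply l j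
    rw [← h, hc A hA, map_sum]
    simp only [map_mul, Complex.conj_ofReal]
  have hgi : ∀ i, Integrable (fun t : Set.Icc (-Real.pi) Real.pi => g t) (ν i) := fun i =>
    integrable_of_continuous (hg.comp continuous_subtype_val) _
  have hgi' : ∀ i, Integrable (fun t : Set.Icc (-Real.pi) Real.pi => (starRingEnd ℂ) (g t)) (ν i) :=
    fun i => integrable_of_continuous
      (Complex.continuous_conj.comp (hg.comp continuous_subtype_val)) _
  rw [MatrixMeasure.integral, MatrixMeasure.integral, Matrix.of_apply, Matrix.of_apply,
    integral_eq_sum_integral hc' hgi, integral_eq_sum_integral hc hgi', map_sum]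
  refine Finset.sum_congr rfl fun i _ => ?_
  rw [map_mul, ← integral_conj]
  simp

lemma IsSpectralMeasure.integral_expInt (hM : IsSpectralMeasure (lagLimit x) M) (k : ℤ)
    (j l : Fin p) : M.integral (expInt k) j l = (lagLimitInt x k j l : ℂ) := by
  have hnat : ∀ (m : ℕ) (j l : Fin p), M.integral (expInt m) j l = (lagLimit x m j l : ℂ) := by
    intro m j l
    have h := congrFun₂ (hM.fourier m) j l
    rw [Matrix.map_apply] at h
    rw [h]
    simp [expInt, MatrixMeasure.integral]
  match k with
  | (k : ℕ) => exact hnat k j l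
  | Int.negSucc k =>
    rw [hM.integral_transpose l j (continuous_expInt _)]
    simp only [conj_expInt, Int.neg_negSucc]
    rw [hnat, Complex.conj_ofReal]
    rfl

/-- Term by term integration of the absolutely convergent series of `f` against the four finite
measures of the entry; the Fourier coefficients then recombine into `R(k)`. -/
lemma IsSpectralMeasure.integral_spectralDensity (hM : IsSpectralMeasure (lagLimit x) M)
    {γ : ℤ → ℝ} (hγ : Summable fun k => |γ k|) (j l : Fin p) :
    M.integral (spectralDensity γ) j l = (2 * (Real.pi : ℂ))⁻¹ * (longRunCov γ x j l : ℂ) := by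
  obtain ⟨c, ν, hν, hc⟩ := exists_eq_sum_measure (M j l)
  have hexp : ∀ k i, Integrable (fun t : Set.Icc (-Real.pi) Real.pi => expInt k t) (ν i) :=
    fun k i => integrable_of_continuous ((continuous_expInt k).comp continuous_subtype_val) _
  have hb : ∀ k t, ‖(γ k : ℂ) * expInt k t‖ ≤ |γ k| := fun k t => by
    rw [norm_mul, norm_expInt, mul_one, Complex.norm_real, Real.norm_eq_abs]
  have hcont : Continuous (spectralDensity γ) :=
    continuous_const.mul (continuous_tsum (fun k => continuous_const.mul (continuous_expInt k)) hγ hb)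
  have hk : ∀ k, (∑ i, c i * ∫ t, expInt k t ∂(ν i)) = (lagLimitInt x k j l : ℂ) := by
    intro k
    rw [← hM.integral_expInt k j l, MatrixMeasure.integral, Matrix.of_apply,
      integral_eq_sum_integral hc (hexp k)]
  have hsum : ∀ i, Summable fun k => (γ k : ℂ) * ∫ t, expInt k t ∂(ν i) := by
    intro i
    refine Summable.of_norm_bounded (hγ.mul_right ((ν i).real Set.univ)) fun k => ?_
    rw [norm_mul, Complex.norm_real, Real.norm_eq_abs]
    refine mul_le_mul_of_nonneg_left ?_ (abs_nonneg _)
    refine (norm_integral_le_integral_norm _).trans_eq ?_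
    simp [norm_expInt]
  have hfi : ∀ i, Integrable (fun t : Set.Icc (-Real.pi) Real.pi => spectralDensity γ t) (ν i) :=
    fun i => integrable_of_continuous (hcont.comp continuous_subtype_val) _
  rw [MatrixMeasure.integral, Matrix.of_apply, integral_eq_sum_integral hc hfi]
  have hi : ∀ i, ∫ t, spectralDensity γ (t : Set.Icc (-Real.pi) Real.pi) ∂(ν i) =
      (2 * (Real.pi : ℂ))⁻¹ * ∑' k : ℤ, (γ k : ℂ) * ∫ t, expInt k t ∂(ν i) := by
    intro i
    simp only [spectralDensity_eq]
    rw [integral_const_mul]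
    have := integral_mul_tsum_expInt (ν := ν i) (τ := Subtype.val) measurable_subtype_coe
      (g := fun _ => 1) measurable_const (fun _ => by simp) hγ
    simp only [one_mul] at this
    rw [this]
  simp only [hi, longRunCov, Matrix.of_apply]
  push_cast
  rw [← Finset.sum_congr rfl fun i _ => mul_left_comm (2 * (Real.pi : ℂ))⁻¹ (c i) _, ← Finset.mul_sum]
  congr 1
  simp only [← tsum_mul_left]
  rw [← Summable.tsum_finsetSum fun i _ => (hsum i).mul_left (c i)]
  refine tsum_congr fun k => ?_
  rw [← hk k, Finset.mul_sum]
  refine Finset.sum_congr rfl fun i _ => ?_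
  ring

/-- The limiting covariance matrix is `R(0)⁻¹ (∑_k γ(k) R(k)) R(0)⁻¹`. -/
theorem IsHannanDesign.limitCov_eq (hx : IsHannanDesign x) {γ : ℤ → ℝ}
    (hγ : Summable fun k => |γ k|) (j l : Fin p) :
    limitCov (spectralDensity γ) x j l = (realLimitCov γ x j l : ℂ) := by
  have hM := hx.isSpectralMeasure
  set a : ℂ := (2 * (Real.pi : ℂ))⁻¹ with ha
  have ha0 : a ≠ 0 := by
    rw [ha]
    simp [Real.pi_ne_zero]
  set φ : ℝ →+* ℂ := Complex.ofRealHom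
  have hF : matF x = a • (lagLimit x 0).map φ := by
    rw [matF]
    congr 1
    ext i k
    have h := hM.integral_expInt 0 i k
    rw [Matrix.map_apply]
    refine Eq.trans ?_ h
    simp [expInt, MatrixMeasure.integral]
  have hG : matG (spectralDensity γ) x = a • a • (longRunCov γ x).map φ := by
    rw [matG]
    congr 1
    ext i k
    rw [hM.integral_spectralDensity hγ i k]
    rfl
  have hinv : (matF x)⁻¹ = a⁻¹ • ((lagLimit x 0)⁻¹).map φ := by
    refine Matrix.inv_eq_right_inv ?_
    rw [hF, Matrix.smul_mul, Matrix.mul_smul, smul_smul, mul_inv_cancel₀ ha0, one_smul,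
      ← Matrix.map_mul, Matrix.mul_nonsing_inv _ (isUnit_iff_ne_zero.2 hx.posDef.det_pos.ne'),
      Matrix.map_one _ (map_zero φ) (map_one φ)]
  have hC : limitCov (spectralDensity γ) x = (realLimitCov γ x).map φ := by
    rw [limitCov, hinv, hG, realLimitCov, Matrix.map_mul, Matrix.map_mul]
    simp only [Matrix.smul_mul, Matrix.mul_smul, smul_smul]
    -- The two factors `(2π)⁻¹` in `G`, one from its normalization and one from `f`, cancel against
    -- those of the two inverses of `F`.
    rw [show a⁻¹ * (a * a * a⁻¹) = 1 by field_simp, one_smul]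
  rw [hC]
  rfl

end LimitCov

/-! ### Conditioning on the design -/

section Conditioning

variable {Ω α β : Type*} {mΩ : MeasurableSpace Ω} [mα : MeasurableSpace α] [MeasurableSpace β]
  {μ : Measure Ω} [IsProbabilityMeasure μ]

/-- The conditional expectation of `g(X, Z)` given `X`, for `Z` independent of `X`. -/
lemma condLExp_comap_of_indepFun {X : Ω → α} {Z : Ω → β} (hX : Measurable X) (hZ : Measurable Z)
    (hXZ : IndepFun X Z μ) {g : α × β → ℝ≥0∞} (hg : Measurable g) :
    (fun ω => ∫⁻ ω', g (X ω, Z ω') ∂μ) =ᵐ[μ]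
      condLExp (MeasurableSpace.comap X mα) μ (fun ω => g (X ω, Z ω)) := by
  have hle : MeasurableSpace.comap X mα ≤ mΩ := hX.comap_le
  have hG : Measurable fun a => ∫⁻ b, g (a, b) ∂(μ.map Z) := hg.lintegral_prod_right'
  have hGZ : ∀ a, ∫⁻ ω', g (a, Z ω') ∂μ = ∫⁻ b, g (a, b) ∂(μ.map Z) := fun a =>
    (lintegral_map (hg.comp measurable_prodMk_left) hZ).symm
  simp only [hGZ]
  have := Measure.isProbabilityMeasure_map (μ := μ) hX.aemeasurable
  have := Measure.isProbabilityMeasure_map (μ := μ) hZ.aemeasurable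
  refine ae_eq_condLExp hle μ _ (hG.comp (comap_measurable X)) ?_
  rintro s ⟨B, hB, rfl⟩
  -- Independence makes the joint law a product; Tonelli then identifies the set integrals over
  -- events determined by `X`.
  have hmap := (indepFun_iff_map_prod_eq_prod_map_map hX.aemeasurable hZ.aemeasurable).1 hXZ
  calc ∫⁻ ω in X ⁻¹' B, ∫⁻ b, g (X ω, b) ∂(μ.map Z) ∂μ
      = ∫⁻ a in B, ∫⁻ b, g (a, b) ∂(μ.map Z) ∂(μ.map X) := (setLIntegral_map hB hG hX).symm
    _ = ∫⁻ q in B ×ˢ Set.univ, g q ∂((μ.map X).prod (μ.map Z)) := by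
        rw [setLIntegral_prod _ hg.aemeasurable, Measure.restrict_univ]
    _ = ∫⁻ q in B ×ˢ Set.univ, g q ∂(μ.map fun ω => (X ω, Z ω)) := by rw [hmap]
    _ = ∫⁻ ω in X ⁻¹' B, g (X ω, Z ω) ∂μ := by
        rw [setLIntegral_map (hB.prod MeasurableSet.univ) hg (hX.prodMk hZ)]
        congr 2
        ext ω
        simp

end Conditioning

/-! ### Measurable dependence of the estimator and of its limit on the data -/

section Measurability

variable {α : Type*} [MeasurableSpace α] {p : ℕ}

lemma measurable_mul_apply {ι κ τ : Type*} [Fintype κ] {A : α → Matrix ι κ ℝ}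
    {B : α → Matrix κ τ ℝ} (hA : ∀ i j, Measurable fun a => A a i j)
    (hB : ∀ i j, Measurable fun a => B a i j) (i : ι) (j : τ) :
    Measurable fun a => (A a * B a) i j := by
  simp only [Matrix.mul_apply]
  exact Finset.measurable_fun_sum _ fun k _ => (hA i k).mul (hB k j)

lemma measurable_matrix_det {A : α → Matrix (Fin p) (Fin p) ℝ}
    (hA : ∀ i j, Measurable fun a => A a i j) : Measurable fun a => (A a).det := by
  simp only [Matrix.det_apply']
  exact Finset.measurable_fun_sum _ fun σ _ => measurable_const.mul
    (Finset.measurable_fun_prod _ fun i _ => hA _ _)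

lemma measurable_inv_apply {A : α → Matrix (Fin p) (Fin p) ℝ}
    (hA : ∀ i j, Measurable fun a => A a i j) (i j : Fin p) :
    Measurable fun a => (A a)⁻¹ i j := by
  simp only [Matrix.inv_def, Matrix.smul_apply, Ring.inverse_eq_inv', smul_eq_mul,
    Matrix.adjugate_apply]
  refine (measurable_matrix_det hA).inv.mul (measurable_matrix_det fun k l => ?_)
  simp only [Matrix.updateRow_apply]
  split_ifs
  · exact measurable_const
  · exact hA k l

variable {x : α → ℕ → Fin p → ℝ}

lemma measurable_colNorm (hx : ∀ i j, Measurable fun a => x a i j) (n : ℕ) (j : Fin p) :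
    Measurable fun a => colNorm (x a) n j :=
  (Finset.measurable_fun_sum _ fun i _ => (hx i j).pow_const 2).sqrt

lemma measurable_lagLimit (hx : ∀ i j, Measurable fun a => x a i j) (k : ℕ) (j l : Fin p) :
    Measurable fun a => lagLimit (x a) k j l := by
  have h : ∀ n, StronglyMeasurable fun a => lagCorr (x a) n k j l := fun n =>
    (Finset.measurable_fun_sum _ fun m _ => ((hx m j).mul (hx (m + k) l)).div
      ((measurable_colNorm hx n j).mul (measurable_colNorm hx n l))).stronglyMeasurable
  exact (StronglyMeasurable.limUnder h).measurable

lemma lagLimitInt_natCast (x : ℕ → Fin p → ℝ) (k : ℕ) : lagLimitInt x k = lagLimit x k := rfl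

lemma lagLimitInt_negSucc (x : ℕ → Fin p → ℝ) (k : ℕ) :
    lagLimitInt x (Int.negSucc k) = (lagLimit x (k + 1))ᵀ := rfl

lemma measurable_realLimitCov (hx : ∀ i j, Measurable fun a => x a i j) (γ : ℤ → ℝ)
    (j l : Fin p) : Measurable fun a => realLimitCov γ (x a) j l := by
  have hinv := measurable_inv_apply (fun i j => measurable_lagLimit hx 0 i j)
  have hint : ∀ (k : ℤ) (i m : Fin p), Measurable fun a => lagLimitInt (x a) k i m := by
    intro k i m
    cases k with
    | ofNat k =>
      simp only [Int.ofNat_eq_natCast, lagLimitInt_natCast]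
      exact measurable_lagLimit hx k i m
    | negSucc k =>
      simp only [lagLimitInt_negSucc, Matrix.transpose_apply]
      exact measurable_lagLimit hx (k + 1) m i
  have hlong : ∀ i m, Measurable fun a => longRunCov γ (x a) i m := fun i m =>
    (StronglyMeasurable.tsum fun k => ((hint k i m).const_mul (γ k)).stronglyMeasurable).measurable
  exact measurable_mul_apply (measurable_mul_apply hinv hlong) hinv j l

lemma measurable_covEstimator (hx : ∀ i j, Measurable fun a => x a i j) {y : α → ℕ → ℝ}
    (hy : ∀ i, Measurable fun a => y a i) (K : ℝ → ℝ) (h : ℝ) (n : ℕ) (j l : Fin p) :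
    Measurable fun a => covEstimator K h (x a) (y a) n j l := by
  have hX : ∀ i j, Measurable fun a => designMatrix (x a) n i j := fun i j => hx i j
  have hXt : ∀ i j, Measurable fun a => (designMatrix (x a) n)ᵀ i j := fun i j => hx j i
  have hG := measurable_inv_apply (measurable_mul_apply hXt hX)
  have hD : ∀ i j, Measurable fun a => colNormMatrix (x a) n i j := by
    intro i j
    simp only [colNormMatrix, Matrix.diagonal_apply]
    split_ifs
    · exact measurable_colNorm hx n i
    · exact measurable_const
  have hls : ∀ j, Measurable fun a => leastSquares (x a) (y a) n j := by
    intro j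
    simp only [leastSquares, Matrix.mulVec, dotProduct]
    exact Finset.measurable_fun_sum _ fun k _ => (hG j k).mul
      (Finset.measurable_fun_sum _ fun i _ => (hXt k i).mul (hy i))
  have hres : ∀ i, Measurable fun a => residual (x a) (y a) n i := fun i =>
    (hy i).sub (Finset.measurable_fun_sum _ fun j _ => (hx i j).mul (hls j))
  have hΓ : ∀ i j, Measurable fun a => taperedCov K h (residual (x a) (y a) n) n i j := by
    intro i j
    simp only [taperedCov, Matrix.of_apply, empAutocov]
    exact measurable_const.mul (measurable_const.mul
      (Finset.measurable_fun_sum _ fun k _ => (hres _).mul (hres _)))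
  exact measurable_mul_apply (measurable_mul_apply (measurable_mul_apply (measurable_mul_apply
    (measurable_mul_apply (measurable_mul_apply hD hG) hXt) hΓ) hX) hG) hD j l

end Measurability

/-! ### Consistency conditionally on the design -/

section Main

variable {Ω : Type*} {F₀ mΩ : MeasurableSpace Ω} {μ : Measure Ω} [IsProbabilityMeasure μ]
  {T : Ω ≃ᵐ Ω} {ε₀ : Ω → ℝ} {p : ℕ} {X : Ω → ℕ → Fin p → ℝ}

/-- Consistency of the estimator, conditionally on the design. -/
theorem IsHannanProcess.tendsto_condLExp_covEstimator (hε : IsHannanProcess F₀ μ T ε₀)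
    (hX : Measurable X) (hindep : IndepFun X (fun ω (i : ℤ) => process T ε₀ i ω) μ)
    (hdesign : ∀ᵐ ω ∂μ, IsHannanDesign (X ω)) {K : ℝ → ℝ} (hK : IsTaperKernel K) {h : ℕ → ℝ}
    (hpos : ∀ n, 0 < h n) (htop : Tendsto h atTop atTop)
    (hcond : Tendsto
      (fun n : ℕ => h n * ∫ ω, |ε₀ ω| ^ 2 * min 1 (h n / n * |ε₀ ω| ^ 2) ∂μ) atTop (𝓝 0))
    (β : Fin p → ℝ) (j l : Fin p) :
    ∀ᵐ ω ∂μ, Tendsto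
      (fun n : ℕ => condLExp (MeasurableSpace.comap X inferInstance) μ
        (fun ω' => ‖(covEstimator K (h n) (X ω') (response T ε₀ X β ω') n j l : ℂ)
          - limitCov (spectralDensity (autocov μ T ε₀)) (X ω') j l‖ₑ) ω)
      atTop (𝓝 0) := by
  set Z : Ω → ℤ → ℝ := fun ω i => process T ε₀ i ω with hZdef
  have hZ : Measurable Z := measurable_pi_lambda _ fun i => hε.measurable.comp (measurable_iter i)
  set g : ℕ → (ℕ → Fin p → ℝ) × (ℤ → ℝ) → ℝ≥0∞ := fun n q =>
    ‖((covEstimator K (h n) q.1 (fun i => ∑ j, q.1 i j * β j + q.2 (i + 1)) n j l : ℝ) : ℂ) -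
      ((realLimitCov (autocov μ T ε₀) q.1 j l : ℝ) : ℂ)‖ₑ with hgdef
  have hq1 : ∀ i k, Measurable fun q : (ℕ → Fin p → ℝ) × (ℤ → ℝ) => q.1 i k := fun i k =>
    (measurable_pi_apply k).comp ((measurable_pi_apply i).comp measurable_fst)
  have hq2 : ∀ i : ℤ, Measurable fun q : (ℕ → Fin p → ℝ) × (ℤ → ℝ) => q.2 i := fun i =>
    (measurable_pi_apply i).comp measurable_snd
  have hg : ∀ n, Measurable (g n) := fun n =>
    ((Complex.measurable_ofReal.comp (measurable_covEstimator hq1 (fun i =>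
      (Finset.measurable_fun_sum _ fun k _ => (hq1 i k).mul_const _).add (hq2 _)) K (h n) n j l)).sub
      (Complex.measurable_ofReal.comp (measurable_realLimitCov hq1 _ j l))).enorm
  have hcongr : ∀ n, condLExp (MeasurableSpace.comap X inferInstance) μ
      (fun ω' => ‖(covEstimator K (h n) (X ω') (response T ε₀ X β ω') n j l : ℂ)
          - limitCov (spectralDensity (autocov μ T ε₀)) (X ω') j l‖ₑ) =ᵐ[μ]
      fun ω => ∫⁻ ω', g n (X ω, Z ω') ∂μ := by
    intro n
    -- `limitCov` rests on a chosen spectral measure. For almost every design it equals its time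
    -- domain form, whose measurable dependence on the array is explicit; the substitution is made
    -- before independence is applied.
    refine (condLExp_congr_ae ?_).trans (condLExp_comap_of_indepFun hX hZ hindep (hg n)).symm
    filter_upwards [hdesign] with ω hω
    rw [hω.limitCov_eq hε.summable_autocov]
    rfl
  -- There are countably many `n`, so outside one null set every conditional expectation is the
  -- integral over the errors with the design frozen at `X ω`.
  filter_upwards [hdesign, ae_all_iff.2 hcongr] with ω hω hω'
  simp only [hω']
  exact hε.tendsto_lintegral_covEstimator_of_bandwidth hω hK hpos htop hcond β j l

end Main

end HannanRegression

end

open HannanRegression in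
/-- The last conjunct is the consistency; the conditional expectation given the design is that of a
nonnegative random variable, with values in `[0, ∞]`. The other conjuncts say that `f` is the
spectral density of the errors and that the spectral measure `F_X` of the design exists, so that the
limit `C = F⁻¹ G F⁻¹` is what it should be. -/
theorem theorem3p1 {Ω : Type*} (F₀ : MeasurableSpace Ω) [mΩ : MeasurableSpace Ω]
    (μ : Measure Ω) [IsProbabilityMeasure μ]
    (T : Ω ≃ᵐ Ω) (ε₀ : Ω → ℝ) (hε : IsHannanProcess F₀ μ T ε₀)
    {p : ℕ} (X : Ω → ℕ → Fin p → ℝ) (hX : Measurable X)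
    (hindep : IndepFun X (fun ω (i : ℤ) => process T ε₀ i ω) μ)
    (hdesign : ∀ᵐ ω ∂μ, IsHannanDesign (X ω))
    (K : ℝ → ℝ) (hK : IsTaperKernel K)
    (h : ℕ → ℝ) (hpos : ∀ n, 0 < h n) (htop : Tendsto h atTop atTop)
    (hcond : Tendsto
      (fun n : ℕ => h n * ∫ ω, |ε₀ ω| ^ 2 * min 1 (h n / n * |ε₀ ω| ^ 2) ∂μ) atTop (𝓝 0))
    (β : Fin p → ℝ) :
    Summable (fun k : ℤ => |autocov μ T ε₀ k|) ∧
    (∀ k : ℤ, (autocov μ T ε₀ k : ℂ) = ∫ t in (-Real.pi)..Real.pi,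
      Complex.exp (Complex.I * k * t) * spectralDensity (autocov μ T ε₀) t) ∧
    (∀ᵐ ω ∂μ, IsSpectralMeasure (lagLimit (X ω)) (spectralMeasure (X ω))) ∧
    ∀ j l : Fin p, ∀ᵐ ω ∂μ, Tendsto
      (fun n : ℕ => condLExp (MeasurableSpace.comap X inferInstance) μ
        (fun ω' => ‖(covEstimator K (h n) (X ω') (response T ε₀ X β ω') n j l : ℂ)
          - limitCov (spectralDensity (autocov μ T ε₀)) (X ω') j l‖ₑ) ω)
      atTop (𝓝 0) := by
  refine ⟨hε.summable_autocov, fun k => ?_, ?_, fun j l => ?_⟩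
  · exact integral_expInt_mul_spectralDensity hε.summable_autocov
      (autocov_neg hε.measurePreserving ε₀) k
  · filter_upwards [hdesign] with ω hω using hω.isSpectralMeasure
  · exact hε.tendsto_condLExp_covEstimator hX hindep hdesign hK hpos htop hcond β j l
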